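/- **Programs.** Integer expressions are $i ::= k \mid i\pm k \mid i/2 \mid |l|$ ($k\in\mathbb N$; $/2$ rounds up), Boolean expressions are built from comparisons of integers by Boolean connectives, qubit-list expressions are $l ::= \bar q \mid l\ominus[i] \mid l^{\boxminus} \mid l^{\boxplus}$ (variable; $l$ without its $i$-th element; first half, of $\lceil |l|/2\rceil$ elements, and second half of $l$, both empty if $|l|\le 1$; the value is the empty list if $i\notin\{1,\dots,|l|\}$), and a qubit expression $l[i]$ is the $i$-th element of $l$. Statements are $$S ::= \texttt{skip} \mid l[i]\mathrel{*}=U \mid S\,S \mid \texttt{if } b \texttt{ then } S \texttt{ else } S \mid \texttt{qcase } l[i] \texttt{ of } \{0\to S,\ 1\to S\} \mid \texttt{call } p(l_1,\dots,l_m),$$ where $U$ is $\mathrm{NOT}$, a phase gate $\mathrm{Ph}(g(j))=\mathrm{diag}(1,e^{\mathrm i g(j)})$ or a rotation $\mathrm R_Y(g(j))=\begin{pmatrix}\cos g(j)&-\sin g(j)\\ \sin g(j)&\cos g(j)\end{pmatrix}$, with $g:\mathbb Z\to[0,2\pi)$ and an integer expression $j$. A program $P$ consists of finitely many, possibly mutually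 recursive, procedure declarations, where the body of each procedure uses only the parameters of this procedure, and of a main statement over input variables $\bar q_1<\dots<\bar q_m$. The arguments of each call are sublists of pairwise distinct variables. A $\texttt{call}$ with an empty argument does nothing, other calls execute the body of the procedure with the arguments substituted for the parameters; $\texttt{qcase}$ executes its two branches in superposition, controlled by the qubit, which is not accessible inside the branches. An access to a non-existent or inaccessible qubit is an error; $P$ is *error-free* if no error occurs for any lengths of the inputs. For input lengths $|\bar q_1|,\dots,|\bar q_m|$ with sum $n$, $[\![P]\!]$ maps an input state of $n$ qubits to the final state, when $P$ terminates without an error. **PLP.** Write $p\sim p'$ if each of the procedures $p,p'$ can be reached from the other by one or more steps of the relation "the body of $p_1$ contains a call to $p_2$". $P$ is a *PLP program* if (1) for each call of $p'$ in the body of $p$ with $p\sim p'$, some argument of the call is cut in half, i.e. a half $l^{\boxminus}$ or $l^{\boxplus}$ appears in it (outside the integers that serve as indices), and (2) the body of every procedure $p$ has width at most $1$, where the width is $1$ for a call to some $p'\sim p$, $0$ for other calls, $\texttt{skip}$ and gates, the sum of the widths for a sequence, and the maximum of the widths of the two branches for $\texttt{if}$ and $\texttt{qcase}$. **Circuits.**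 A circuit on $n$ qubits with $a$ ancillas is a sequence of gates on $n+a$ wires; a gate is $\mathrm{NOT}$, $\mathrm{Ph}(\theta)$ or $\mathrm R_Y(\theta)$ on one wire with at most two (positive or negative) controls. Its size is the number of gates, its depth the number of time steps when gates on disjoint wires are executed in parallel. It implements a unitary $F$ if it maps $|\psi\rangle|0^a\rangle$ to $(F|\psi\rangle)|0^a\rangle$ for all $\psi$. A family of unitaries (on $n$ qubits each, for varying $n$) is in QNC if it is implemented by circuits of depth $O(\log^k n)$ for some $k$, with a number of ancillas polynomial in $n$. **Compilation by anchoring and merging.** Given $P$ and the lengths of its inputs, statements are compiled by induction, under a list of controls. Each variable is mapped to a list of wires, so that expressions can be evaluated. Gates are emitted with the current controls (a conjunction of several controls is computed in ancillas by Toffoli gates), sequences are concatenated, $\texttt{if}$ is resolved, the branches of a $\texttt{qcase}$ on a wire $w$ are compiled with the additional control $w=0$, respectively $w=1$, a call with an empty argument gives nothing, and the body of a non-recursive procedure is compiled in place. For a call to a recursive procedure $p$, a dictionary is maintained whose keys are pairs of a procedure $p'\sim p$ and the sizes of its arguments. A call whose key is new creates an anchoring ancilla, set by a multiply controlled NOT;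 a call whose key is present updates the anchoring ancilla of this key and sets a second ancilla, which controls a permutation that moves the qubits of its arguments to the wires of the arguments of the first call with this key. (A controlled permutation is realized by copying the control to fresh ancillas in logarithmic depth, and by two layers of disjoint controlled transpositions.) The keys are treated in decreasing order of the total size of the arguments: after the permutations for the merged calls, the body of the procedure is compiled once, under the control of the anchoring ancilla. Its part that precedes its call to a procedure $\sim p$ is put before, its part that follows the call after, the circuits for the keys treated later; finally permutations and ancillas are undone. **Theorem 4 (Compilation).** Let $P$ be a PLP program. There are constants $c,k\in\mathbb N$, depending only on $P$, such that for all input lengths with sum $n\ge 2$, the circuit produced by the compilation of $P$ for these lengths has size at most $c\,n\log^k n$ and depth at most $c\log^k n$ (where $\log n=\lfloor\log_2 n\rfloor$). If $P$ is error-free, then, for all input lengths, $P$ terminates on all input states, $[\![P]\!]$ is a unitary operator, and the circuit produced by the compilation implements $[\![P]\!]$; and the family of these operators, over all input lengths, is in QNC. Hence PLP programs compute QNC operators. -/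

import Mathlib

namespace PLP

/-! ## Syntax -/

/-- The four basic types of expressions. -/
inductive ETy
  | int
  | bool
  | list
  | qubit

/-- Expressions over the qubit-list variables `V`. Integers: constants `k`, `i + k`, `i - k`, `i / 2`
(rounded up) and `|l|`; Booleans; qubit lists: variables, removal of the `i`-th element, first half
and second half; qubits: the `i`-th element `l[i]` of a list (counted from `1`). -/
inductive Exp (V : Type) : ETy → Type
  | const (k : ℕ) : Exp V .int
  | add (i : Exp V .int) (k : ℕ) : Exp V .int
  | sub (i : Exp V .int) (k : ℕ) : Exp V .int
  | half (i : Exp V .int) : Exp V .int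
  | size (l : Exp V .list) : Exp V .int
  | ge (i j : Exp V .int) : Exp V .bool
  | eq (i j : Exp V .int) : Exp V .bool
  | and (b c : Exp V .bool) : Exp V .bool
  | or (b c : Exp V .bool) : Exp V .bool
  | not (b : Exp V .bool) : Exp V .bool
  | var (q : V) : Exp V .list
  | remove (l : Exp V .list) (i : Exp V .int) : Exp V .list
  | fstHalf (l : Exp V .list) : Exp V .list
  | sndHalf (l : Exp V .list) : Exp V .list
  | nth (l : Exp V .list) (i : Exp V .int) : Exp V .qubit

/-- The functions `g` from the integers to `[0, 2π)` that parametrize phase and rotation gates. -/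
abbrev AngleFn : Type := ℤ → Set.Ico (0 : ℝ) (2 * Real.pi)

/-- The unitary transformations `NOT`, `Ph^g(i)` and `R_Y^g(i)`. -/
inductive UnitaryExp (V : Type)
  | not : UnitaryExp V
  | ph (g : AngleFn) (i : Exp V .int) : UnitaryExp V
  | ry (g : AngleFn) (i : Exp V .int) : UnitaryExp V

/-- Statements over the variables `V`, in the presence of `N` procedures, of which the `p`-th one
takes `ar p` qubit lists as parameters. -/
inductive Stmt {N : ℕ} (ar : Fin N → ℕ) (V : Type) : Type
  | skip : Stmt ar V
  | app (q : Exp V .qubit) (U : UnitaryExp V) : Stmt ar V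
  | seq (S₀ S₁ : Stmt ar V) : Stmt ar V
  /-- `if b then {S₁} else {S₀}` -/
  | ite (b : Exp V .bool) (S₁ S₀ : Stmt ar V) : Stmt ar V
  /-- `qcase q of {0 → S₀, 1 → S₁}` -/
  | qcase (q : Exp V .qubit) (S₀ S₁ : Stmt ar V) : Stmt ar V
  | call (p : Fin N) (args : Fin (ar p) → Exp V .list) : Stmt ar V

/-- A program: finitely many (possibly mutually recursive) procedure declarations, the variables of
the body of each procedure being its parameters, and a program statement over the (ordered) input
variables `0 < 1 < ... < nvars - 1`. Procedure names are the elements of `Fin nprocs`. -/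
structure Program where
  nprocs : ℕ
  arity : Fin nprocs → ℕ
  body : (p : Fin nprocs) → Stmt arity (Fin (arity p))
  nvars : ℕ
  main : Stmt arity (Fin nvars)

/-- The variable of which a list expression denotes a sublist. -/
def Exp.base {V : Type} : Exp V .list → V
  | .var q => q
  | .remove l _ => l.base
  | .fstHalf l => l.base
  | .sndHalf l => l.base

/-- The variable to which the qubit denoted by a qubit expression belongs. -/
def Exp.qbase {V : Type} : Exp V .qubit → V
  | .nth l _ => l.base

/-- The no-cloning condition: the arguments of a call are sublists of distinct variables. -/
def Stmt.NoCloning {N : ℕ} {ar : Fin N → ℕ} {V : Type} : Stmt ar V → Prop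
  | .skip => True
  | .app _ _ => True
  | .seq S₀ S₁ => S₀.NoCloning ∧ S₁.NoCloning
  | .ite _ S₁ S₀ => S₁.NoCloning ∧ S₀.NoCloning
  | .qcase _ S₀ S₁ => S₀.NoCloning ∧ S₁.NoCloning
  | .call _ args => Function.Injective fun j => (args j).base

/-- The no-cloning condition, for all calls of a program. -/
def Program.NoCloning (P : Program) : Prop :=
  (∀ p, (P.body p).NoCloning) ∧ P.main.NoCloning

/-! ## Semantics of expressions, substitution -/

/-- The values of expressions. Qubits are pointers, qubit lists are lists of pointers. -/
abbrev ETy.Val : ETy → Type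
  | .int => ℤ
  | .bool => Bool
  | .list => List ℕ
  | .qubit => ℕ

/-- The value of an expression in the context `f`. The empty list and the pointer `0` stand for
errors. Note that `⌈m / 2⌉ = ⌊(m + 1) / 2⌋`. -/
def Exp.eval {V : Type} (f : V → List ℕ) : {τ : ETy} → Exp V τ → τ.Val
  | _, .const k => (k : ℤ)
  | _, .add i k => (i.eval f : ℤ) + (k : ℤ)
  | _, .sub i k => (i.eval f : ℤ) - (k : ℤ)
  | _, .half i => ((i.eval f : ℤ) + 1) / 2
  | _, .size l => ((l.eval f : List ℕ).length : ℤ)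
  | _, .ge i j => decide ((j.eval f : ℤ) ≤ (i.eval f : ℤ))
  | _, .eq i j => decide ((i.eval f : ℤ) = (j.eval f : ℤ))
  | _, .and b c => (b.eval f : Bool) && (c.eval f : Bool)
  | _, .or b c => (b.eval f : Bool) || (c.eval f : Bool)
  | _, .not b => !(b.eval f : Bool)
  | _, .var q => f q
  | _, .remove l i =>
      let xs : List ℕ := l.eval f
      let k : ℤ := i.eval f
      if 1 ≤ k ∧ k ≤ xs.length then xs.eraseIdx (k.toNat - 1) else []
  | _, .fstHalf l =>
      let xs : List ℕ := l.eval f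
      if 1 < xs.length then xs.take ((xs.length + 1) / 2) else []
  | _, .sndHalf l =>
      let xs : List ℕ := l.eval f
      if 1 < xs.length then xs.drop ((xs.length + 1) / 2) else []
  | _, .nth l i =>
      let xs : List ℕ := l.eval f
      let k : ℤ := i.eval f
      if 1 ≤ k ∧ k ≤ xs.length then xs.getD (k.toNat - 1) 0 else (0 : ℕ)

/-- Simultaneous substitution of list expressions for variables, in expressions. -/
def Exp.subst {V W : Type} (s : V → Exp W .list) : {τ : ETy} → Exp V τ → Exp W τ
  | _, .const k => .const k
  | _, .add i k => .add (i.subst s) k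
  | _, .sub i k => .sub (i.subst s) k
  | _, .half i => .half (i.subst s)
  | _, .size l => .size (l.subst s)
  | _, .ge i j => .ge (i.subst s) (j.subst s)
  | _, .eq i j => .eq (i.subst s) (j.subst s)
  | _, .and b c => .and (b.subst s) (c.subst s)
  | _, .or b c => .or (b.subst s) (c.subst s)
  | _, .not b => .not (b.subst s)
  | _, .var q => s q
  | _, .remove l i => .remove (l.subst s) (i.subst s)
  | _, .fstHalf l => .fstHalf (l.subst s)
  | _, .sndHalf l => .sndHalf (l.subst s)
  | _, .nth l i => .nth (l.subst s) (i.subst s)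

/-- Substitution in unitary transformations. -/
def UnitaryExp.subst {V W : Type} (s : V → Exp W .list) : UnitaryExp V → UnitaryExp W
  | .not => .not
  | .ph g i => .ph g (i.subst s)
  | .ry g i => .ry g (i.subst s)

/-- Substitution in statements. -/
def Stmt.subst {N : ℕ} {ar : Fin N → ℕ} {V W : Type} (s : V → Exp W .list) :
    Stmt ar V → Stmt ar W
  | .skip => .skip
  | .app q U => .app (q.subst s) (U.subst s)
  | .seq S₀ S₁ => .seq (S₀.subst s) (S₁.subst s)
  | .ite b S₁ S₀ => .ite (b.subst s) (S₁.subst s) (S₀.subst s)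
  | .qcase q S₀ S₁ => .qcase (q.subst s) (S₀.subst s) (S₁.subst s)
  | .call p args => .call p fun j => (args j).subst s

/-! ## Quantum states and one-qubit gates -/

/-- Vectors of the Hilbert space of `n` qubits, in the computational basis. -/
abbrev QState (n : ℕ) : Type := (Fin n → Fin 2) → ℂ

/-- One-qubit gates: `NOT`, phase gates and rotation gates. -/
inductive Op
  | not : Op
  | ph (θ : ℝ) : Op
  | ry (θ : ℝ) : Op

/-- The unitary matrix of a one-qubit gate. -/
noncomputable def Op.matrix : Op → Matrix (Fin 2) (Fin 2) ℂ
  | .not => !![0, 1; 1, 0]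
  | .ph θ => !![1, 0; 0, Complex.exp (θ * Complex.I)]
  | .ry θ => !![(Real.cos θ : ℂ), -(Real.sin θ : ℂ); (Real.sin θ : ℂ), (Real.cos θ : ℂ)]

/-- The gate denoted by a unitary transformation in the context `f`. -/
def UnitaryExp.eval {V : Type} (f : V → List ℕ) : UnitaryExp V → Op
  | .not => .not
  | .ph g i => .ph (g (i.eval f))
  | .ry g i => .ry (g (i.eval f))

/-- The value of the wire `w` in a basis state (wires are counted from `0`). -/
def getBit {n : ℕ} (x : Fin n → Fin 2) (w : ℕ) : Fin 2 := if h : w < n then x ⟨w, h⟩ else 0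

/-- The basis state obtained by giving the value `b` to the wire `w`. -/
def setBit {n : ℕ} (x : Fin n → Fin 2) (w : ℕ) (b : Fin 2) : Fin n → Fin 2 :=
  fun i => if (i : ℕ) = w then b else x i

/-- The matrix `U` applied to the wire `w`, i.e. the operator `I ⊗ U ⊗ I`. -/
noncomputable def applyAt {n : ℕ} (U : Matrix (Fin 2) (Fin 2) ℂ) (w : ℕ) (ψ : QState n) :
    QState n :=
  fun x => ∑ b : Fin 2, U (getBit x w) b * ψ (setBit x w b)

/-! ## Semantics of programs -/

/-- The total number of qubits. -/
def total {m : ℕ} (len : Fin m → ℕ) : ℕ := ∑ q, len q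

/-- The wire of the qubit of the variable `q` with pointer `k ≥ 1`; the variables are laid out in
increasing order. -/
def wire {m : ℕ} (len : Fin m → ℕ) (q : Fin m) (k : ℕ) : ℕ :=
  (∑ q' ∈ Finset.univ.filter (· < q), len q') + k - 1

/-- Termination `⊤` and error `⊥`. -/
inductive Outcome
  | top
  | bot

/-- The big-step semantics on inputs of lengths `len`: `Exec P len f S ψ A d ψ'` says that the
configuration `(S, ψ, A, f)` evaluates to `(d, ψ', A, f)`. Here `A q` is the set of accessible
pointers of the variable `q`, and `f q` is the list of pointers assigned to `q`. -/
inductive Exec (P : Program) (len : Fin P.nvars → ℕ) (f : Fin P.nvars → List ℕ) :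
    Stmt P.arity (Fin P.nvars) → QState (total len) → (Fin P.nvars → Set ℕ) →
      Outcome → QState (total len) → Prop
  | skip (ψ A) : Exec P len f .skip ψ A .top ψ
  | app_error (q U ψ A) (h : q.eval f ∉ A q.qbase) : Exec P len f (.app q U) ψ A .bot ψ
  | app (q U ψ A) (h : q.eval f ∈ A q.qbase) :
      Exec P len f (.app q U) ψ A .top
        (applyAt (U.eval f).matrix (wire len q.qbase (q.eval f)) ψ)
  | seq (S₀ S₁ ψ ψ' ψ'' A d) (h₀ : Exec P len f S₀ ψ A .top ψ')
      (h₁ : Exec P len f S₁ ψ' A d ψ'') : Exec P len f (.seq S₀ S₁) ψ A d ψ''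
  | seq_error (S₀ S₁ ψ ψ' A) (h₀ : Exec P len f S₀ ψ A .bot ψ') :
      Exec P len f (.seq S₀ S₁) ψ A .bot ψ'
  | ite (b S₁ S₀ ψ ψ' A d)
      (h : Exec P len f (if b.eval f = true then S₁ else S₀) ψ A d ψ') :
      Exec P len f (.ite b S₁ S₀) ψ A d ψ'
  | qcase (q S₀ S₁ ψ ψ₀ ψ₁ A) (h : q.eval f ∈ A q.qbase)
      (h₀ : Exec P len f S₀ ψ (Function.update A q.qbase (A q.qbase \ {q.eval f})) .top ψ₀)
      (h₁ : Exec P len f S₁ ψ (Function.update A q.qbase (A q.qbase \ {q.eval f})) .top ψ₁) :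
      Exec P len f (.qcase q S₀ S₁) ψ A .top
        (fun x => if getBit x (wire len q.qbase (q.eval f)) = 0 then ψ₀ x else ψ₁ x)
  | qcase_error₀ (q S₀ S₁ ψ ψ' A) (h : q.eval f ∈ A q.qbase)
      (h₀ : Exec P len f S₀ ψ (Function.update A q.qbase (A q.qbase \ {q.eval f})) .bot ψ') :
      Exec P len f (.qcase q S₀ S₁) ψ A .bot ψ
  | qcase_error₁ (q S₀ S₁ ψ ψ' A) (h : q.eval f ∈ A q.qbase)
      (h₁ : Exec P len f S₁ ψ (Function.update A q.qbase (A q.qbase \ {q.eval f})) .bot ψ') :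
      Exec P len f (.qcase q S₀ S₁) ψ A .bot ψ
  | qcase_error (q S₀ S₁ ψ A) (h : q.eval f ∉ A q.qbase) :
      Exec P len f (.qcase q S₀ S₁) ψ A .bot ψ
  | call (p args ψ ψ' A d) (hne : ∀ j, (args j).eval f ≠ [])
      (h : Exec P len f ((P.body p).subst args) ψ A d ψ') :
      Exec P len f (.call p args) ψ A d ψ'
  | call_empty (p args ψ A) (j) (he : (args j).eval f = []) :
      Exec P len f (.call p args) ψ A .top ψ

/-- The evaluation of the program from its initial configuration. -/
def Program.Run (P : Program) (len : Fin P.nvars → ℕ) (ψ : QState (total len)) (d : Outcome)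
    (ψ' : QState (total len)) : Prop :=
  Exec P len (fun q => List.range' 1 (len q)) P.main ψ (fun q => Set.Icc 1 (len q)) d ψ'

/-- The program never reaches an error, whatever the lengths of its inputs. -/
def Program.ErrorFree (P : Program) : Prop :=
  ∀ (len : Fin P.nvars → ℕ) (ψ ψ' : QState (total len)), ¬ P.Run len ψ .bot ψ'

/-- The operators `F len` are the semantics of the program: on each input state `ψ`, the program
terminates, in the final state `F len ψ` and in no other one. -/
def Program.Computes (P : Program)
    (F : (len : Fin P.nvars → ℕ) → Matrix.unitaryGroup (Fin (total len) → Fin 2) ℂ) : Prop :=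
  ∀ (len : Fin P.nvars → ℕ) (ψ ψ' : QState (total len)),
    P.Run len ψ .top ψ' ↔ ψ' = Matrix.mulVec (F len).1 ψ

/-! ## Polylogarithmic programs -/

/-- The procedures that are called in a statement. -/
def Stmt.callees {N : ℕ} {ar : Fin N → ℕ} {V : Type} : Stmt ar V → List (Fin N)
  | .skip => []
  | .app _ _ => []
  | .seq S₀ S₁ => S₀.callees ++ S₁.callees
  | .ite _ S₁ S₀ => S₁.callees ++ S₀.callees
  | .qcase _ S₀ S₁ => S₀.callees ++ S₁.callees
  | .call p _ => [p]

/-- The call relation between procedures. -/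
def Program.Calls (P : Program) (p q : Fin P.nprocs) : Prop := q ∈ (P.body p).callees

/-- Mutual recursion `p ∼ q`: each one is reachable from the other by the transitive closure of the
call relation. -/
def Program.MutRec (P : Program) (p q : Fin P.nprocs) : Prop :=
  Relation.TransGen P.Calls p q ∧ Relation.TransGen P.Calls q p

/-- A half `l⊟` or `l⊞` appears in a list expression (integers that serve as indices are not
inspected: a half that appears there does not shorten the list). -/
def Exp.Halves {V : Type} : Exp V .list → Prop
  | .var _ => False
  | .remove l _ => l.Halves
  | .fstHalf _ => True
  | .sndHalf _ => True

/-- Each call in the statement to a procedure satisfying `R` has an argument that is cut in half. -/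
def Stmt.HalvesCalls {N : ℕ} {ar : Fin N → ℕ} {V : Type} (R : Fin N → Prop) : Stmt ar V → Prop
  | .skip => True
  | .app _ _ => True
  | .seq S₀ S₁ => S₀.HalvesCalls R ∧ S₁.HalvesCalls R
  | .ite _ S₁ S₀ => S₁.HalvesCalls R ∧ S₀.HalvesCalls R
  | .qcase _ S₀ S₁ => S₀.HalvesCalls R ∧ S₁.HalvesCalls R
  | .call p args => R p → ∃ j, (args j).Halves

/-- Recursively halving programs. -/
def Program.RecHalving (P : Program) : Prop := ∀ p, (P.body p).HalvesCalls (P.MutRec p)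

/-- The width of a statement: the number of sequential calls to procedures satisfying `R`. -/
def Stmt.width {N : ℕ} {ar : Fin N → ℕ} {V : Type} (R : Fin N → Prop) [DecidablePred R] :
    Stmt ar V → ℕ
  | .skip => 0
  | .app _ _ => 0
  | .seq S₀ S₁ => S₀.width R + S₁.width R
  | .ite _ S₁ S₀ => max (S₁.width R) (S₀.width R)
  | .qcase _ S₀ S₁ => max (S₀.width R) (S₁.width R)
  | .call p _ => if R p then 1 else 0

/-- Paths of the relation `R` whose intermediate vertices are smaller than `k`. -/
def pathBelow {N : ℕ} (R : Fin N → Fin N → Bool) : ℕ → Fin N → Fin N → Bool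
  | 0, p, q => R p q
  | k + 1, p, q => pathBelow R k p q ||
      (if h : k < N then pathBelow R k p ⟨k, h⟩ && pathBelow R k ⟨k, h⟩ q else false)

theorem pathBelow_trans {N : ℕ} (R : Fin N → Fin N → Bool) (k : ℕ) (p q r : Fin N)
    (hr : (r : ℕ) < k) (h₁ : pathBelow R k p r = true) (h₂ : pathBelow R k r q = true) :
    pathBelow R k p q = true := by
  induction k generalizing p q r with
  | zero => omega
  | succ k ih =>
    rcases Nat.lt_succ_iff_lt_or_eq.mp hr with hr' | hr'
    · simp only [pathBelow] at *
      by_cases hk : k < N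
      · simp only [hk, dite_true, Bool.or_eq_true, Bool.and_eq_true] at *
        rcases h₁ with h₁ | ⟨h₁, h₁'⟩ <;> rcases h₂ with h₂ | ⟨h₂, h₂'⟩
        · exact Or.inl (ih _ _ _ hr' h₁ h₂)
        · exact Or.inr ⟨ih _ _ _ hr' h₁ h₂, h₂'⟩
        · exact Or.inr ⟨h₁, ih _ _ _ hr' h₁' h₂⟩
        · exact Or.inr ⟨h₁, h₂'⟩
      · simp only [hk, dite_false, Bool.or_false] at *
        exact ih _ _ _ hr' h₁ h₂
    · have hk : k < N := hr' ▸ r.isLt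
      obtain rfl : r = ⟨k, hk⟩ := Fin.ext hr'
      simp only [pathBelow, hk, dite_true, Bool.or_eq_true, Bool.and_eq_true] at *
      have h₁' : pathBelow R k p ⟨k, hk⟩ = true := by
        rcases h₁ with h₁ | h₁
        · exact h₁
        · exact h₁.1
      have h₂' : pathBelow R k ⟨k, hk⟩ q = true := by
        rcases h₂ with h₂ | h₂
        · exact h₂
        · exact h₂.2
      exact Or.inr ⟨h₁', h₂'⟩

theorem pathBelow_iff {N : ℕ} (R : Fin N → Fin N → Bool) (p q : Fin N) :
    pathBelow R N p q = true ↔ Relation.TransGen (fun a b => R a b = true) p q := by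
  constructor
  · have key : ∀ (k : ℕ) (p q : Fin N), pathBelow R k p q = true →
        Relation.TransGen (fun a b => R a b = true) p q := by
      intro k
      induction k with
      | zero => intro p q h; exact Relation.TransGen.single h
      | succ k ih =>
        intro p q h
        simp only [pathBelow, Bool.or_eq_true] at h
        rcases h with h | h
        · exact ih _ _ h
        · by_cases hk : k < N
          · simp only [hk, dite_true, Bool.and_eq_true] at h
            exact (ih _ _ h.1).trans (ih _ _ h.2)
          · simp [hk] at h
    exact key N p q
  · have base : ∀ (k : ℕ) (p q : Fin N), R p q = true → pathBelow R k p q = true := by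
      intro k
      induction k with
      | zero => intro p q h; exact h
      | succ k ih => intro p q h; simp [pathBelow, ih p q h]
    intro h
    induction h with
    | single h => exact base _ _ _ h
    | tail _ h ih => exact pathBelow_trans R N _ _ _ (Fin.isLt _) ih (base _ _ _ h)

instance Program.decidableMutRec (P : Program) (p q : Fin P.nprocs) : Decidable (P.MutRec p q) :=
  decidable_of_iff
    (pathBelow (fun a b => decide (b ∈ (P.body a).callees)) P.nprocs p q = true ∧
      pathBelow (fun a b => decide (b ∈ (P.body a).callees)) P.nprocs q p = true) (by
    simp only [pathBelow_iff, decide_eq_true_eq]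
    rfl)

/-- Polylogarithmic programs: recursively halving, and every procedure has width at most `1`. -/
def Program.IsPolyLog (P : Program) : Prop :=
  P.RecHalving ∧ ∀ p, (P.body p).width (P.MutRec p) ≤ 1

/-! ## Quantum circuits -/

/-- A one-qubit gate `op` applied to the wire `tgt`, under the condition that each wire `w` has the
value `b`, for all `(w, b)` in `ctls`. -/
structure Gate where
  ctls : List (ℕ × Fin 2)
  op : Op
  tgt : ℕ

/-- The wires of a gate. -/
def Gate.wires (g : Gate) : List ℕ := g.tgt :: g.ctls.map Prod.fst

/-- The operator of a gate on `n` wires. -/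
noncomputable def Gate.apply {n : ℕ} (g : Gate) (ψ : QState n) : QState n :=
  fun x => if ∀ c ∈ g.ctls, getBit x c.1 = c.2 then applyAt g.op.matrix g.tgt ψ x else ψ x

/-- A quantum circuit with `n` input wires `0, ..., n - 1` and the ancilla wires
`n, ..., n + ancillas - 1`: a sequence of gates, the first gate of the list being applied first. -/
structure Circuit (n : ℕ) where
  ancillas : ℕ
  gates : List Gate

/-- Only elementary gates are used: each gate acts on distinct wires of the circuit, with at most
two controls. -/
def Circuit.WellFormed {n : ℕ} (C : Circuit n) : Prop :=
  ∀ g ∈ C.gates, g.ctls.length ≤ 2 ∧ g.wires.Nodup ∧ ∀ w ∈ g.wires, w < n + C.ancillas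

/-- The operator of a circuit. -/
noncomputable def Circuit.apply {n : ℕ} (C : Circuit n) (ψ : QState (n + C.ancillas)) :
    QState (n + C.ancillas) :=
  C.gates.foldl (fun φ g => g.apply φ) ψ

/-- The state `ψ ⊗ |0...0⟩` with `a` ancillas. -/
def withAncillas {n : ℕ} (a : ℕ) (ψ : QState n) : QState (n + a) :=
  fun x => if ∀ i : Fin a, x (Fin.natAdd n i) = 0 then ψ (fun i => x (Fin.castAdd a i)) else 0

/-- The circuit implements the operator `F`, with ancillas that start and end in state `|0⟩`. -/
def Circuit.Implements {n : ℕ} (C : Circuit n)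
    (F : Matrix.unitaryGroup (Fin n → Fin 2) ℂ) : Prop :=
  C.WellFormed ∧ ∀ ψ : QState n,
    C.apply (withAncillas C.ancillas ψ) = withAncillas C.ancillas (Matrix.mulVec F.1 ψ)

/-- The size of a circuit is its number of gates. -/
def Circuit.size {n : ℕ} (C : Circuit n) : ℕ := C.gates.length

/-- The time steps `t w` at which the wires get free, and the number of time steps elapsed, after the
gate `g` is executed as soon as its wires are free. -/
def Gate.schedule (t : (ℕ → ℕ) × ℕ) (g : Gate) : (ℕ → ℕ) × ℕ :=
  let d := (g.wires.map t.1).foldr max 0 + 1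
  (fun w => if w ∈ g.wires then d else t.1 w, max t.2 d)

/-- The depth of a circuit: the number of time steps when gates on disjoint wires are executed in
parallel, each gate as soon as possible. -/
def Circuit.depth {n : ℕ} (C : Circuit n) : ℕ :=
  (C.gates.foldl Gate.schedule (fun _ => 0, 0)).2

/-- A family of unitary transformations `F i` on `n i` qubits is in `QNC` if it is implemented by
circuits of depth `O(log^k n)`, for some `k`, with a polynomial number of ancillas. -/
def QNC {I : Type} (n : I → ℕ) (F : (i : I) → Matrix.unitaryGroup (Fin (n i) → Fin 2) ℂ) : Prop :=
  ∃ (k d c : ℕ) (C : (i : I) → Circuit (n i)), ∀ i, (C i).Implements (F i) ∧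
    (2 ≤ n i → (C i).depth ≤ c * Nat.log 2 (n i) ^ k ∧ (C i).ancillas ≤ c * n i ^ d)

/-! ## Compilation

Fresh ancillas are allocated by a counter `next`, the smallest wire that is not in use. -/

/-- The gate `op` on the wire `t`, controlled by `c` and the list of controls: the conjunction of the
controls is computed in ancillas by Toffoli gates, and uncomputed afterwards. -/
def ctlChain (op : Op) (t : ℕ) : ℕ × Fin 2 → List (ℕ × Fin 2) → ℕ → List Gate × ℕ
  | c, [], next => ([⟨[c], op, t⟩], next)
  | c, d :: ds, next =>
      let r := ctlChain op t (next, 1) ds (next + 1)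
      (⟨[c, d], .not, next⟩ :: r.1 ++ [⟨[c, d], .not, next⟩], r.2)

/-- The gate `op` on the wire `t` under a list of controls, by elementary gates. -/
def multiCtl (op : Op) (t : ℕ) : List (ℕ × Fin 2) → ℕ → List Gate × ℕ
  | [], next => ([⟨[], op, t⟩], next)
  | c :: cs, next => ctlChain op t c cs next

/-- The wires `x` and `y` are swapped if the wire `c` has the value `1`. -/
def cswap (c x y : ℕ) : List Gate :=
  [⟨[(y, 1)], .not, x⟩, ⟨[(c, 1), (x, 1)], .not, y⟩, ⟨[(y, 1)], .not, x⟩]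

/-- A controlled permutation: if the wire `b` has the value `1`, the qubits on the wires `src` are
moved to the wires `dst` (two lists of the same length, which may overlap). The control is copied in
logarithmic depth to as many ancillas as there are qubits to be moved; then two sets of disjoint
controlled transpositions are applied, which move the qubits from `src` to fresh ancillas, and from
there to `dst`. -/
def ctlPerm (b : ℕ) (src dst : List ℕ) (next : ℕ) : List Gate × ℕ :=
  let K := src.length
  let copy : ℕ → ℕ := fun j => if j = 0 then b else next + (j - 1)
  let fanOut : List Gate :=
    (List.range K).map fun j => ⟨[(copy ((j + 1) / 2), 1)], .not, copy (j + 1)⟩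
  let move₁ : List Gate :=
    (List.range K).flatMap fun j => cswap (copy (j + 1)) (src.getD j 0) (next + K + j)
  let move₂ : List Gate :=
    (List.range K).flatMap fun j => cswap (copy (j + 1)) (next + K + j) (dst.getD j 0)
  (fanOut ++ move₁ ++ move₂, next + 2 * K)

/-- An entry of the dictionary: a procedure and the wires of its arguments at the first call with
these sizes (an entry serves all the calls to the same procedure with arguments of the same sizes),
the anchoring ancilla, and, for each further call that is merged with the first one, an ancilla that
controls the permutation of qubits, and the wires of the arguments of this call. -/
structure Entry {N : ℕ} (ar : Fin N → ℕ) where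
  proc : Fin N
  args : Fin (ar proc) → List ℕ
  anchor : ℕ
  merged : List (ℕ × List ℕ)

/-- The sizes of the arguments of a call. -/
def sizes {m : ℕ} (args : Fin m → List ℕ) : List ℕ := List.ofFn fun j => (args j).length

/-- All the wires of the arguments of a call. -/
def allWires {m : ℕ} (args : Fin m → List ℕ) : List ℕ := (List.ofFn args).flatten

/-- The entry serves the calls to `p` with arguments of the given sizes. -/
def Entry.serves {N : ℕ} {ar : Fin N → ℕ} (e : Entry ar) (p : Fin N) (s : List ℕ) : Bool :=
  decide (e.proc = p) && decide (sizes e.args = s)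

/-- The state of the compiler: the next fresh ancilla, and the dictionary. -/
structure CState {N : ℕ} (ar : Fin N → ℕ) where
  next : ℕ
  dict : List (Entry ar)

/-- The output of the compiler: the gates that precede the pending calls of the dictionary, those
that follow them, and the state of the compiler. -/
structure Output {N : ℕ} (ar : Fin N → ℕ) where
  pre : List Gate
  post : List Gate
  state : CState ar

/-- Compilation of a recursive call under the controls `cs`. If the dictionary has no entry for this
procedure and these sizes, an anchoring ancilla is created, and set by the controls (anchoring).
Otherwise the existing anchoring ancilla is updated, and a second ancilla is set, which will control
the permutation of qubits (merging). The ancillas are reset after the call. -/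
def anchorMerge {N : ℕ} {ar : Fin N → ℕ} (p : Fin N) (args : Fin (ar p) → List ℕ)
    (cs : List (ℕ × Fin 2)) (s : CState ar) : Output ar :=
  match s.dict.find? (fun e => e.serves p (sizes args)) with
  | none =>
      let r := multiCtl .not s.next cs (s.next + 1)
      ⟨r.1, r.1.reverse, ⟨r.2, s.dict ++ [⟨p, args, s.next, []⟩]⟩⟩
  | some e =>
      let r₁ := multiCtl .not e.anchor cs (s.next + 1)
      let r₂ := multiCtl .not s.next cs r₁.2
      ⟨r₁.1 ++ r₂.1, (r₁.1 ++ r₂.1).reverse, ⟨r₂.2, s.dict.map fun e' =>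
        if e'.serves p (sizes args) then
          { e' with merged := e'.merged ++ [(s.next, allWires args)] }
        else e'⟩⟩

/-- Compilation of a statement under the controls `cs`, where `f` maps the variables to lists of
wires. Calls to the procedures satisfying `R` are anchored or merged; the other calls are compiled by
`compileCall`. -/
def Stmt.compile {N : ℕ} {ar : Fin N → ℕ}
    (compileCall : (p : Fin N) → (Fin (ar p) → List ℕ) → List (ℕ × Fin 2) → ℕ → List Gate × ℕ)
    (R : Fin N → Prop) [DecidablePred R] {V : Type} (f : V → List ℕ) :
    Stmt ar V → List (ℕ × Fin 2) → CState ar → Output ar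
  | .skip, _, s => ⟨[], [], s⟩
  | .app q U, cs, s =>
      let r := multiCtl (U.eval f) (q.eval f) cs s.next
      ⟨r.1, [], ⟨r.2, s.dict⟩⟩
  | .seq S₀ S₁, cs, s =>
      let r₀ := S₀.compile compileCall R f cs s
      let r₁ := S₁.compile compileCall R f cs r₀.state
      if S₀.width R = 0 then ⟨r₀.pre ++ r₀.post ++ r₁.pre, r₁.post, r₁.state⟩
      else ⟨r₀.pre, r₀.post ++ r₁.pre ++ r₁.post, r₁.state⟩
  | .ite b S₁ S₀, cs, s =>
      if b.eval f = true then S₁.compile compileCall R f cs s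
      else S₀.compile compileCall R f cs s
  | .qcase q S₀ S₁, cs, s =>
      let r₀ := S₀.compile compileCall R f (cs ++ [(q.eval f, 0)]) s
      let r₁ := S₁.compile compileCall R f (cs ++ [(q.eval f, 1)]) r₀.state
      ⟨r₀.pre ++ r₁.pre, r₁.post ++ r₀.post, r₁.state⟩
  | .call p args, cs, s =>
      if ∃ j, (args j).eval f = [] then ⟨[], [], s⟩
      else if R p then anchorMerge p (fun j => (args j).eval f) cs s
      else
        let r := compileCall p (fun j => (args j).eval f) cs s.next
        ⟨r.1, [], ⟨r.2, s.dict⟩⟩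

/-- The controlled permutations for all the calls merged in an entry. -/
def ctlPerms (dst : List ℕ) : List (ℕ × List ℕ) → ℕ → List Gate × ℕ
  | [], next => ([], next)
  | m :: ms, next =>
      let r := ctlPerm m.1 m.2 dst next
      let r' := ctlPerms dst ms r.2
      (r.1 ++ r'.1, r'.2)

/-- Compilation of the procedure bodies of a list of entries, each one under the control of its
anchoring ancilla, after the permutations for the merged calls. -/
def Program.compileEntries (P : Program)
    (compileCall : (p : Fin P.nprocs) → (Fin (P.arity p) → List ℕ) → List (ℕ × Fin 2) → ℕ →
      List Gate × ℕ)
    (R : Fin P.nprocs → Prop) [DecidablePred R] :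
    List (Entry P.arity) → CState P.arity → Output P.arity
  | [], s => ⟨[], [], s⟩
  | e :: es, s =>
      let π := ctlPerms (allWires e.args) e.merged s.next
      let r := (P.body e.proc).compile compileCall R e.args [(e.anchor, 1)] ⟨π.2, s.dict⟩
      let r' := P.compileEntries compileCall R es r.state
      ⟨π.1 ++ r.pre ++ r'.pre, r'.post ++ r.post ++ π.1.reverse, r'.state⟩

/-- Compilation of the pending calls of the dictionary with arguments of total size at most `t`, in
decreasing order of this size. -/
def Program.compileDict (P : Program)
    (compileCall : (p : Fin P.nprocs) → (Fin (P.arity p) → List ℕ) → List (ℕ × Fin 2) → ℕ →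
      List Gate × ℕ)
    (R : Fin P.nprocs → Prop) [DecidablePred R] :
    ℕ → CState P.arity → List Gate × ℕ
  | 0, s => ([], s.next)
  | t + 1, s =>
      let es := s.dict.filter fun e => (allWires e.args).length = t + 1
      let rest := s.dict.filter fun e => (allWires e.args).length ≠ t + 1
      let r := P.compileEntries compileCall R es ⟨s.next, rest⟩
      let r' := P.compileDict compileCall R t r.state
      (r.pre ++ r'.1 ++ r.post, r'.2)

/-- Compilation of a procedure call under the controls `cs`: the body of a non-recursive procedure is
compiled in place; a recursive call is compiled by anchoring and merging, with a new dictionary. The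
first argument bounds the number of nested calls to procedures that are not mutually recursive. -/
def Program.compileCall (P : Program) : ℕ → (p : Fin P.nprocs) → (Fin (P.arity p) → List ℕ) →
    List (ℕ × Fin 2) → ℕ → List Gate × ℕ
  | 0, _, _, _, next => ([], next)
  | d + 1, p, args, cs, next =>
      if P.MutRec p p then
        let r := anchorMerge p args cs ⟨next, []⟩
        let r' := P.compileDict (P.compileCall d) (P.MutRec p) (allWires args).length r.state
        (r.pre ++ r'.1 ++ r.post, r'.2)
      else
        let r := (P.body p).compile (P.compileCall d) (fun _ => False) args cs ⟨next, []⟩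
        (r.pre ++ r.post, r.state.next)

/-- The circuit produced by the compilation of the program for inputs of lengths `len`. -/
def Program.compile (P : Program) (len : Fin P.nvars → ℕ) : Circuit (total len) :=
  let r := P.main.compile (P.compileCall P.nprocs) (fun _ => False)
    (fun q => (List.range' 1 (len q)).map (wire len q)) [] ⟨total len, []⟩
  ⟨r.state.next - total len, r.pre ++ r.post⟩

end PLP

/-! The reference object is the unrolling of the program. A call inside a class of mutually
recursive procedures has a halved argument, so the total size of its arguments drops
(`sum_length_eval_lt`), while any other call goes down in the call graph (`Program.rank_lt`). By
`Program.need_lt` every statement therefore unrolls into a finite tree of gates, sequences and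
quantum cases on wires. The big-step semantics follows this tree (`executes_main`): it ends in the
product of the gates of the tree if all wires used are accessible, and in an error otherwise.
Unitarity is inherited from the gates (`exists_unitary`).

Circuits are studied as linear maps on finite superpositions of bit sequences indexed by all of `ℕ`.
Ancillas need no declaration there, and an identity between circuits is checked on one basis state
at a time (`lin_agree`).

Merging is sound because expressions see lists only through lengths and positions (`Exp.evalMap`):
two calls of a procedure with equal argument sizes unroll to trees that differ by a renaming of
wires (`Program.unroll_map`, `args_eq_map_relabel`). Moving the qubits, running the first tree and
moving them back is the same as running the second tree (`flips_ctlPerms_active`, `run_conj`). A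
dictionary is given a meaning by the ideal circuit `spec`, in which every announced call is executed
under its ancillas. The invariant `StmtSpec` says that `pre`, then `spec`, then `post` equals the
unrolled statement. Width at most `1` enters twice: in a sequence only one side announces calls, so
the other side can be placed entirely before or after them; and in each basis state at most one call
is pending (`Conf`), so the order of the entries is irrelevant and calls with the same key can share
one body. `EntriesSpec` replaces the ideal calls of some entries by compiled bodies. These announce
only strictly smaller calls, hence `run_compileDict` exhausts the dictionary as the size bound
decreases to zero.

For the cost, `Cost n gs k` bounds the size by `k * n` and the depth by `k * log n`, and is additive
under concatenation. A body is compiled once per key, and each merged call adds one controlled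
permutation, which is a constant in this unit (`cost_ctlPerm`). Everything thus rests on the number
of keys being polylogarithmic. Each recursive call consumes one unit of the sum of the rounded-up
logarithms of the argument lengths (`halvings_eval_lt`), so chains of calls have length `O(log n)`.
After `k` calls, each size is within `O(k)` of some `N / 2 ^ a` with `a = O(k)`, where `N` is a size
at the root (`Exp.sizeAt_eval`). This leaves polynomially many tuples in `log n` (`card_keySet_le`).
The amortized count `callCost_compileDict` and an induction over the nesting of recursion classes
(`callCost_compileCall`) give the bounds. -/

namespace PLP

/-! ## Circuits on infinitely many wires -/

/-- Basis states of infinitely many wires. -/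
abbrev Bits : Type := ℕ → Fin 2

/-- Finite superpositions of basis states of infinitely many wires. -/
abbrev St : Type := Bits →₀ ℂ

/-- The basis state `x`, as a vector. -/
noncomputable abbrev ket (x : Bits) : St := Finsupp.single x 1

/-- The superpositions of the basis states in `V`. -/
noncomputable abbrev On (V : Set Bits) : Submodule ℂ St := Finsupp.supported ℂ ℂ V

theorem ket_mem_On {V : Set Bits} {x : Bits} (h : x ∈ V) : ket x ∈ On V :=
  Finsupp.single_mem_supported ℂ 1 h

theorem On_mono {V W : Set Bits} (h : ∀ x ∈ V, x ∈ W) {ψ : St} (hψ : ψ ∈ On V) : ψ ∈ On W :=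
  Finsupp.supported_mono h hψ

/-- Linearity reduces an identity of circuits to basis states. The set `V` carries what is known
about the wires at that moment, for instance that ancillas are `0` or that controls hold. -/
theorem lin_agree {L M : St →ₗ[ℂ] St} {V : Set Bits} (h : ∀ x ∈ V, L (ket x) = M (ket x))
    {ψ : St} (hψ : ψ ∈ On V) : L ψ = M ψ := by
  rw [On, Finsupp.supported_eq_span_single] at hψ
  refine LinearMap.eqOn_span (f := L) (g := M) ?_ hψ
  rintro _ ⟨x, hx, rfl⟩
  exact h x hx

theorem lin_maps {L : St →ₗ[ℂ] St} {V W : Set Bits} (h : ∀ x ∈ V, L (ket x) ∈ On W)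
    {ψ : St} (hψ : ψ ∈ On V) : L ψ ∈ On W := by
  rw [On, Finsupp.supported_eq_span_single] at hψ
  have : Submodule.span ℂ ((fun i : Bits => (Finsupp.single i 1 : St)) '' V) ≤
      (On W).comap L := by
    rw [Submodule.span_le]
    rintro _ ⟨x, hx, rfl⟩
    exact h x hx
  exact this hψ

/-- All the controls are satisfied. -/
def Holds (cs : List (ℕ × Fin 2)) (x : Bits) : Prop := ∀ c ∈ cs, x c.1 = c.2

instance (cs : List (ℕ × Fin 2)) (x : Bits) : Decidable (Holds cs x) := by
  unfold Holds; infer_instance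

@[simp] theorem holds_nil (x : Bits) : Holds [] x := by simp [Holds]

@[simp] theorem holds_cons (c : ℕ × Fin 2) (cs : List (ℕ × Fin 2)) (x : Bits) :
    Holds (c :: cs) x ↔ x c.1 = c.2 ∧ Holds cs x := by simp [Holds]

@[simp] theorem holds_append (cs ds : List (ℕ × Fin 2)) (x : Bits) :
    Holds (cs ++ ds) x ↔ Holds cs x ∧ Holds ds x := by
  simp [Holds, or_imp, forall_and]

theorem holds_congr {cs : List (ℕ × Fin 2)} {x y : Bits} (h : ∀ c ∈ cs, y c.1 = x c.1) :
    Holds cs y ↔ Holds cs x := by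
  unfold Holds
  constructor <;> intro H c hc
  · rw [← h c hc]; exact H c hc
  · rw [h c hc]; exact H c hc

/-- The action of a gate on a basis state. -/
noncomputable def Gate.onBasis (g : Gate) (x : Bits) : St :=
  if Holds g.ctls x then
    ∑ b : Fin 2, g.op.matrix b (x g.tgt) • ket (Function.update x g.tgt b)
  else ket x

/-- The operator of a gate on infinitely many wires. -/
noncomputable def Gate.lin (g : Gate) : St →ₗ[ℂ] St := Finsupp.linearCombination ℂ g.onBasis

@[simp] theorem Gate.lin_ket (g : Gate) (x : Bits) : g.lin (ket x) = g.onBasis x := by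
  simp [Gate.lin]

/-- The operator of a sequence of gates on infinitely many wires. -/
noncomputable def run : List Gate → St →ₗ[ℂ] St
  | [] => LinearMap.id
  | g :: gs => run gs ∘ₗ g.lin

@[simp] theorem run_nil (ψ : St) : run [] ψ = ψ := rfl

@[simp] theorem run_cons (g : Gate) (gs : List Gate) (ψ : St) :
    run (g :: gs) ψ = run gs (g.lin ψ) := rfl

@[simp] theorem run_append (gs hs : List Gate) (ψ : St) :
    run (gs ++ hs) ψ = run hs (run gs ψ) := by
  induction gs generalizing ψ with
  | nil => rfl
  | cons g gs ih => simp [ih]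

theorem Gate.lin_mem (g : Gate) (x : Bits) :
    g.lin (ket x) ∈ On {y | ∀ w, g.tgt ≠ w → y w = x w} := by
  rw [Gate.lin_ket, Gate.onBasis]
  split_ifs with h
  · refine Submodule.sum_mem _ fun b _ => Submodule.smul_mem _ _ (ket_mem_On ?_)
    intro w hw
    exact Function.update_of_ne hw.symm _ _
  · exact ket_mem_On fun w _ => rfl

/-- Wires that are not a target keep their values. -/
theorem run_frame (gs : List Gate) (x : Bits) :
    run gs (ket x) ∈ On {y | ∀ w, (∀ g ∈ gs, g.tgt ≠ w) → y w = x w} := by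
  induction gs generalizing x with
  | nil => exact ket_mem_On fun w _ => rfl
  | cons g gs ih =>
    rw [run_cons]
    refine lin_maps (V := {y | ∀ w, g.tgt ≠ w → y w = x w}) ?_ (g.lin_mem x)
    intro y hy
    refine On_mono ?_ (ih y)
    intro z hz w hw
    rw [hz w fun g' hg' => hw g' (by simp [hg']), hy w (hw g (by simp))]

theorem run_mem {gs : List Gate} {x : Bits} {W : Set Bits}
    (h : ∀ y, (∀ w, (∀ g ∈ gs, g.tgt ≠ w) → y w = x w) → y ∈ W) : run gs (ket x) ∈ On W :=
  On_mono h (run_frame gs x)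

theorem run_id_of_forall {gs : List Gate} {V : Set Bits} (h : ∀ x ∈ V, run gs (ket x) = ket x)
    {ψ : St} (hψ : ψ ∈ On V) : run gs ψ = ψ :=
  lin_agree (M := LinearMap.id) h hψ

/-! ### Controlled NOT gates -/

/-- The gate is a NOT gate that does not control itself. -/
def Gate.IsNot (g : Gate) : Prop := g.op = .not ∧ ∀ c ∈ g.ctls, c.1 ≠ g.tgt

/-- The action of a controlled NOT gate on the basis states. -/
def Gate.flip (g : Gate) (x : Bits) : Bits :=
  if Holds g.ctls x then Function.update x g.tgt (x g.tgt + 1) else x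

theorem Gate.lin_not {g : Gate} (h : g.op = .not) (x : Bits) : g.lin (ket x) = ket (g.flip x) := by
  rw [Gate.lin_ket, Gate.onBasis, Gate.flip]
  split_ifs
  · rw [h, Fin.sum_univ_two]
    generalize x g.tgt = v
    fin_cases v <;> simp [Op.matrix]
  · rfl

theorem Gate.flip_flip {g : Gate} (h : g.IsNot) (x : Bits) : g.flip (g.flip x) = x := by
  unfold Gate.flip
  by_cases hx : Holds g.ctls x
  · have : Holds g.ctls (Function.update x g.tgt (x g.tgt + 1)) :=
      (holds_congr fun c hc => Function.update_of_ne (h.2 c hc) _ _).mpr hx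
    simp only [hx, this, if_true, Function.update_self, Function.update_idem]
    have : x g.tgt + 1 + 1 = x g.tgt := by
      generalize x g.tgt = v; revert v; decide
    rw [this, Function.update_eq_self]
  · simp [hx]

theorem Gate.lin_lin {g : Gate} (h : g.IsNot) (ψ : St) : g.lin (g.lin ψ) = ψ := by
  have : ∀ x ∈ (Set.univ : Set Bits), (g.lin ∘ₗ g.lin) (ket x) =
      (LinearMap.id : St →ₗ[ℂ] St) (ket x) := by
    intro x _
    rw [LinearMap.comp_apply, g.lin_not h.1, g.lin_not h.1, Gate.flip_flip h]; rfl
  exact lin_agree (L := g.lin ∘ₗ g.lin) (M := LinearMap.id) this (by simp [On])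

/-- Each gate is its own inverse, because flipping the target does not change the truth of the
controls. This is how ancillas and permutations are undone. -/
theorem run_reverse_run {gs : List Gate} (h : ∀ g ∈ gs, g.IsNot) (ψ : St) :
    run gs.reverse (run gs ψ) = ψ := by
  induction gs generalizing ψ with
  | nil => rfl
  | cons g gs ih =>
    rw [List.reverse_cons, run_append, run_cons g gs, ih fun g hg => h g (by simp [hg])]
    exact Gate.lin_lin (h g (by simp)) ψ

/-- The action of a sequence of controlled NOT gates on the basis states. -/
def flips (gs : List Gate) (x : Bits) : Bits := gs.foldl (fun y g => g.flip y) x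

@[simp] theorem flips_nil (x : Bits) : flips [] x = x := rfl

@[simp] theorem flips_cons (g : Gate) (gs : List Gate) (x : Bits) :
    flips (g :: gs) x = flips gs (g.flip x) := rfl

@[simp] theorem flips_append (gs hs : List Gate) (x : Bits) :
    flips (gs ++ hs) x = flips hs (flips gs x) := by simp [flips]

theorem run_not {gs : List Gate} (h : ∀ g ∈ gs, g.op = .not) (x : Bits) :
    run gs (ket x) = ket (flips gs x) := by
  induction gs generalizing x with
  | nil => rfl
  | cons g gs ih =>
    rw [run_cons, g.lin_not (h g (by simp)), ih fun g hg => h g (by simp [hg]), flips_cons]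

/-! ### Renaming of wires, additional controls -/

/-- Renaming of the wires of a gate. -/
def Gate.rename (σ : ℕ → ℕ) (g : Gate) : Gate :=
  ⟨g.ctls.map fun c => (σ c.1, c.2), g.op, σ g.tgt⟩

/-- Additional controls. -/
def Gate.addCtls (cs : List (ℕ × Fin 2)) (g : Gate) : Gate := ⟨cs ++ g.ctls, g.op, g.tgt⟩

/-- On `Z`, reading or writing wire `w` after `L` is reading or writing wire `σ w` before `L`, so
gates can be pushed through `L` at the price of a renaming. The hypotheses concern only the wires of
the gates, which lets `L` do anything to the other ones. It serves for permutations of qubits, and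
with `σ = id` for the setting of ancillas. -/
theorem run_conj {gs : List Gate} {σ : ℕ → ℕ} {u : Bits → Bits} {L : St →ₗ[ℂ] St} {Z : Set Bits}
    (hL : ∀ x ∈ Z, L (ket x) = ket (u x))
    (h₁ : ∀ x ∈ Z, ∀ g ∈ gs, ∀ w ∈ g.wires, u x w = x (σ w))
    (h₂ : ∀ x ∈ Z, ∀ g ∈ gs, ∀ v, u (Function.update x (σ g.tgt) v) =
      Function.update (u x) g.tgt v ∧ Function.update x (σ g.tgt) v ∈ Z)
    {x : Bits} (hx : x ∈ Z) :
    run gs (L (ket x)) = L (run (gs.map (Gate.rename σ)) (ket x)) := by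
  induction gs generalizing x with
  | nil => rfl
  | cons g gs ih =>
    have key : g.lin (L (ket x)) = L ((g.rename σ).lin (ket x)) ∧
        (g.rename σ).lin (ket x) ∈ On Z := by
      have hh : Holds g.ctls (u x) ↔ Holds (g.rename σ).ctls x := by
        simp only [Holds, Gate.rename, List.mem_map]
        constructor
        · rintro H _ ⟨c, hc, rfl⟩
          rw [← H c hc, h₁ x hx g (by simp) c.1
            (by simp only [Gate.wires, List.mem_cons, List.mem_map]; exact Or.inr ⟨c, hc, rfl⟩)]
        · intro H c hc
          rw [h₁ x hx g (by simp) c.1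
            (by simp only [Gate.wires, List.mem_cons, List.mem_map]; exact Or.inr ⟨c, hc, rfl⟩)]
          exact H _ ⟨c, hc, rfl⟩
      rw [hL x hx, Gate.lin_ket, Gate.lin_ket, Gate.onBasis, Gate.onBasis]
      by_cases H : Holds g.ctls (u x)
      · rw [if_pos H, if_pos (hh.mp H)]
        have ht : u x g.tgt = x (σ g.tgt) := h₁ x hx g (by simp) _ (by simp [Gate.wires])
        constructor
        · rw [map_sum]
          refine Finset.sum_congr rfl fun b _ => ?_
          obtain ⟨h, h'⟩ := h₂ x hx g (by simp) b
          rw [map_smul]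
          simp only [Gate.rename]
          rw [hL _ h', h, ht]
        · refine Submodule.sum_mem _ fun b _ => Submodule.smul_mem _ _ (ket_mem_On ?_)
          exact (h₂ x hx g (by simp) b).2
      · rw [if_neg H, if_neg (fun h => H (hh.mpr h)), hL x hx]
        exact ⟨rfl, ket_mem_On hx⟩
    rw [run_cons, List.map_cons, run_cons, key.1]
    refine lin_agree (L := run gs ∘ₗ L) (M := L ∘ₗ run (gs.map (Gate.rename σ))) ?_ key.2
    intro y hy
    exact ih (fun x hx g hg => h₁ x hx g (by simp [hg])) (fun x hx g hg => h₂ x hx g (by simp [hg]))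
      hy

/-- No gate targets a control wire, so the truth of the controls is constant during the run and the
whole list is either applied or skipped. -/
theorem run_addCtls {gs : List Gate} {cs : List (ℕ × Fin 2)}
    (h : ∀ g ∈ gs, ∀ c ∈ cs, g.tgt ≠ c.1) (x : Bits) :
    run (gs.map (Gate.addCtls cs)) (ket x) = if Holds cs x then run gs (ket x) else ket x := by
  induction gs generalizing x with
  | nil => simp
  | cons g gs ih =>
    rw [List.map_cons, run_cons, run_cons]
    have hg : (g.addCtls cs).lin (ket x) = if Holds cs x then g.lin (ket x) else ket x := by
      simp only [Gate.lin_ket, Gate.onBasis, Gate.addCtls, holds_append]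
      by_cases H : Holds cs x <;> simp [H]
    rw [hg]
    have ih := ih fun g hg => h g (by simp [hg])
    by_cases H : Holds cs x
    · rw [if_pos H, if_pos H]
      refine lin_agree ?_ (g.lin_mem x)
      intro y hy
      rw [ih y, if_pos]
      exact (holds_congr fun c hc => hy c.1 (h g (by simp) c hc)).mpr H
    · rw [if_neg H, if_neg H, ih x, if_neg H]

/-! ### States of finitely many wires -/

/-- A basis state of `m` wires, the other wires having the value `0`. -/
def extend {m : ℕ} (x : Fin m → Fin 2) : Bits := fun w => getBit x w

theorem extend_injective {m : ℕ} : Function.Injective (extend (m := m)) := by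
  intro x y h
  funext i
  have := congrFun h i
  simpa [extend, getBit] using this

/-- A state of `m` wires, the other wires having the value `0`. -/
noncomputable def embed {m : ℕ} (ψ : QState m) : St := ∑ x, ψ x • ket (extend x)

open Classical in
theorem embed_apply {m : ℕ} (ψ : QState m) (z : Bits) :
    embed ψ z = if ∀ w, m ≤ w → z w = 0 then ψ (fun i => z i) else 0 := by
  rw [embed, Finsupp.finsetSum_apply]
  simp only [Finsupp.smul_apply, smul_eq_mul]
  split_ifs with h
  · have hz : extend (fun i : Fin m => z i) = z := by
      funext w
      by_cases hw : w < m
      · simp [extend, getBit, hw]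
      · simp [extend, getBit, hw, h w (by omega)]
    rw [Finset.sum_eq_single (fun i : Fin m => z i)]
    · rw [hz]; simp
    · intro x _ hx
      rw [Finsupp.single_eq_of_ne', mul_zero]
      intro hxz
      exact hx (extend_injective (hxz.trans hz.symm))
    · simp
  · refine Finset.sum_eq_zero fun x _ => ?_
    rw [Finsupp.single_eq_of_ne', mul_zero]
    rintro rfl
    exact h fun w hw => by simp [extend, getBit, Nat.not_lt.mpr hw]

theorem embed_injective {m : ℕ} : Function.Injective (embed (m := m)) := by
  intro φ ψ h
  funext x
  have := DFunLike.congr_fun h (extend x)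
  have hx : ∀ w, m ≤ w → extend x w = 0 := fun w hw => by
    simp [extend, getBit, Nat.not_lt.mpr hw]
  rw [embed_apply, embed_apply, if_pos hx, if_pos hx] at this
  simpa [extend, getBit] using this

theorem embed_mem {m : ℕ} (ψ : QState m) : embed ψ ∈ On {x | ∀ w, m ≤ w → x w = 0} := by
  refine Submodule.sum_mem _ fun x _ => Submodule.smul_mem _ _ (ket_mem_On ?_)
  intro w hw
  simp [extend, getBit, Nat.not_lt.mpr hw]

/-- On infinitely many wires, all wires beyond the inputs are `0` anyway, so appending ancillas in
state zero changes nothing. -/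
theorem embed_withAncillas {n : ℕ} (a : ℕ) (ψ : QState n) :
    embed (withAncillas a ψ) = embed ψ := by
  ext z
  rw [embed_apply, embed_apply]
  by_cases h : ∀ w, n ≤ w → z w = 0
  · rw [if_pos h, if_pos fun w hw => h w (by omega)]
    simp [withAncillas, h]
  · rw [if_neg h]
    split_ifs with h'
    · rw [withAncillas, if_neg]
      intro H
      apply h
      intro w hw
      by_cases hwa : w < n + a
      · have := H ⟨w - n, by omega⟩
        simpa [Nat.add_sub_cancel' hw] using this
      · exact h' w (by omega)
    · rfl

theorem getBit_setBit {m : ℕ} (x : Fin m → Fin 2) (t w : ℕ) (b : Fin 2) (ht : t < m) :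
    getBit (setBit x t b) w = if w = t then b else getBit x w := by
  unfold getBit setBit
  by_cases hw : w < m
  · simp [hw]
  · have : w ≠ t := by omega
    simp [hw, this]

theorem extend_setBit {m : ℕ} (x : Fin m → Fin 2) (t : ℕ) (b : Fin 2) (ht : t < m) :
    extend (setBit x t b) = Function.update (extend x) t b := by
  funext w
  rw [extend, getBit_setBit _ _ _ _ ht, Function.update_apply]
  rfl

theorem setBit_setBit {m : ℕ} (x : Fin m → Fin 2) (t : ℕ) (b c : Fin 2) :
    setBit (setBit x t b) t c = setBit x t c := by
  funext i; unfold setBit; split_ifs <;> rfl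

theorem setBit_getBit {m : ℕ} (x : Fin m → Fin 2) (t : ℕ) (ht : t < m) :
    setBit x t (getBit x t) = x := by
  funext i; unfold setBit getBit; split_ifs with h
  · subst h; rfl
  · rfl

/-- `Gate.apply` collects the amplitude at a basis state from its sources, `Gate.lin` distributes a
basis state over its images. The two double sums over pairs `(x, b)` match under the involution that
exchanges `b` with the target bit of `x`. -/
theorem embed_gate {m : ℕ} (g : Gate) (ht : g.tgt < m) (hc : ∀ c ∈ g.ctls, c.1 ≠ g.tgt)
    (ψ : QState m) : embed (g.apply ψ) = g.lin (embed ψ) := by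
  classical
  have hl : g.lin (embed ψ) = ∑ x, ψ x • g.onBasis (extend x) := by
    rw [embed, map_sum]
    refine Finset.sum_congr rfl fun x _ => ?_
    rw [map_smul, Gate.lin_ket]
  have hh : ∀ x : Fin m → Fin 2, (∀ c ∈ g.ctls, getBit x c.1 = c.2) ↔ Holds g.ctls (extend x) :=
    fun x => Iff.rfl
  have hs : ∀ (x : Fin m → Fin 2) b, Holds g.ctls (extend (setBit x g.tgt b)) ↔
      Holds g.ctls (extend x) := fun x b => holds_congr fun c h => by
    rw [extend_setBit _ _ _ ht, Function.update_of_ne (hc c h)]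
  rw [hl, embed]
  simp only [Gate.apply, Gate.onBasis, hh, applyAt]
  rw [← sub_eq_zero, ← Finset.sum_sub_distrib]
  have e1 : ∀ x : Fin m → Fin 2,
      ((if Holds g.ctls (extend x) then
        ∑ b, g.op.matrix (getBit x g.tgt) b * ψ (setBit x g.tgt b) else ψ x) • ket (extend x) -
      ψ x • (if Holds g.ctls (extend x) then
        ∑ b, g.op.matrix b (extend x g.tgt) • ket (Function.update (extend x) g.tgt b)
        else ket (extend x)) : St) =
      ∑ b : Fin 2, ((if Holds g.ctls (extend x) then
        (g.op.matrix (getBit x g.tgt) b * ψ (setBit x g.tgt b)) • ket (extend x) else 0) -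
       (if Holds g.ctls (extend x) then
        (g.op.matrix b (getBit x g.tgt) * ψ x) • ket (extend (setBit x g.tgt b)) else 0)) := by
    intro x
    split_ifs
    · rw [Finset.sum_smul, Finset.smul_sum, ← Finset.sum_sub_distrib]
      refine Finset.sum_congr rfl fun b _ => ?_
      rw [extend_setBit _ _ _ ht, smul_smul, mul_comm (ψ x)]
      rfl
    · simp
  rw [Finset.sum_congr rfl fun x _ => e1 x]
  simp only [Finset.sum_sub_distrib]
  rw [sub_eq_zero, ← Finset.sum_product', ← Finset.sum_product']
  refine Finset.sum_bij' (fun p _ => (setBit p.1 g.tgt p.2, getBit p.1 g.tgt))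
    (fun p _ => (setBit p.1 g.tgt p.2, getBit p.1 g.tgt)) ?_ ?_ ?_ ?_ ?_
  · simp
  · simp
  · rintro ⟨x, b⟩ _
    simp [setBit_setBit, getBit_setBit _ _ _ _ ht, setBit_getBit _ _ ht]
  · rintro ⟨x, b⟩ _
    simp [setBit_setBit, getBit_setBit _ _ _ _ ht, setBit_getBit _ _ ht]
  · rintro ⟨x, b⟩ _
    simp only [hs, setBit_setBit, getBit_setBit _ _ _ _ ht, setBit_getBit _ _ ht, if_true]

/-- The gate acts on distinct wires smaller than `m`, with at most two controls. -/
def Gate.Elementary (m : ℕ) (g : Gate) : Prop :=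
  g.ctls.length ≤ 2 ∧ g.wires.Nodup ∧ ∀ w ∈ g.wires, w < m

theorem Gate.ctl_ne_of_nodup {g : Gate} (h : g.wires.Nodup) : ∀ c ∈ g.ctls, c.1 ≠ g.tgt := by
  intro c hc he
  simp only [Gate.wires, List.nodup_cons, List.mem_map, not_exists, not_and] at h
  exact h.1 c hc he

theorem Gate.Elementary.mono {m m' : ℕ} (h : m ≤ m') {g : Gate} (hg : g.Elementary m) :
    g.Elementary m' :=
  ⟨hg.1, hg.2.1, fun w hw => (hg.2.2 w hw).trans_le h⟩

theorem embed_foldl {m : ℕ} {gs : List Gate} (h : ∀ g ∈ gs, g.wires.Nodup ∧ ∀ w ∈ g.wires, w < m)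
    (ψ : QState m) : embed (gs.foldl (fun φ g => g.apply φ) ψ) = run gs (embed ψ) := by
  induction gs generalizing ψ with
  | nil => rfl
  | cons g gs ih =>
    rw [List.foldl_cons, ih fun g hg => h g (by simp [hg]), run_cons, embed_gate]
    · exact (h g (by simp)).2 _ (by simp [Gate.wires])
    · exact Gate.ctl_ne_of_nodup (h g (by simp)).1

end PLP

namespace PLP

/-! ## Values of expressions -/

/-- The index of the qubit expression is within the bounds of the list. -/
def Exp.Valid {V : Type} (f : V → List ℕ) : Exp V .qubit → Prop
  | .nth l i => 1 ≤ (i.eval f : ℤ) ∧ (i.eval f : ℤ) ≤ (l.eval f : List ℕ).length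

instance {V : Type} (f : V → List ℕ) (q : Exp V .qubit) : Decidable (q.Valid f) := by
  cases q; unfold Exp.Valid; infer_instance

theorem Exp.index_lt {k : ℤ} {n : ℕ} (h₁ : 1 ≤ k) (h₂ : k ≤ n) : k.toNat - 1 < n := by omega

theorem Exp.eval_sublist {V : Type} (f : V → List ℕ) :
    (l : Exp V .list) → List.Sublist (l.eval f) (f l.base)
  | .var _ => by simp only [Exp.eval, Exp.base]; exact List.Sublist.refl _
  | .remove l i => by
      simp only [Exp.eval, Exp.base]
      split_ifs
      · exact (List.eraseIdx_sublist _ _).trans (l.eval_sublist f)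
      · exact List.nil_sublist _
  | .fstHalf l => by
      simp only [Exp.eval, Exp.base]
      split_ifs
      · exact (List.take_sublist _ _).trans (l.eval_sublist f)
      · exact List.nil_sublist _
  | .sndHalf l => by
      simp only [Exp.eval, Exp.base]
      split_ifs
      · exact (List.drop_sublist _ _).trans (l.eval_sublist f)
      · exact List.nil_sublist _

theorem Exp.eval_mem {V : Type} (f : V → List ℕ) {q : Exp V .qubit} (h : q.Valid f) :
    (q.eval f : ℕ) ∈ f q.qbase := by
  cases q with
  | nth l i =>
    have h' := h
    simp only [Exp.Valid] at h'
    simp only [Exp.eval, Exp.qbase]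
    rw [if_pos h']
    refine (l.eval_sublist f).subset ?_
    have hlt := Exp.index_lt h'.1 h'.2
    rw [List.getD_eq_getElem _ _ hlt]
    exact List.getElem_mem _

theorem Exp.eval_of_not_valid {V : Type} (f : V → List ℕ) {q : Exp V .qubit} (h : ¬ q.Valid f) :
    (q.eval f : ℕ) = 0 := by
  cases q with
  | nth l i =>
    simp only [Exp.Valid] at h
    simp only [Exp.eval]
    rw [if_neg h]

/-- The effect on the value of an expression of mapping the elements of the lists. -/
def Exp.EvalMap {V : Type} (f : V → List ℕ) (h : V → ℕ → ℕ) : {τ : ETy} → Exp V τ → Prop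
  | .int, e => (e.eval (fun v => (f v).map (h v)) : ℤ) = e.eval f
  | .bool, e => (e.eval (fun v => (f v).map (h v)) : Bool) = e.eval f
  | .list, e => (e.eval (fun v => (f v).map (h v)) : List ℕ) = (e.eval f : List ℕ).map (h e.base)
  | .qubit, e => (e.Valid (fun v => (f v).map (h v)) ↔ e.Valid f) ∧
      (e.Valid f → (e.eval (fun v => (f v).map (h v)) : ℕ) = h e.qbase (e.eval f))

/-- Expressions inspect lists only through lengths and positions; the elements are opaque. Hence
elementwise renaming, possibly different for each variable, commutes with evaluation. Qubits need a
valid index, since the error value `0` is not renamed. The same fact passes from pointers to wires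
and from one call to another call of the same sizes. -/
theorem Exp.evalMap {V : Type} (f : V → List ℕ) (h : V → ℕ → ℕ) {τ : ETy} (e : Exp V τ) :
    e.EvalMap f h := by
  induction e with
  | const k => rfl
  | add i k ih => simp only [Exp.EvalMap, Exp.eval] at *; rw [ih]
  | sub i k ih => simp only [Exp.EvalMap, Exp.eval] at *; rw [ih]
  | half i ih => simp only [Exp.EvalMap, Exp.eval] at *; rw [ih]
  | size l ih => simp only [Exp.EvalMap, Exp.eval] at *; rw [ih, List.length_map]
  | ge i j ih₁ ih₂ => simp only [Exp.EvalMap, Exp.eval] at *; rw [ih₁, ih₂]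
  | eq i j ih₁ ih₂ => simp only [Exp.EvalMap, Exp.eval] at *; rw [ih₁, ih₂]
  | and i j ih₁ ih₂ => simp only [Exp.EvalMap, Exp.eval] at *; rw [ih₁, ih₂]
  | or i j ih₁ ih₂ => simp only [Exp.EvalMap, Exp.eval] at *; rw [ih₁, ih₂]
  | not b ih => simp only [Exp.EvalMap, Exp.eval] at *; rw [ih]
  | var q => simp only [Exp.EvalMap, Exp.eval, Exp.base]
  | remove l i ih₁ ih₂ =>
    simp only [Exp.EvalMap, Exp.eval, Exp.base] at *
    rw [ih₁, ih₂, List.length_map]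
    split_ifs
    · rw [List.eraseIdx_map]
    · rfl
  | fstHalf l ih =>
    simp only [Exp.EvalMap, Exp.eval, Exp.base] at *
    rw [ih, List.length_map]
    split_ifs
    · rw [List.map_take]
    · rfl
  | sndHalf l ih =>
    simp only [Exp.EvalMap, Exp.eval, Exp.base] at *
    rw [ih, List.length_map]
    split_ifs
    · rw [List.map_drop]
    · rfl
  | nth l i ih₁ ih₂ =>
    simp only [Exp.EvalMap, Exp.eval, Exp.qbase, Exp.Valid] at *
    rw [ih₁, ih₂, List.length_map]
    refine ⟨Iff.rfl, fun H => ?_⟩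
    rw [if_pos H, if_pos H, List.getD_eq_getElem _ _ (by
        rw [List.length_map]; exact Exp.index_lt H.1 H.2),
      List.getD_eq_getElem _ _ (Exp.index_lt H.1 H.2), List.getElem_map]

theorem Exp.eval_subst {V W : Type} (s : V → Exp W .list) (f : W → List ℕ) {τ : ETy}
    (e : Exp V τ) : (e.subst s).eval f = e.eval fun v => (s v).eval f := by
  induction e <;> simp_all [Exp.subst, Exp.eval]

theorem Exp.valid_subst {V W : Type} (s : V → Exp W .list) (f : W → List ℕ) (q : Exp V .qubit) :
    (q.subst s).Valid f ↔ q.Valid fun v => (s v).eval f := by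
  cases q
  simp [Exp.subst, Exp.Valid, Exp.eval_subst]

theorem Exp.base_subst {V W : Type} (s : V → Exp W .list) :
    (l : Exp V .list) → (l.subst s).base = (s l.base).base
  | .var _ => by simp only [Exp.subst, Exp.base]
  | .remove l _ => by simpa only [Exp.subst, Exp.base] using l.base_subst s
  | .fstHalf l => by simpa only [Exp.subst, Exp.base] using l.base_subst s
  | .sndHalf l => by simpa only [Exp.subst, Exp.base] using l.base_subst s

theorem Exp.qbase_subst {V W : Type} (s : V → Exp W .list) (q : Exp V .qubit) :
    (q.subst s).qbase = (s q.qbase).base := by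
  cases q
  exact Exp.base_subst s _

theorem UnitaryExp.eval_subst {V W : Type} (s : V → Exp W .list) (f : W → List ℕ)
    (U : UnitaryExp V) : (U.subst s).eval f = U.eval fun v => (s v).eval f := by
  cases U <;> simp [UnitaryExp.subst, UnitaryExp.eval, Exp.eval_subst]

theorem UnitaryExp.eval_map {V : Type} (f : V → List ℕ) (h : V → ℕ → ℕ) (U : UnitaryExp V) :
    U.eval (fun v => (f v).map (h v)) = U.eval f := by
  cases U with
  | not => rfl
  | ph g i => simp only [UnitaryExp.eval]; rw [show i.eval _ = i.eval f from i.evalMap f h]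
  | ry g i => simp only [UnitaryExp.eval]; rw [show i.eval _ = i.eval f from i.evalMap f h]

/-- The decrease is strict because the value is nonempty: halves of lists of length at most `1` are
empty, and both halves of a longer list are proper. -/
theorem Exp.length_lt_of_halves {V : Type} (f : V → List ℕ) :
    (l : Exp V .list) → l.Halves → (l.eval f : List ℕ) ≠ [] →
      (l.eval f : List ℕ).length < (f l.base).length
  | .var _, h, _ => by simp only [Exp.Halves] at h
  | .remove l i, h, hne => by
      simp only [Exp.eval, Exp.base, Exp.Halves] at *
      split_ifs at hne ⊢ with hk
      · have hl : (l.eval f : List ℕ) ≠ [] := by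
          intro h0; rw [h0] at hk; simp at hk; omega
        exact (List.length_eraseIdx_le _ _).trans_lt (l.length_lt_of_halves f h hl)
      · exact absurd rfl hne
  | .fstHalf l, _, hne => by
      simp only [Exp.eval, Exp.base] at *
      have := (l.eval_sublist f).length_le
      split_ifs at hne ⊢ with hk
      · rw [List.length_take]; omega
      · exact absurd rfl hne
  | .sndHalf l, _, hne => by
      simp only [Exp.eval, Exp.base] at *
      have := (l.eval_sublist f).length_le
      split_ifs at hne ⊢ with hk
      · rw [List.length_drop]; omega
      · exact absurd rfl hne

/-! ### Arguments of calls -/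

/-- The lists consist of distinct wires smaller than `n`, and are disjoint. -/
structure Good (n : ℕ) {V : Type} (f : V → List ℕ) : Prop where
  nodup : ∀ v, (f v).Nodup
  lt : ∀ v, ∀ w ∈ f v, w < n
  disj : ∀ v v', v ≠ v' → (f v).Disjoint (f v')

theorem Good.eval {n : ℕ} {V : Type} {f : V → List ℕ} (hf : Good n f) {m : ℕ}
    {args : Fin m → Exp V .list} (h : Function.Injective fun j => (args j).base) :
    Good n fun j => (args j).eval f where
  nodup j := ((args j).eval_sublist f).nodup (hf.nodup _)
  lt j _ hw := hf.lt _ _ (((args j).eval_sublist f).subset hw)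
  disj j j' hj := fun _ hw hw' => hf.disj _ _ (fun e => hj (h e))
    (((args j).eval_sublist f).subset hw) (((args j').eval_sublist f).subset hw')

/-- The total size of the arguments of a call. -/
def tot {m : ℕ} (args : Fin m → List ℕ) : ℕ := ∑ j, (args j).length

theorem length_allWires {m : ℕ} (args : Fin m → List ℕ) : (allWires args).length = tot args := by
  rw [allWires, List.length_flatten, List.map_ofFn, List.sum_ofFn, tot]
  rfl

theorem mem_allWires {m : ℕ} {args : Fin m → List ℕ} {w : ℕ} :
    w ∈ allWires args ↔ ∃ j, w ∈ args j := by
  simp [allWires, List.mem_flatten, List.mem_ofFn]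

theorem Good.nodup_allWires {n m : ℕ} {args : Fin m → List ℕ} (h : Good n args) :
    (allWires args).Nodup := by
  rw [allWires, List.nodup_flatten]
  constructor
  · intro l hl
    obtain ⟨j, rfl⟩ := List.mem_ofFn.mp hl
    exact h.nodup j
  · rw [List.pairwise_ofFn]
    intro i j hij
    exact h.disj i j hij.ne

theorem Good.lt_allWires {n m : ℕ} {args : Fin m → List ℕ} (h : Good n args) :
    ∀ w ∈ allWires args, w < n := by
  intro w hw
  obtain ⟨j, hj⟩ := mem_allWires.mp hw
  exact h.lt j w hj

theorem sizes_eq_iff {m : ℕ} {a b : Fin m → List ℕ} :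
    sizes a = sizes b ↔ ∀ j, (a j).length = (b j).length := by
  rw [sizes, sizes, List.ofFn_inj, funext_iff]

theorem tot_eq_of_sizes_eq {m : ℕ} {a b : Fin m → List ℕ} (h : sizes a = sizes b) :
    tot a = tot b :=
  Finset.sum_congr rfl fun j _ => sizes_eq_iff.mp h j

/-- By no-cloning the arguments can be charged to distinct variables, each argument being a sublist
of its variable. -/
theorem sum_length_eval_le {m k : ℕ} {f : Fin k → List ℕ} {args : Fin m → Exp (Fin k) .list}
    (h : Function.Injective fun j => (args j).base) :
    tot (fun j => (args j).eval f) ≤ tot f := by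
  refine (Finset.sum_le_sum fun j _ => ((args j).eval_sublist f).length_le).trans ?_
  have := Finset.sum_map Finset.univ ⟨fun j => (args j).base, h⟩ fun v => (f v).length
  rw [tot]
  refine this.symm.le.trans (Finset.sum_le_sum_of_subset (Finset.subset_univ _))

theorem sum_length_eval_lt {m k : ℕ} {f : Fin k → List ℕ} {args : Fin m → Exp (Fin k) .list}
    (h : Function.Injective fun j => (args j).base) (hh : ∃ j, (args j).Halves)
    (hne : ∀ j, ((args j).eval f : List ℕ) ≠ []) :
    tot (fun j => (args j).eval f) < tot f := by
  obtain ⟨j, hj⟩ := hh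
  have h1 : tot (fun j => (args j).eval f) < ∑ j, (f (args j).base).length :=
    Finset.sum_lt_sum (fun j _ => ((args j).eval_sublist f).length_le)
      ⟨j, Finset.mem_univ _, (args j).length_lt_of_halves f hj (hne j)⟩
  have := Finset.sum_map Finset.univ ⟨fun j => (args j).base, h⟩ fun v => (f v).length
  refine h1.trans_le ?_
  rw [tot]
  refine this.symm.le.trans (Finset.sum_le_sum_of_subset (Finset.subset_univ _))

/-- The map of wires that sends the `j`-th wire of `dst` to the `j`-th wire of `src`. -/
def relabel (dst src : List ℕ) (w : ℕ) : ℕ := src.getD (dst.idxOf w) 0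

theorem relabel_getElem {dst src : List ℕ} (hd : dst.Nodup) (hl : dst.length = src.length) {j : ℕ}
    (hj : j < dst.length) : relabel dst src dst[j] = src[j] := by
  rw [relabel, hd.idxOf_getElem, List.getD_eq_getElem]

theorem map_relabel {dst src : List ℕ} (hd : dst.Nodup) (hl : dst.length = src.length) :
    dst.map (relabel dst src) = src := by
  refine List.ext_getElem (by simpa using hl) fun j h₁ h₂ => ?_
  rw [List.getElem_map, relabel_getElem hd hl]

/-- Equal sizes make the flattened lists equally long, and distinctness of the wires of `a` turns
the positional matching into a function on wires. Cutting the flattened list at the same lengths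
recovers the individual arguments. -/
theorem args_eq_map_relabel {m : ℕ} {a b : Fin m → List ℕ} (ha : (allWires a).Nodup)
    (h : sizes a = sizes b) :
    b = fun j => (a j).map (relabel (allWires a) (allWires b)) := by
  have hl : (allWires a).length = (allWires b).length := by
    rw [length_allWires, length_allWires, tot_eq_of_sizes_eq h]
  have := map_relabel ha hl
  generalize relabel (allWires a) (allWires b) = σ at this
  have e : List.ofFn b = List.ofFn fun j => (a j).map σ := by
    rw [List.eq_iff_flatten_eq]
    constructor
    · rw [allWires, List.map_flatten, List.map_ofFn] at this
      exact this.symm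
    · rw [List.map_ofFn, List.map_ofFn]
      congr 1
      funext j
      simp [sizes_eq_iff.mp h j]
  exact List.ofFn_injective e

/-! ### Calls in a statement -/

/-- The calls in a statement. -/
def Stmt.calls {N : ℕ} {ar : Fin N → ℕ} {V : Type} :
    Stmt ar V → List (Σ p : Fin N, Fin (ar p) → Exp V .list)
  | .skip => []
  | .app _ _ => []
  | .seq S₀ S₁ => S₀.calls ++ S₁.calls
  | .ite _ S₁ S₀ => S₁.calls ++ S₀.calls
  | .qcase _ S₀ S₁ => S₀.calls ++ S₁.calls
  | .call p args => [⟨p, args⟩]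

theorem Stmt.mem_callees_of_mem_calls {N : ℕ} {ar : Fin N → ℕ} {V : Type} {S : Stmt ar V}
    {c : Σ p : Fin N, Fin (ar p) → Exp V .list} (h : c ∈ S.calls) : c.1 ∈ S.callees := by
  induction S <;> simp_all [Stmt.calls, Stmt.callees] <;> tauto

theorem Stmt.NoCloning.of_mem_calls {N : ℕ} {ar : Fin N → ℕ} {V : Type} {S : Stmt ar V}
    (hS : S.NoCloning) {c : Σ p : Fin N, Fin (ar p) → Exp V .list} (h : c ∈ S.calls) :
    Function.Injective fun j => (c.2 j).base := by
  induction S with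
  | skip => simp [Stmt.calls] at h
  | app => simp [Stmt.calls] at h
  | seq S₀ S₁ h₀ h₁ =>
    rcases List.mem_append.mp h with h | h
    exacts [h₀ hS.1 h, h₁ hS.2 h]
  | ite b S₁ S₀ h₁ h₀ =>
    rcases List.mem_append.mp h with h | h
    exacts [h₁ hS.1 h, h₀ hS.2 h]
  | qcase q S₀ S₁ h₀ h₁ =>
    rcases List.mem_append.mp h with h | h
    exacts [h₀ hS.1 h, h₁ hS.2 h]
  | call p args =>
    obtain rfl := List.mem_singleton.mp h
    exact hS

theorem Stmt.HalvesCalls.of_mem_calls {N : ℕ} {ar : Fin N → ℕ} {V : Type} {R : Fin N → Prop}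
    {S : Stmt ar V} (hS : S.HalvesCalls R) {c : Σ p : Fin N, Fin (ar p) → Exp V .list}
    (h : c ∈ S.calls) (hR : R c.1) : ∃ j, (c.2 j).Halves := by
  induction S with
  | skip => simp [Stmt.calls] at h
  | app => simp [Stmt.calls] at h
  | seq S₀ S₁ h₀ h₁ =>
    rcases List.mem_append.mp h with h | h
    exacts [h₀ hS.1 h, h₁ hS.2 h]
  | ite b S₁ S₀ h₁ h₀ =>
    rcases List.mem_append.mp h with h | h
    exacts [h₁ hS.1 h, h₀ hS.2 h]
  | qcase q S₀ S₁ h₀ h₁ =>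
    rcases List.mem_append.mp h with h | h
    exacts [h₀ hS.1 h, h₁ hS.2 h]
  | call p args =>
    obtain rfl := List.mem_singleton.mp h
    exact hS hR

/-! ### The call graph -/

/-- The number of procedures that can be reached from `p`. -/
noncomputable def Program.rank (P : Program) (p : Fin P.nprocs) : ℕ :=
  {q | Relation.ReflTransGen P.Calls p q}.ncard

theorem Program.rank_le (P : Program) (p : Fin P.nprocs) : P.rank p ≤ P.nprocs := by
  refine (Set.ncard_le_ncard (Set.subset_univ _)).trans ?_
  simp [Set.ncard_univ]

theorem Program.rank_le_of_calls {P : Program} {p q : Fin P.nprocs}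
    (h : Relation.ReflTransGen P.Calls p q) : P.rank q ≤ P.rank p :=
  Set.ncard_le_ncard (fun _ hr => h.trans hr) (Set.toFinite _)

/-- What `q` reaches is also reached by `p`, but `p` itself is not reached from `q`: otherwise the
call would close a cycle and the two would be mutually recursive. -/
theorem Program.rank_lt {P : Program} {p q : Fin P.nprocs} (h : P.Calls p q)
    (hn : ¬ P.MutRec p q) : P.rank q < P.rank p := by
  refine Set.ncard_lt_ncard ?_ (Set.toFinite _)
  refine ⟨fun _ hr => (Relation.ReflTransGen.single h).trans hr, fun hs => ?_⟩
  have : Relation.ReflTransGen P.Calls q p := hs (Relation.ReflTransGen.refl)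
  rcases Relation.reflTransGen_iff_eq_or_transGen.mp this with e | e
  · subst e
    exact hn ⟨.single h, .single h⟩
  · exact hn ⟨.single h, e⟩

theorem Program.MutRec.symm {P : Program} {p q : Fin P.nprocs} (h : P.MutRec p q) :
    P.MutRec q p := ⟨h.2, h.1⟩

theorem Program.MutRec.trans {P : Program} {p q r : Fin P.nprocs} (h : P.MutRec p q)
    (h' : P.MutRec q r) : P.MutRec p r := ⟨h.1.trans h'.1, h'.2.trans h.2⟩

theorem Program.MutRec.rank_eq {P : Program} {p q : Fin P.nprocs} (h : P.MutRec p q) :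
    P.rank p = P.rank q :=
  le_antisymm (rank_le_of_calls h.2.to_reflTransGen) (rank_le_of_calls h.1.to_reflTransGen)

theorem Program.MutRec.congr {P : Program} {p q : Fin P.nprocs} (h : P.MutRec p q)
    (r : Fin P.nprocs) : P.MutRec p r ↔ P.MutRec q r :=
  ⟨fun h' => h.symm.trans h', fun h' => h.trans h'⟩

theorem Stmt.width_congr {N : ℕ} {ar : Fin N → ℕ} {V : Type} (S : Stmt ar V)
    {R R' : Fin N → Prop} [DecidablePred R] [DecidablePred R'] (h : ∀ p, R p ↔ R' p) :
    S.width R = S.width R' := by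
  induction S <;> simp_all [Stmt.width]

theorem Stmt.width_eq_zero_of_forall_not {N : ℕ} {ar : Fin N → ℕ} {V : Type} (S : Stmt ar V)
    {R : Fin N → Prop} [DecidablePred R] (h : ∀ p, ¬ R p) : S.width R = 0 := by
  induction S <;> simp_all [Stmt.width]

end PLP

namespace PLP

/-! ## Unrolling of programs -/

/-- Statements without calls and classical control, acting on wires. -/
inductive Tree
  | skip
  | err
  | gate (op : Op) (w : ℕ)
  | seq (t₀ t₁ : Tree)
  | qcase (w : ℕ) (t₀ t₁ : Tree)

/-- The tree causes no error if the wires in `A` are accessible. -/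
def Tree.Ok : Tree → Set ℕ → Prop
  | .skip, _ => True
  | .err, _ => False
  | .gate _ w, A => w ∈ A
  | .seq t₀ t₁, A => t₀.Ok A ∧ t₁.Ok A
  | .qcase w t₀ t₁, A => w ∈ A ∧ t₀.Ok (A \ {w}) ∧ t₁.Ok (A \ {w})

/-- The wires of the tree are in `A`. -/
def Tree.WiresIn (A : Set ℕ) : Tree → Prop
  | .skip => True
  | .err => True
  | .gate _ w => w ∈ A
  | .seq t₀ t₁ => t₀.WiresIn A ∧ t₁.WiresIn A
  | .qcase w t₀ t₁ => w ∈ A ∧ t₀.WiresIn A ∧ t₁.WiresIn A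

/-- The gates of the tree, with arbitrarily many controls. -/
def Tree.gates : Tree → List Gate
  | .skip => []
  | .err => []
  | .gate op w => [⟨[], op, w⟩]
  | .seq t₀ t₁ => t₀.gates ++ t₁.gates
  | .qcase w t₀ t₁ =>
      t₀.gates.map (Gate.addCtls [(w, 0)]) ++ t₁.gates.map (Gate.addCtls [(w, 1)])

/-- Renaming of the wires of a tree. -/
def Tree.rename (σ : ℕ → ℕ) : Tree → Tree
  | .skip => .skip
  | .err => .err
  | .gate op w => .gate op (σ w)
  | .seq t₀ t₁ => .seq (t₀.rename σ) (t₁.rename σ)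
  | .qcase w t₀ t₁ => .qcase (σ w) (t₀.rename σ) (t₁.rename σ)

theorem Tree.WiresIn.mono {A B : Set ℕ} (h : A ⊆ B) {t : Tree} (ht : t.WiresIn A) :
    t.WiresIn B := by
  induction t with
  | skip => trivial
  | err => trivial
  | gate op w => exact h ht
  | seq t₀ t₁ h₀ h₁ => exact ⟨h₀ ht.1, h₁ ht.2⟩
  | qcase w t₀ t₁ h₀ h₁ => exact ⟨h ht.1, h₀ ht.2.1, h₁ ht.2.2⟩

theorem Tree.Ok.wiresIn {A : Set ℕ} {t : Tree} (ht : t.Ok A) : t.WiresIn A := by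
  induction t generalizing A with
  | skip => trivial
  | err => trivial
  | gate op w => exact ht
  | seq t₀ t₁ h₀ h₁ => exact ⟨h₀ ht.1, h₁ ht.2⟩
  | qcase w t₀ t₁ h₀ h₁ =>
    exact ⟨ht.1, (h₀ ht.2.1).mono Set.sdiff_subset, (h₁ ht.2.2).mono Set.sdiff_subset⟩

theorem Tree.WiresIn.gates {A : Set ℕ} {t : Tree} (ht : t.WiresIn A) :
    ∀ g ∈ t.gates, ∀ w ∈ g.wires, w ∈ A := by
  induction t with
  | skip => simp [Tree.gates]
  | err => simp [Tree.gates]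
  | gate op w =>
    have hw : w ∈ A := ht
    simpa [Tree.gates, Gate.wires] using hw
  | seq t₀ t₁ h₀ h₁ =>
    intro g hg
    rcases List.mem_append.mp hg with hg | hg
    exacts [h₀ ht.1 g hg, h₁ ht.2 g hg]
  | qcase w t₀ t₁ h₀ h₁ =>
    intro g hg
    rcases List.mem_append.mp hg with hg | hg
    all_goals
      obtain ⟨g', hg', rfl⟩ := List.mem_map.mp hg
      intro v hv
      simp only [Gate.wires, Gate.addCtls, List.map_append, List.map_cons, List.map_nil,
        List.mem_cons, List.mem_append, List.not_mem_nil, or_false] at hv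
    · rcases hv with hv | hv | hv
      · exact h₀ ht.2.1 g' hg' v (by simp [Gate.wires, hv])
      · exact hv ▸ ht.1
      · exact h₀ ht.2.1 g' hg' v (by simp only [Gate.wires, List.mem_cons]; exact Or.inr hv)
    · rcases hv with hv | hv | hv
      · exact h₁ ht.2.2 g' hg' v (by simp [Gate.wires, hv])
      · exact hv ▸ ht.1
      · exact h₁ ht.2.2 g' hg' v (by simp only [Gate.wires, List.mem_cons]; exact Or.inr hv)

theorem Tree.WiresIn.tgt {A : Set ℕ} {t : Tree} (ht : t.WiresIn A) :
    ∀ g ∈ t.gates, g.tgt ∈ A := fun g hg => ht.gates g hg _ (by simp [Gate.wires])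

/-- A `qcase` removes its wire from the accessible set of its branches, so controls and target of
each resulting gate are distinct. -/
theorem Tree.Ok.nodup {A : Set ℕ} {t : Tree} (ht : t.Ok A) : ∀ g ∈ t.gates, g.wires.Nodup := by
  induction t generalizing A with
  | skip => simp [Tree.gates]
  | err => simp [Tree.gates]
  | gate op w => simp [Tree.gates, Gate.wires]
  | seq t₀ t₁ h₀ h₁ =>
    intro g hg
    rcases List.mem_append.mp hg with hg | hg
    exacts [h₀ ht.1 g hg, h₁ ht.2 g hg]
  | qcase w t₀ t₁ h₀ h₁ =>
    have key : ∀ (t : Tree) (b : Fin 2), t.Ok (A \ {w}) → (∀ g ∈ t.gates, g.wires.Nodup) →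
        ∀ g ∈ t.gates.map (Gate.addCtls [(w, b)]), g.wires.Nodup := by
      intro t b hok hn g hg
      obtain ⟨g', hg', rfl⟩ := List.mem_map.mp hg
      have hw : w ∉ g'.wires := fun h => (hok.wiresIn.gates g' hg' w h).2 rfl
      have := hn g' hg'
      have hp : List.Perm (Gate.wires (g'.addCtls [(w, b)])) (w :: g'.wires) := by
        simpa [Gate.wires, Gate.addCtls] using List.Perm.swap _ _ _
      rw [hp.nodup_iff, List.nodup_cons]
      exact ⟨hw, this⟩
    intro g hg
    rcases List.mem_append.mp hg with hg | hg
    exacts [key t₀ 0 ht.2.1 (h₀ ht.2.1) g hg, key t₁ 1 ht.2.2 (h₁ ht.2.2) g hg]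

theorem Tree.gates_rename (σ : ℕ → ℕ) (t : Tree) :
    (t.rename σ).gates = t.gates.map (Gate.rename σ) := by
  induction t with
  | skip => rfl
  | err => rfl
  | gate op w => rfl
  | seq t₀ t₁ h₀ h₁ => simp [Tree.rename, Tree.gates, h₀, h₁]
  | qcase w t₀ t₁ h₀ h₁ =>
    simp only [Tree.rename, Tree.gates, h₀, h₁, List.map_append, List.map_map]
    congr 1

/-- The effect of a `qcase` on a basis state. -/
theorem run_qcase {A : Set ℕ} {w : ℕ} {t₀ t₁ : Tree} (h : (Tree.qcase w t₀ t₁).Ok A) (x : Bits) :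
    run (Tree.qcase w t₀ t₁).gates (ket x) =
      if x w = 0 then run t₀.gates (ket x) else run t₁.gates (ket x) := by
  have hw : ∀ t : Tree, t.Ok (A \ {w}) → ∀ (b : Fin 2), ∀ g ∈ t.gates,
      ∀ c ∈ [((w, b) : ℕ × Fin 2)], g.tgt ≠ c.1 := by
    intro t ht b g hg c hc
    simp only [List.mem_singleton] at hc
    subst hc
    exact (ht.wiresIn.tgt g hg).2
  rw [Tree.gates, run_append, run_addCtls (hw t₀ h.2.1 0)]
  simp only [holds_cons, holds_nil, and_true]
  by_cases h0 : x w = 0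
  · rw [if_pos h0, if_pos h0]
    refine run_id_of_forall (V := {y | y w = x w}) ?_ (run_mem ?_)
    · intro y hy
      rw [run_addCtls (hw t₁ h.2.2 1), if_neg]
      simp only [holds_cons, holds_nil, and_true]
      rw [show y w = x w from hy, h0]; decide
    · intro y hy
      exact hy w fun g hg => (h.2.1.wiresIn.tgt g hg).2
  · rw [if_neg h0, if_neg h0, run_addCtls (hw t₁ h.2.2 1), if_pos]
    simp only [holds_cons, holds_nil, and_true]
    revert h0; generalize x w = v; revert v; decide

/-- Unrolling of a statement, where the calls are unrolled by `C`. -/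
def Stmt.tree {N : ℕ} {ar : Fin N → ℕ} (C : (p : Fin N) → (Fin (ar p) → List ℕ) → Tree)
    {V : Type} (f : V → List ℕ) : Stmt ar V → Tree
  | .skip => .skip
  | .app q U => if q.Valid f then .gate (U.eval f) (q.eval f) else .err
  | .seq S₀ S₁ => .seq (S₀.tree C f) (S₁.tree C f)
  | .ite b S₁ S₀ => if b.eval f = true then S₁.tree C f else S₀.tree C f
  | .qcase q S₀ S₁ => if q.Valid f then .qcase (q.eval f) (S₀.tree C f) (S₁.tree C f) else .err
  | .call p args =>
      if ∃ j, (args j).eval f = [] then .skip else C p fun j => (args j).eval f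

theorem Stmt.tree_congr {N : ℕ} {ar : Fin N → ℕ}
    {C C' : (p : Fin N) → (Fin (ar p) → List ℕ) → Tree} {V : Type} {f : V → List ℕ}
    {S : Stmt ar V} (h : ∀ c ∈ S.calls, (∀ j, (c.2 j).eval f ≠ []) →
      C c.1 (fun j => (c.2 j).eval f) = C' c.1 fun j => (c.2 j).eval f) :
    S.tree C f = S.tree C' f := by
  induction S with
  | skip => rfl
  | app => rfl
  | seq S₀ S₁ h₀ h₁ =>
    simp only [Stmt.tree]
    rw [h₀ fun c hc => h c (by simp [Stmt.calls, hc]),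
      h₁ fun c hc => h c (by simp [Stmt.calls, hc])]
  | ite b S₁ S₀ h₁ h₀ =>
    simp only [Stmt.tree]
    rw [h₀ fun c hc => h c (by simp [Stmt.calls, hc]),
      h₁ fun c hc => h c (by simp [Stmt.calls, hc])]
  | qcase q S₀ S₁ h₀ h₁ =>
    simp only [Stmt.tree]
    rw [h₀ fun c hc => h c (by simp [Stmt.calls, hc]),
      h₁ fun c hc => h c (by simp [Stmt.calls, hc])]
  | call p args =>
    simp only [Stmt.tree]
    split_ifs with he
    · rfl
    · exact h ⟨p, args⟩ (by simp [Stmt.calls]) (by simpa using he)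

theorem Stmt.tree_map {N : ℕ} {ar : Fin N → ℕ}
    {C : (p : Fin N) → (Fin (ar p) → List ℕ) → Tree} {V : Type} {f : V → List ℕ} {σ : ℕ → ℕ}
    {S : Stmt ar V} (h : ∀ c ∈ S.calls, (∀ j, (c.2 j).eval f ≠ []) →
      C c.1 (fun j => ((c.2 j).eval f : List ℕ).map σ) =
        (C c.1 fun j => (c.2 j).eval f).rename σ) :
    S.tree C (fun v => (f v).map σ) = (S.tree C f).rename σ := by
  have hl : ∀ l : Exp V .list,
      (l.eval (fun v => (f v).map σ) : List ℕ) = (l.eval f : List ℕ).map σ :=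
    fun l => l.evalMap f fun _ => σ
  have hb : ∀ b : Exp V .bool, (b.eval (fun v => (f v).map σ) : Bool) = b.eval f :=
    fun b => b.evalMap f fun _ => σ
  have hq : ∀ q : Exp V .qubit, (q.Valid (fun v => (f v).map σ) ↔ q.Valid f) ∧
      (q.Valid f → (q.eval (fun v => (f v).map σ) : ℕ) = σ (q.eval f)) :=
    fun q => q.evalMap f fun _ => σ
  induction S with
  | skip => rfl
  | app q U =>
    simp only [Stmt.tree, (hq q).1]
    split_ifs with hv
    · rw [(hq q).2 hv, U.eval_map f fun _ => σ]; rfl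
    · rfl
  | seq S₀ S₁ h₀ h₁ =>
    simp only [Stmt.tree]
    rw [h₀ fun c hc => h c (by simp [Stmt.calls, hc]),
      h₁ fun c hc => h c (by simp [Stmt.calls, hc])]
    rfl
  | ite b S₁ S₀ h₁ h₀ =>
    simp only [Stmt.tree]
    rw [h₀ fun c hc => h c (by simp [Stmt.calls, hc]),
      h₁ fun c hc => h c (by simp [Stmt.calls, hc]), hb]
    split_ifs <;> rfl
  | qcase q S₀ S₁ h₀ h₁ =>
    simp only [Stmt.tree, (hq q).1]
    rw [h₀ fun c hc => h c (by simp [Stmt.calls, hc]),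
      h₁ fun c hc => h c (by simp [Stmt.calls, hc])]
    split_ifs with hv
    · rw [(hq q).2 hv]; rfl
    · rfl
  | call p args =>
    simp only [Stmt.tree, hl, List.map_eq_nil_iff]
    split_ifs with he
    · rfl
    · exact h ⟨p, args⟩ (by simp [Stmt.calls]) (by simpa using he)

theorem Stmt.tree_wiresIn {N : ℕ} {ar : Fin N → ℕ}
    {C : (p : Fin N) → (Fin (ar p) → List ℕ) → Tree} {V : Type} {f : V → List ℕ}
    {S : Stmt ar V} (h : ∀ c ∈ S.calls, (∀ j, (c.2 j).eval f ≠ []) →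
      (C c.1 fun j => (c.2 j).eval f).WiresIn {w | ∃ j, w ∈ ((c.2 j).eval f : List ℕ)}) :
    (S.tree C f).WiresIn {w | ∃ v, w ∈ f v} := by
  induction S with
  | skip => trivial
  | app q U =>
    simp only [Stmt.tree]
    split_ifs with hv
    · exact ⟨_, q.eval_mem f hv⟩
    · trivial
  | seq S₀ S₁ h₀ h₁ =>
    exact ⟨h₀ fun c hc => h c (by simp [Stmt.calls, hc]),
      h₁ fun c hc => h c (by simp [Stmt.calls, hc])⟩
  | ite b S₁ S₀ h₁ h₀ =>
    simp only [Stmt.tree]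
    split_ifs
    · exact h₁ fun c hc => h c (by simp [Stmt.calls, hc])
    · exact h₀ fun c hc => h c (by simp [Stmt.calls, hc])
  | qcase q S₀ S₁ h₀ h₁ =>
    simp only [Stmt.tree]
    split_ifs with hv
    · exact ⟨⟨_, q.eval_mem f hv⟩, h₀ fun c hc => h c (by simp [Stmt.calls, hc]),
        h₁ fun c hc => h c (by simp [Stmt.calls, hc])⟩
    · trivial
  | call p args =>
    simp only [Stmt.tree]
    split_ifs with he
    · trivial
    · refine (h ⟨p, args⟩ (by simp [Stmt.calls]) (by simpa using he)).mono ?_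
      rintro w ⟨j, hj⟩
      exact ⟨_, ((args j).eval_sublist f).subset hj⟩

/-- A bound on the number of nested calls in the execution of a call with arguments of total size
`t`, plus one. -/
noncomputable def Program.need (P : Program) (p : Fin P.nprocs) (t : ℕ) : ℕ :=
  P.rank p * (t + 1) + t + 1

/-- A lexicographic descent packed into one number: within a recursion class the rank stays and the
total size drops; otherwise the rank drops and the total size does not grow, and one unit of rank is
worth `t + 1`. -/
theorem Program.need_lt {P : Program} (hclone : P.NoCloning) (hrec : P.RecHalving)
    {p : Fin P.nprocs} {args : Fin (P.arity p) → List ℕ}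
    {c : Σ q : Fin P.nprocs, Fin (P.arity q) → Exp (Fin (P.arity p)) .list}
    (hc : c ∈ (P.body p).calls) (hne : ∀ j, (c.2 j).eval args ≠ []) :
    P.need c.1 (tot fun j => (c.2 j).eval args) < P.need p (tot args) := by
  have hinj := (hclone.1 p).of_mem_calls hc
  have hcall : P.Calls p c.1 := Stmt.mem_callees_of_mem_calls hc
  have hle := sum_length_eval_le (f := args) hinj
  unfold Program.need
  by_cases hR : P.MutRec p c.1
  · have hlt := sum_length_eval_lt (f := args) hinj ((hrec p).of_mem_calls hc hR) hne
    rw [← hR.rank_eq]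
    have := Nat.mul_le_mul_left (P.rank p) hlt.le
    nlinarith
  · have hlt := P.rank_lt hcall hR
    have h1 := Nat.mul_le_mul_left (P.rank c.1) (Nat.add_le_add_right hle 1)
    have h2 := Nat.mul_le_mul_right (tot args + 1) (Nat.succ_le_of_lt hlt)
    simp only [Nat.succ_eq_add_one, add_mul, one_mul] at h2
    linarith

/-- Unrolling of calls, with a bound on the number of nested calls. -/
def Program.unrollFuel (P : Program) :
    ℕ → (p : Fin P.nprocs) → (Fin (P.arity p) → List ℕ) → Tree
  | 0, _, _ => .skip
  | d + 1, p, args => (P.body p).tree (P.unrollFuel d) args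

/-- Unrolling of calls. -/
noncomputable def Program.unroll (P : Program) (p : Fin P.nprocs)
    (args : Fin (P.arity p) → List ℕ) : Tree :=
  P.unrollFuel (P.need p (tot args)) p args

theorem Program.unrollFuel_eq {P : Program} (hclone : P.NoCloning) (hrec : P.RecHalving)
    (d d' : ℕ) (p : Fin P.nprocs) (args : Fin (P.arity p) → List ℕ)
    (h : P.need p (tot args) ≤ d) (h' : P.need p (tot args) ≤ d') :
    P.unrollFuel d p args = P.unrollFuel d' p args := by
  induction d generalizing d' p args with
  | zero => unfold Program.need at h; omega
  | succ d ih =>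
    cases d' with
    | zero => unfold Program.need at h'; omega
    | succ d' =>
      refine Stmt.tree_congr fun c hc hne => ?_
      have := Program.need_lt hclone hrec hc hne
      exact ih _ _ _ (by omega) (by omega)

/-- The recursion equation of the unrolling, which makes the bound on nested calls invisible from
here on. -/
theorem Program.unroll_eq {P : Program} (hclone : P.NoCloning) (hrec : P.RecHalving)
    (p : Fin P.nprocs) (args : Fin (P.arity p) → List ℕ) :
    P.unroll p args = (P.body p).tree P.unroll args := by
  rw [Program.unroll, Program.unrollFuel_eq hclone hrec _ (P.need p (tot args) + 1) p args le_rfl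
    (by omega)]
  refine Stmt.tree_congr fun c hc hne => ?_
  have := Program.need_lt hclone hrec hc hne
  exact Program.unrollFuel_eq hclone hrec _ _ _ _ this.le le_rfl

theorem Program.call_induction {P : Program} (hclone : P.NoCloning) (hrec : P.RecHalving)
    {motive : (p : Fin P.nprocs) → (Fin (P.arity p) → List ℕ) → Prop}
    (h : ∀ p args, (∀ c ∈ (P.body p).calls, (∀ j, (c.2 j).eval args ≠ []) →
      motive c.1 fun j => (c.2 j).eval args) → motive p args)
    (p : Fin P.nprocs) (args : Fin (P.arity p) → List ℕ) : motive p args := by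
  induction hn : P.need p (tot args) using Nat.strong_induction_on generalizing p args with
  | _ m ih =>
    refine h p args fun c hc hne => ih _ ?_ _ _ rfl
    rw [← hn]
    exact Program.need_lt hclone hrec hc hne

/-- The reason why calls can be merged: the control flow of the unrolling depends on sizes alone,
and wires enter only as names. Injectivity of `σ` plays no role at this level. -/
theorem Program.unroll_map {P : Program} (hclone : P.NoCloning) (hrec : P.RecHalving) (σ : ℕ → ℕ)
    (p : Fin P.nprocs) (args : Fin (P.arity p) → List ℕ) :
    P.unroll p (fun j => (args j).map σ) = (P.unroll p args).rename σ := by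
  induction p, args using Program.call_induction hclone hrec with
  | h p args ih =>
    rw [Program.unroll_eq hclone hrec, Program.unroll_eq hclone hrec]
    exact Stmt.tree_map ih

theorem Program.unroll_wiresIn {P : Program} (hclone : P.NoCloning) (hrec : P.RecHalving)
    (p : Fin P.nprocs) (args : Fin (P.arity p) → List ℕ) :
    (P.unroll p args).WiresIn {w | ∃ j, w ∈ args j} := by
  induction p, args using Program.call_induction hclone hrec with
  | h p args ih =>
    rw [Program.unroll_eq hclone hrec]
    exact Stmt.tree_wiresIn ih

end PLP

namespace PLP

/-! ## The semantics of programs, by unrolling -/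

/-- The operator of a sequence of gates on `m` wires. -/
noncomputable def applyGates {m : ℕ} (gs : List Gate) (ψ : QState m) : QState m :=
  gs.foldl (fun φ g => g.apply φ) ψ

theorem applyGates_append {m : ℕ} (gs hs : List Gate) (ψ : QState m) :
    applyGates (gs ++ hs) ψ = applyGates hs (applyGates gs ψ) := by simp [applyGates]

theorem getBit_setBit_of_ne {m : ℕ} (x : Fin m → Fin 2) {t w : ℕ} (b : Fin 2) (h : w ≠ t) :
    getBit (setBit x t b) w = getBit x w := by
  unfold getBit setBit
  by_cases hw : w < m
  · simp [hw, h]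
  · simp [hw]

/-- Gates that never target `w` preserve the subspaces where `w` has a fixed value, so amplitudes
with `w = b` depend only on such amplitudes. -/
theorem applyGates_congr {m : ℕ} {gs : List Gate} {w : ℕ} {b : Fin 2}
    (hw : ∀ g ∈ gs, g.tgt ≠ w) {φ ψ : QState m} (h : ∀ x, getBit x w = b → φ x = ψ x)
    (x : Fin m → Fin 2) (hx : getBit x w = b) : applyGates gs φ x = applyGates gs ψ x := by
  induction gs generalizing φ ψ with
  | nil => exact h x hx
  | cons g gs ih =>
    refine ih (fun g hg => hw g (by simp [hg])) (φ := g.apply φ) (ψ := g.apply ψ) ?_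
    intro y hy
    simp only [Gate.apply, applyAt, h y hy]
    have : ∀ c, φ (setBit y g.tgt c) = ψ (setBit y g.tgt c) := fun c => h _ (by
      rw [getBit_setBit_of_ne _ _ (hw g (by simp)).symm, hy])
    simp only [this]

theorem applyGates_addCtls {m : ℕ} {gs : List Gate} {w : ℕ} {b : Fin 2}
    (hw : ∀ g ∈ gs, g.tgt ≠ w) (ψ : QState m) (x : Fin m → Fin 2) :
    applyGates (gs.map (Gate.addCtls [(w, b)])) ψ x =
      if getBit x w = b then applyGates gs ψ x else ψ x := by
  induction gs generalizing ψ with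
  | nil => simp [applyGates]
  | cons g gs ih =>
    have hw' : ∀ g ∈ gs, g.tgt ≠ w := fun g hg => hw g (by simp [hg])
    rw [show applyGates ((g :: gs).map (Gate.addCtls [(w, b)])) ψ =
      applyGates (gs.map (Gate.addCtls [(w, b)])) ((g.addCtls [(w, b)]).apply ψ) from rfl,
      show applyGates (g :: gs) ψ = applyGates gs (g.apply ψ) from rfl, ih hw']
    split_ifs with hx
    · refine applyGates_congr hw' ?_ x hx
      intro y hy
      simp only [Gate.apply, Gate.addCtls, List.singleton_append, List.forall_mem_cons, hy,
        true_and]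
    · simp only [Gate.apply, Gate.addCtls, List.singleton_append, List.forall_mem_cons, hx,
        false_and, if_false]

theorem applyGates_qcase {m : ℕ} {A : Set ℕ} {w : ℕ} {t₀ t₁ : Tree}
    (h : (Tree.qcase w t₀ t₁).Ok A) (ψ : QState m) :
    applyGates (Tree.qcase w t₀ t₁).gates ψ = fun x =>
      if getBit x w = 0 then applyGates t₀.gates ψ x else applyGates t₁.gates ψ x := by
  have h₀ : ∀ g ∈ t₀.gates, g.tgt ≠ w := fun g hg => (h.2.1.wiresIn.tgt g hg).2
  have h₁ : ∀ g ∈ t₁.gates, g.tgt ≠ w := fun g hg => (h.2.2.wiresIn.tgt g hg).2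
  funext x
  rw [Tree.gates, applyGates_append, applyGates_addCtls h₁]
  have hv : ∀ v : Fin 2, v = 1 ↔ ¬ v = 0 := by decide
  by_cases hx : getBit x w = 0
  · rw [if_pos hx, if_neg (fun h => (hv _).mp h hx), applyGates_addCtls h₀, if_pos hx]
  · rw [if_neg hx, if_pos ((hv _).mpr hx)]
    refine applyGates_congr h₁ ?_ x ((hv _).mpr hx)
    intro y hy
    rw [applyGates_addCtls h₀, if_neg ((hv _).mp hy)]

/-! ### Wires of the input variables -/

theorem wire_lt_wire {m : ℕ} (len : Fin m → ℕ) {q q' : Fin m} (h : q < q') {k k' : ℕ}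
    (hk : k ∈ Set.Icc 1 (len q)) (hk' : k' ∈ Set.Icc 1 (len q')) :
    wire len q k < wire len q' k' := by
  have : (∑ r ∈ Finset.univ.filter (· < q), len r) + len q ≤
      ∑ r ∈ Finset.univ.filter (· < q'), len r := by
    rw [add_comm, ← Finset.sum_insert (by simp)]
    refine Finset.sum_le_sum_of_subset ?_
    intro r hr
    simp only [Finset.mem_insert, Finset.mem_filter, Finset.mem_univ, true_and] at hr ⊢
    rcases hr with rfl | hr
    exacts [h, hr.trans h]
  unfold wire
  have h1 := hk.1; have h2 := hk.2; have h3 := hk'.1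
  omega

theorem wire_injective {m : ℕ} (len : Fin m → ℕ) {q q' : Fin m} {k k' : ℕ}
    (hk : k ∈ Set.Icc 1 (len q)) (hk' : k' ∈ Set.Icc 1 (len q'))
    (h : wire len q k = wire len q' k') : q = q' ∧ k = k' := by
  rcases lt_trichotomy q q' with hq | rfl | hq
  · exact absurd h (wire_lt_wire len hq hk hk').ne
  · refine ⟨rfl, ?_⟩
    unfold wire at h
    have h1 := hk.1; have h3 := hk'.1
    omega
  · exact absurd h (wire_lt_wire len hq hk' hk).ne'

theorem wire_lt_total {m : ℕ} (len : Fin m → ℕ) {q : Fin m} {k : ℕ}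
    (hk : k ∈ Set.Icc 1 (len q)) : wire len q k < total len := by
  have : (∑ r ∈ Finset.univ.filter (· < q), len r) + len q ≤ total len := by
    rw [add_comm, ← Finset.sum_insert (by simp)]
    exact Finset.sum_le_sum_of_subset (Finset.subset_univ _)
  unfold wire
  have h1 := hk.1; have h2 := hk.2
  omega

/-- The wires of the accessible pointers. -/
def accWires {m : ℕ} (len : Fin m → ℕ) (A : Fin m → Set ℕ) : Set ℕ :=
  {w | ∃ q, ∃ k ∈ A q, w = wire len q k}

/-- Pointers within bounds determine their wire and conversely, so making a pointer inaccessible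
removes exactly one wire. -/
theorem accWires_update {m : ℕ} (len : Fin m → ℕ) {A : Fin m → Set ℕ}
    (hA : ∀ q, A q ⊆ Set.Icc 1 (len q)) {q : Fin m} {k : ℕ} (hk : k ∈ A q) :
    accWires len (Function.update A q (A q \ {k})) = accWires len A \ {wire len q k} := by
  ext w
  simp only [accWires, Set.mem_ofPred_eq, Set.mem_sdiff, Set.mem_singleton_iff]
  constructor
  · rintro ⟨r, j, hj, rfl⟩
    by_cases hr : r = q
    · subst hr
      rw [Function.update_self] at hj
      refine ⟨⟨r, j, hj.1, rfl⟩, fun e => hj.2 ?_⟩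
      exact (wire_injective len (hA _ hj.1) (hA _ hk) e).2
    · rw [Function.update_of_ne hr] at hj
      refine ⟨⟨r, j, hj, rfl⟩, fun e => hr ?_⟩
      exact (wire_injective len (hA _ hj) (hA _ hk) e).1
  · rintro ⟨⟨r, j, hj, rfl⟩, hne⟩
    refine ⟨r, j, ?_, rfl⟩
    by_cases hr : r = q
    · subst hr
      rw [Function.update_self]
      exact ⟨hj, fun e => hne (by rw [Set.mem_singleton_iff.mp e])⟩
    · rwa [Function.update_of_ne hr]

theorem update_diff_subset {m : ℕ} {len : Fin m → ℕ} {A : Fin m → Set ℕ}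
    (hA : ∀ q, A q ⊆ Set.Icc 1 (len q)) (q : Fin m) (k : ℕ) :
    ∀ r, Function.update A q (A q \ {k}) r ⊆ Set.Icc 1 (len r) := by
  intro r
  by_cases hr : r = q
  · subst hr
    rw [Function.update_self]
    exact Set.sdiff_subset.trans (hA r)
  · rw [Function.update_of_ne hr]
    exact hA r

/-- The lists of pointers of the inputs. -/
def pointers {m : ℕ} (len : Fin m → ℕ) (q : Fin m) : List ℕ := List.range' 1 (len q)

/-- The lists of wires denoted by list expressions over the inputs. -/
def wiresOf {m : ℕ} (len : Fin m → ℕ) {V : Type} (s : V → Exp (Fin m) .list) (v : V) : List ℕ :=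
  ((s v).eval (pointers len) : List ℕ).map (wire len (s v).base)

theorem eval_list_wiresOf {m : ℕ} (len : Fin m → ℕ) {V : Type} (s : V → Exp (Fin m) .list)
    (l : Exp V .list) : (l.eval (wiresOf len s) : List ℕ) =
      ((l.subst s).eval (pointers len) : List ℕ).map (wire len (l.subst s).base) := by
  rw [Exp.eval_subst, Exp.base_subst]
  exact l.evalMap (fun v => (s v).eval (pointers len)) fun v => wire len (s v).base

theorem eval_bool_wiresOf {m : ℕ} (len : Fin m → ℕ) {V : Type} (s : V → Exp (Fin m) .list)
    (b : Exp V .bool) :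
    (b.eval (wiresOf len s) : Bool) = (b.subst s).eval (pointers len) := by
  rw [Exp.eval_subst]
  exact b.evalMap (fun v => (s v).eval (pointers len)) fun v => wire len (s v).base

theorem eval_unitary_wiresOf {m : ℕ} (len : Fin m → ℕ) {V : Type} (s : V → Exp (Fin m) .list)
    (U : UnitaryExp V) : U.eval (wiresOf len s) = (U.subst s).eval (pointers len) := by
  rw [UnitaryExp.eval_subst]
  exact U.eval_map (fun v => (s v).eval (pointers len)) fun v => wire len (s v).base

theorem valid_wiresOf {m : ℕ} (len : Fin m → ℕ) {V : Type} (s : V → Exp (Fin m) .list)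
    (q : Exp V .qubit) : (q.Valid (wiresOf len s) ↔ (q.subst s).Valid (pointers len)) ∧
      ((q.subst s).Valid (pointers len) → (q.eval (wiresOf len s) : ℕ) =
        wire len (q.subst s).qbase ((q.subst s).eval (pointers len))) := by
  rw [Exp.valid_subst, Exp.eval_subst, Exp.qbase_subst]
  exact q.evalMap (fun v => (s v).eval (pointers len)) fun v => wire len (s v).base

/-- The single membership test of the semantics covers two errors: an invalid index evaluates to the
pointer `0`, which is never accessible because pointers start at `1`. -/
theorem accessible_iff {m : ℕ} {len : Fin m → ℕ} {V : Type} (s : V → Exp (Fin m) .list)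
    (q : Exp V .qubit) {A : Fin m → Set ℕ} (hA : ∀ q, A q ⊆ Set.Icc 1 (len q)) :
    ((q.subst s).eval (pointers len) : ℕ) ∈ A (q.subst s).qbase ↔
      q.Valid (wiresOf len s) ∧ (q.eval (wiresOf len s) : ℕ) ∈ accWires len A := by
  obtain ⟨h₁, h₂⟩ := valid_wiresOf len s q
  constructor
  · intro h
    have hv : (q.subst s).Valid (pointers len) := by
      by_contra hv
      rw [Exp.eval_of_not_valid _ hv] at h
      exact absurd (hA _ h).1 (by norm_num)
    exact ⟨h₁.mpr hv, _, _, h, h₂ hv⟩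
  · rintro ⟨hv, r, k, hk, e⟩
    have hv' := h₁.mp hv
    rw [h₂ hv'] at e
    have hm := Exp.eval_mem _ hv'
    rw [pointers, List.mem_range'_1] at hm
    obtain ⟨rfl, e'⟩ := wire_injective len (q := (q.subst s).qbase) ⟨hm.1, by omega⟩ (hA _ hk) e
    rw [e']
    exact hk

/-! ### Execution of statements -/

section

variable {P : Program} {len : Fin P.nvars → ℕ}

/-- A statement ends in the state computed by its unrolling if it causes no error, and in an error
otherwise. -/
def Executes (P : Program) (len : Fin P.nvars → ℕ) (S : Stmt P.arity (Fin P.nvars)) (t : Tree) :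
    Prop :=
  ∀ (A : Fin P.nvars → Set ℕ), (∀ q, A q ⊆ Set.Icc 1 (len q)) → ∀ ψ : QState (total len),
    (t.Ok (accWires len A) → Exec P len (pointers len) S ψ A .top (applyGates t.gates ψ)) ∧
    (¬ t.Ok (accWires len A) → ∃ ψ', Exec P len (pointers len) S ψ A .bot ψ')

/-- The semantics substitutes list expressions for parameters, whereas the unrolling binds
parameters to lists of wires. Carrying the substitution `s` through the induction relates the two,
since evaluation commutes with the passage to wires. -/
theorem executes_subst {V : Type} {S : Stmt P.arity V} (s : V → Exp (Fin P.nvars) .list)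
    (h : ∀ c ∈ S.calls, (∀ j, (c.2 j).eval (wiresOf len s) ≠ []) →
      Executes P len ((P.body c.1).subst fun j => (c.2 j).subst s)
        (P.unroll c.1 fun j => (c.2 j).eval (wiresOf len s))) :
    Executes P len (S.subst s) (S.tree P.unroll (wiresOf len s)) := by
  induction S with
  | skip =>
    intro A hA ψ
    exact ⟨fun _ => .skip _ _, fun h => absurd trivial h⟩
  | app q U =>
    intro A hA ψ
    have hq := accessible_iff s q hA
    simp only [Stmt.tree, Stmt.subst]
    by_cases hv : q.Valid (wiresOf len s)
    · simp only [if_pos hv, Tree.Ok]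
      constructor
      · intro ha
        have := Exec.app (P := P) (len := len) (f := pointers len) (q.subst s) (U.subst s) ψ A
          (hq.mpr ⟨hv, ha⟩)
        rw [eval_unitary_wiresOf, (valid_wiresOf len s q).2 ((valid_wiresOf len s q).1.mp hv)]
        convert this using 1
        funext x
        simp [applyGates, Tree.gates, Gate.apply]
      · intro ha
        exact ⟨ψ, .app_error _ _ _ _ fun h => ha (hq.mp h).2⟩
    · simp only [if_neg hv, Tree.Ok]
      exact ⟨False.elim, fun _ => ⟨ψ, .app_error _ _ _ _ fun h => hv (hq.mp h).1⟩⟩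
  | seq S₀ S₁ h₀ h₁ =>
    have h₀ := h₀ fun c hc => h c (by simp [Stmt.calls, hc])
    have h₁ := h₁ fun c hc => h c (by simp [Stmt.calls, hc])
    intro A hA ψ
    simp only [Stmt.tree, Stmt.subst, Tree.Ok, Tree.gates, applyGates_append]
    constructor
    · intro hok
      exact .seq _ _ _ _ _ _ _ ((h₀ A hA ψ).1 hok.1) ((h₁ A hA _).1 hok.2)
    · intro hok
      by_cases ok₀ : (S₀.tree P.unroll (wiresOf len s)).Ok (accWires len A)
      · have ok₁ := fun h => hok ⟨ok₀, h⟩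
        obtain ⟨ψ', h'⟩ := (h₁ A hA (applyGates (S₀.tree P.unroll (wiresOf len s)).gates ψ)).2 ok₁
        exact ⟨ψ', .seq _ _ _ _ _ _ _ ((h₀ A hA ψ).1 ok₀) h'⟩
      · obtain ⟨ψ', h'⟩ := (h₀ A hA ψ).2 ok₀
        exact ⟨ψ', .seq_error _ _ _ _ _ h'⟩
  | ite b S₁ S₀ h₁ h₀ =>
    have h₀ := h₀ fun c hc => h c (by simp [Stmt.calls, hc])
    have h₁ := h₁ fun c hc => h c (by simp [Stmt.calls, hc])
    intro A hA ψ
    simp only [Stmt.tree, Stmt.subst]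
    have hb := eval_bool_wiresOf len s b
    by_cases hv : (b.eval (wiresOf len s) : Bool) = true
    · rw [if_pos hv]
      refine ⟨fun hok => .ite _ _ _ _ _ _ _ ?_, fun hok => ?_⟩
      · rw [if_pos (hb ▸ hv)]
        exact (h₁ A hA ψ).1 hok
      · obtain ⟨ψ', h'⟩ := (h₁ A hA ψ).2 hok
        exact ⟨ψ', .ite _ _ _ _ _ _ _ (by rwa [if_pos (hb ▸ hv)])⟩
    · rw [if_neg hv]
      refine ⟨fun hok => .ite _ _ _ _ _ _ _ ?_, fun hok => ?_⟩
      · rw [if_neg (hb ▸ hv)]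
        exact (h₀ A hA ψ).1 hok
      · obtain ⟨ψ', h'⟩ := (h₀ A hA ψ).2 hok
        exact ⟨ψ', .ite _ _ _ _ _ _ _ (by rwa [if_neg (hb ▸ hv)])⟩
  | qcase q S₀ S₁ h₀ h₁ =>
    have h₀ := h₀ fun c hc => h c (by simp [Stmt.calls, hc])
    have h₁ := h₁ fun c hc => h c (by simp [Stmt.calls, hc])
    intro A hA ψ
    have hq := accessible_iff s q hA
    simp only [Stmt.tree, Stmt.subst]
    by_cases hv : q.Valid (wiresOf len s)
    · rw [if_pos hv]
      have hw := (valid_wiresOf len s q).2 ((valid_wiresOf len s q).1.mp hv)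
      by_cases ha : (q.eval (wiresOf len s) : ℕ) ∈ accWires len A
      · have ha' := hq.mpr ⟨hv, ha⟩
        have hA' := update_diff_subset hA (q.subst s).qbase ((q.subst s).eval (pointers len))
        have hacc := accWires_update len hA ha'
        rw [← hw] at hacc
        have h₀ := h₀ _ hA' ψ
        have h₁ := h₁ _ hA' ψ
        rw [hacc] at h₀ h₁
        constructor
        · intro hok
          rw [applyGates_qcase hok, hw]
          exact .qcase _ _ _ _ _ _ _ ha' (h₀.1 hok.2.1) (h₁.1 hok.2.2)
        · intro hok
          by_cases ok₀ : (S₀.tree P.unroll (wiresOf len s)).Ok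
              (accWires len A \ {(q.eval (wiresOf len s) : ℕ)})
          · obtain ⟨ψ', h'⟩ := h₁.2 fun ok₁ => hok ⟨ha, ok₀, ok₁⟩
            exact ⟨ψ, .qcase_error₁ _ _ _ _ _ _ ha' h'⟩
          · obtain ⟨ψ', h'⟩ := h₀.2 ok₀
            exact ⟨ψ, .qcase_error₀ _ _ _ _ _ _ ha' h'⟩
      · exact ⟨fun hok => absurd hok.1 ha,
          fun _ => ⟨ψ, .qcase_error _ _ _ _ _ fun h => ha (hq.mp h).2⟩⟩
    · rw [if_neg hv]
      exact ⟨False.elim, fun _ => ⟨ψ, .qcase_error _ _ _ _ _ fun h => hv (hq.mp h).1⟩⟩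
  | call p args =>
    intro A hA ψ
    have he : ∀ j, ((args j).eval (wiresOf len s) : List ℕ) = [] ↔
        (((args j).subst s).eval (pointers len) : List ℕ) = [] := by
      intro j
      rw [eval_list_wiresOf, List.map_eq_nil_iff]
    simp only [Stmt.tree, Stmt.subst]
    split_ifs with hj
    · obtain ⟨j, hj⟩ := hj
      exact ⟨fun _ => .call_empty _ _ _ _ j ((he j).mp hj), fun h => absurd trivial h⟩
    · push Not at hj
      have := h ⟨p, args⟩ (by simp [Stmt.calls]) hj A hA ψ
      refine ⟨fun hok => .call _ _ _ _ _ _ (fun j e => hj j ((he j).mpr e)) (this.1 hok),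
        fun hok => ?_⟩
      obtain ⟨ψ', h'⟩ := this.2 hok
      exact ⟨ψ', .call _ _ _ _ _ _ (fun j e => hj j ((he j).mpr e)) h'⟩

theorem executes_call (hclone : P.NoCloning) (hrec : P.RecHalving) (p : Fin P.nprocs)
    (args : Fin (P.arity p) → List ℕ) (s : Fin (P.arity p) → Exp (Fin P.nvars) .list)
    (hs : args = wiresOf len s) :
    Executes P len ((P.body p).subst s) (P.unroll p args) := by
  induction p, args using Program.call_induction hclone hrec with
  | h p args ih =>
    subst hs
    rw [Program.unroll_eq hclone hrec]
    refine executes_subst s fun c hc hne => ih c hc hne _ ?_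
    funext j
    exact eval_list_wiresOf len s (c.2 j)

theorem executes_main (hclone : P.NoCloning) (hrec : P.RecHalving) :
    Executes P len P.main (P.main.tree P.unroll (wiresOf len fun q => .var q)) := by
  have hsub : ∀ {τ : ETy} (e : Exp (Fin P.nvars) τ), e.subst (fun q => .var q) = e := by
    intro τ e
    induction e <;> simp_all [Exp.subst]
  have hU : ∀ U : UnitaryExp (Fin P.nvars), U.subst (fun q => .var q) = U := by
    intro U; cases U <;> simp [UnitaryExp.subst, hsub]
  have hS : ∀ S : Stmt P.arity (Fin P.nvars), S.subst (fun q => .var q) = S := by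
    intro S
    induction S <;> simp_all [Stmt.subst]
  have := executes_subst (P := P) (len := len) (S := P.main) (fun q => .var q)
    fun c _ _ => executes_call hclone hrec c.1 _ _ (by
      funext j; exact eval_list_wiresOf len _ (c.2 j))
  rwa [hS] at this

/-- Determinism of successful runs; it upgrades the existence of a final state to the equivalence
required by `Program.Computes`. -/
theorem Exec.top_unique {f : Fin P.nvars → List ℕ} {S : Stmt P.arity (Fin P.nvars)}
    {ψ ψ' : QState (total len)} {A : Fin P.nvars → Set ℕ} {d : Outcome}
    (h : Exec P len f S ψ A d ψ') (hd : d = .top) {ψ'' : QState (total len)}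
    (h' : Exec P len f S ψ A .top ψ'') : ψ' = ψ'' := by
  induction h generalizing ψ'' with
  | skip => cases h'; rfl
  | app_error => cases hd
  | app => cases h'; rfl
  | seq S₀ S₁ ψ ψ₁ ψ₂ A d h₀ h₁ ih₀ ih₁ =>
    cases h' with
    | seq _ _ _ ψ₁' _ _ _ h₀' h₁' =>
      obtain rfl := ih₀ rfl h₀'
      exact ih₁ hd h₁'
  | seq_error => cases hd
  | ite b S₁ S₀ ψ ψ' A d h ih =>
    cases h' with
    | ite _ _ _ _ _ _ _ h' => exact ih hd h'
  | qcase q S₀ S₁ ψ ψ₀ ψ₁ A h h₀ h₁ ih₀ ih₁ =>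
    cases h' with
    | qcase _ _ _ _ ψ₀' ψ₁' _ h' h₀' h₁' =>
      obtain rfl := ih₀ rfl h₀'
      obtain rfl := ih₁ rfl h₁'
      rfl
  | qcase_error₀ => cases hd
  | qcase_error₁ => cases hd
  | qcase_error => cases hd
  | call p args ψ ψ' A d hne h ih =>
    cases h' with
    | call _ _ _ _ _ _ _ h' => exact ih hd h'
    | call_empty _ _ _ _ j he => exact absurd he (hne j)
  | call_empty p args ψ A j he =>
    cases h' with
    | call _ _ _ _ _ _ hne h' => exact absurd he (hne j)
    | call_empty => rfl

end

/-! ### Unitarity -/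

theorem Op.matrix_unitary (o : Op) (a b : Fin 2) :
    ∑ c : Fin 2, star (o.matrix c a) * o.matrix c b = if a = b then 1 else 0 := by
  rw [Fin.sum_univ_two]
  cases o with
  | not => fin_cases a <;> fin_cases b <;> simp [Op.matrix]
  | ph θ =>
    have : star (Complex.exp (θ * Complex.I)) * Complex.exp (θ * Complex.I) = 1 := by
      rw [Complex.star_def, ← Complex.exp_conj, ← Complex.exp_add]
      simp
    fin_cases a <;> fin_cases b <;> simp [Op.matrix] at this ⊢
    exact this
  | ry θ =>
    have : (Real.cos θ : ℂ) * Real.cos θ + (Real.sin θ : ℂ) * Real.sin θ = 1 := by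
      rw [← Complex.ofReal_mul, ← Complex.ofReal_mul, ← Complex.ofReal_add]
      have := Real.sin_sq_add_cos_sq θ
      rw [← Complex.ofReal_one]
      congr 1
      nlinarith
    fin_cases a <;> fin_cases b <;>
      simp only [Op.matrix, Complex.star_def, Matrix.of_apply, Matrix.cons_val', Matrix.cons_val_zero,
        Matrix.cons_val_one, Fin.zero_eta, Fin.mk_one, Fin.isValue, map_neg, Complex.conj_ofReal,
        Matrix.cons_val_fin_one, if_true, zero_ne_one, one_ne_zero, if_false] <;>
      first | linear_combination this | ring

theorem Gate.apply_inner {m : ℕ} (g : Gate) (ht : g.tgt < m) (hc : ∀ c ∈ g.ctls, c.1 ≠ g.tgt)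
    (φ ψ : QState m) :
    ∑ x, star (g.apply φ x) * g.apply ψ x = ∑ x, star (φ x) * ψ x := by
  have hinv : Function.Involutive fun x : Fin m → Fin 2 => setBit x g.tgt (getBit x g.tgt + 1) := by
    intro x
    have h2 : ∀ v : Fin 2, v + 1 + 1 = v := by decide
    simp only [getBit_setBit _ _ _ _ ht, if_true, setBit_setBit, h2, setBit_getBit _ _ ht]
  have hsum : ∀ h : (Fin m → Fin 2) → ℂ,
      ∑ x, (h x + h (setBit x g.tgt (getBit x g.tgt + 1))) = 2 * ∑ x, h x := by
    intro h
    rw [Finset.sum_add_distrib, two_mul]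
    congr 1
    exact Equiv.sum_comp hinv.toPerm h
  have h2 : (2 : ℂ) ≠ 0 := two_ne_zero
  -- Twice the sum counts every pair of states differing in the target bit twice, so unitarity of
  -- the `2 × 2` matrix can be used pair by pair without choosing representatives.
  refine mul_left_cancel₀ h2 ?_
  rw [← hsum, ← hsum]
  refine Finset.sum_congr rfl fun x _ => ?_
  have hpair : ∀ h : (Fin m → Fin 2) → ℂ, h x + h (setBit x g.tgt (getBit x g.tgt + 1)) =
      h (setBit x g.tgt 0) + h (setBit x g.tgt 1) := by
    intro h
    have hx := setBit_getBit x g.tgt ht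
    generalize getBit x g.tgt = v at *
    fin_cases v
    · simp only [Fin.zero_eta, Fin.isValue, zero_add] at hx ⊢; rw [hx]
    · simp only [Fin.mk_one, Fin.isValue] at hx ⊢
      rw [hx, add_comm]; rfl
  rw [hpair fun x => star (g.apply φ x) * g.apply ψ x, hpair fun x => star (φ x) * ψ x]
  have hh : ∀ b, (∀ c ∈ g.ctls, getBit (setBit x g.tgt b) c.1 = c.2) ↔
      ∀ c ∈ g.ctls, getBit x c.1 = c.2 := by
    intro b
    refine forall₂_congr fun c h => ?_
    rw [getBit_setBit_of_ne _ _ (hc c h)]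
  simp only [Gate.apply, hh]
  by_cases H : ∀ c ∈ g.ctls, getBit x c.1 = c.2
  · simp only [if_pos H, applyAt, getBit_setBit _ _ _ _ ht, if_true, setBit_setBit,
      Fin.sum_univ_two]
    have u := g.op.matrix_unitary
    simp only [Fin.sum_univ_two] at u
    have u00 := u 0 0; have u01 := u 0 1; have u10 := u 1 0; have u11 := u 1 1
    simp only [if_true, Fin.isValue, zero_ne_one, one_ne_zero, if_false] at u00 u01 u10 u11
    simp only [star_add, star_mul']
    linear_combination (star (φ (setBit x g.tgt 0)) * ψ (setBit x g.tgt 0)) * u00 +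
      (star (φ (setBit x g.tgt 0)) * ψ (setBit x g.tgt 1)) * u01 +
      (star (φ (setBit x g.tgt 1)) * ψ (setBit x g.tgt 0)) * u10 +
      (star (φ (setBit x g.tgt 1)) * ψ (setBit x g.tgt 1)) * u11
  · simp only [if_neg H]

theorem Gate.apply_add {m : ℕ} (g : Gate) (φ ψ : QState m) :
    g.apply (φ + ψ) = g.apply φ + g.apply ψ := by
  funext x
  simp only [Gate.apply, applyAt, Pi.add_apply]
  split_ifs
  · rw [← Finset.sum_add_distrib]
    exact Finset.sum_congr rfl fun b _ => mul_add _ _ _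
  · rfl

theorem Gate.apply_smul {m : ℕ} (g : Gate) (a : ℂ) (ψ : QState m) :
    g.apply (a • ψ) = a • g.apply ψ := by
  funext x
  simp only [Gate.apply, applyAt, Pi.smul_apply, smul_eq_mul]
  split_ifs
  · rw [Finset.mul_sum]
    exact Finset.sum_congr rfl fun b _ => mul_left_comm _ _ _
  · rfl

/-- The operator of a sequence of gates, as a linear map. -/
noncomputable def gatesLin {m : ℕ} (gs : List Gate) : QState m →ₗ[ℂ] QState m where
  toFun := applyGates gs
  map_add' φ ψ := by
    induction gs generalizing φ ψ with
    | nil => rfl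
    | cons g gs ih =>
      change applyGates gs (g.apply (φ + ψ)) = _
      rw [g.apply_add]; exact ih _ _
  map_smul' a ψ := by
    induction gs generalizing ψ with
    | nil => rfl
    | cons g gs ih =>
      change applyGates gs (g.apply (a • ψ)) = _
      rw [g.apply_smul]; exact ih _

theorem exists_unitary {m : ℕ} {gs : List Gate}
    (h : ∀ g ∈ gs, g.wires.Nodup ∧ ∀ w ∈ g.wires, w < m) :
    ∃ F : Matrix.unitaryGroup (Fin m → Fin 2) ℂ, ∀ ψ : QState m,
      applyGates gs ψ = Matrix.mulVec F.1 ψ := by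
  have hin : ∀ φ ψ : QState m,
      ∑ x, star (applyGates gs φ x) * applyGates gs ψ x = ∑ x, star (φ x) * ψ x := by
    induction gs with
    | nil => intro φ ψ; rfl
    | cons g gs ih =>
      intro φ ψ
      have hg := h g (by simp)
      rw [← g.apply_inner (hg.2 _ (by simp [Gate.wires])) (Gate.ctl_ne_of_nodup hg.1) φ ψ]
      exact ih (fun g hg => h g (by simp [hg])) (g.apply φ) (g.apply ψ)
  refine ⟨⟨LinearMap.toMatrix' (gatesLin gs), ?_⟩, fun ψ => ?_⟩
  · rw [Matrix.mem_unitaryGroup_iff']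
    ext x y
    rw [Matrix.mul_apply]
    -- The entries of `F* F` are the inner products of images of basis vectors.
    have := hin (Pi.single x 1) (Pi.single y 1)
    simp only [Matrix.star_apply, LinearMap.toMatrix'_apply]
    refine this.trans ?_
    rw [Matrix.one_apply]
    simp [Pi.single_apply, eq_comm]
  · rw [LinearMap.toMatrix'_mulVec]; rfl

end PLP

namespace PLP

/-! ## Gates with many controls -/

/-- The wires from `next` on have the value `0`. -/
def Fresh (next : ℕ) (x : Bits) : Prop := ∀ w, next ≤ w → x w = 0

theorem Fresh.mono {a b : ℕ} (h : a ≤ b) {x : Bits} (hx : Fresh a x) : Fresh b x :=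
  fun w hw => hx w (h.trans hw)

theorem ctlChain_le (op : Op) (t : ℕ) (c : ℕ × Fin 2) (cs : List (ℕ × Fin 2)) (next : ℕ) :
    next ≤ (ctlChain op t c cs next).2 := by
  induction cs generalizing c next with
  | nil => exact le_rfl
  | cons d ds ih => exact (Nat.le_succ _).trans (ih _ _)

theorem multiCtl_le (op : Op) (t : ℕ) (cs : List (ℕ × Fin 2)) (next : ℕ) :
    next ≤ (multiCtl op t cs next).2 := by
  cases cs
  exacts [le_rfl, ctlChain_le _ _ _ _ _]

/-- A controlled NOT that neither reads nor writes wire `t` commutes with the gate on `t`. It lets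
the closing Toffoli gate of a chain meet the opening one. -/
theorem Gate.lin_comm_not {op : Op} {t : ℕ} {g : Gate} (hop : g.op = .not) (htgt : g.tgt ≠ t)
    (hc : ∀ c ∈ g.ctls, c.1 ≠ t) (x : Bits) :
    g.lin (Gate.lin ⟨[], op, t⟩ (ket x)) = Gate.lin ⟨[], op, t⟩ (ket (g.flip x)) := by
  have hflip : ∀ b, g.flip (Function.update x t b) = Function.update (g.flip x) t b := by
    intro b
    have hh : Holds g.ctls (Function.update x t b) ↔ Holds g.ctls x :=
      holds_congr fun c h => Function.update_of_ne (hc c h) _ _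
    unfold Gate.flip
    simp only [hh]
    split_ifs
    · rw [Function.update_of_ne htgt, Function.update_comm htgt.symm]
    · rfl
  have ht : g.flip x t = x t := by
    unfold Gate.flip
    split_ifs
    · exact Function.update_of_ne htgt.symm _ _
    · rfl
  have hon : ∀ y : Bits, Gate.lin ⟨[], op, t⟩ (ket y) =
      ∑ b : Fin 2, op.matrix b (y t) • ket (Function.update y t b) := by
    intro y
    rw [Gate.lin_ket, Gate.onBasis, if_pos (holds_nil y)]
  rw [hon, hon, map_sum, ht]
  refine Finset.sum_congr rfl fun b _ => ?_
  rw [map_smul, g.lin_not hop, hflip]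

/-- The Toffoli gate stores the conjunction of the first two controls in the wire `next`, which is
`0` by freshness; this wire then heads a chain with one control less. The controls avoid `t`, so the
same Toffoli gate restores `next` afterwards. -/
theorem run_ctlChain {op : Op} {t next : ℕ} {c : ℕ × Fin 2} {cs : List (ℕ × Fin 2)}
    (ht : t < next) (hcs : ∀ d ∈ c :: cs, d.1 < next ∧ d.1 ≠ t) {x : Bits} (hx : Fresh next x) :
    run (ctlChain op t c cs next).1 (ket x) =
      if Holds (c :: cs) x then Gate.lin ⟨[], op, t⟩ (ket x) else ket x := by
  induction cs generalizing c next x with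
  | nil =>
    simp only [ctlChain, run_cons, run_nil, Gate.lin_ket, Gate.onBasis, holds_nil, if_true]
  | cons d ds ih =>
    have hc := hcs c (by simp)
    have hd := hcs d (by simp)
    set g : Gate := ⟨[c, d], .not, next⟩ with hg
    have hnot : g.IsNot := ⟨rfl, fun e he => by
      simp only [hg, List.mem_cons, List.not_mem_nil, or_false] at he ⊢
      rcases he with rfl | rfl
      exacts [hc.1.ne, hd.1.ne]⟩
    set x' := g.flip x with hx'
    have hx'w : ∀ w, w ≠ next → x' w = x w := by
      intro w hw
      rw [hx', Gate.flip]
      split_ifs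
      · exact Function.update_of_ne hw _ _
      · rfl
    have hfresh : Fresh (next + 1) x' := fun w hw => by
      rw [hx'w w (by omega)]; exact hx w (by omega)
    have hn : x' next = 1 ↔ x c.1 = c.2 ∧ x d.1 = d.2 := by
      rw [hx', Gate.flip]
      simp only [hg, holds_cons, holds_nil, and_true]
      split_ifs with h
      · rw [Function.update_self, hx next le_rfl]; simp [h]
      · rw [hx next le_rfl]; simp [h]
    have hds : Holds ds x' ↔ Holds ds x := holds_congr fun e he => hx'w _
      (hcs e (by simp [he])).1.ne
    have hall : Holds ((next, 1) :: ds) x' ↔ Holds (c :: d :: ds) x := by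
      simp only [holds_cons, hn, hds, and_assoc]
    have IH := ih (c := (next, 1)) (next := next + 1) (x := x') (by omega) (by
      intro e he
      rcases List.mem_cons.mp he with rfl | he
      · exact ⟨by simp, by simp; omega⟩
      · have := hcs e (by simp [he]); exact ⟨by omega, this.2⟩) hfresh
    simp only [ctlChain, List.cons_append, run_cons, run_append, run_nil]
    rw [g.lin_not rfl, IH]
    simp only [hall]
    split_ifs
    · rw [Gate.lin_comm_not (g := g) rfl (by simp [hg]; omega) (by
        intro e he
        simp only [hg, List.mem_cons, List.not_mem_nil, or_false] at he
        rcases he with rfl | rfl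
        exacts [hc.2, hd.2]), Gate.flip_flip hnot]
    · rw [g.lin_not rfl, Gate.flip_flip hnot]

theorem run_multiCtl {op : Op} {t next : ℕ} {cs : List (ℕ × Fin 2)}
    (ht : t < next) (hcs : ∀ d ∈ cs, d.1 < next ∧ d.1 ≠ t) {x : Bits} (hx : Fresh next x) :
    run (multiCtl op t cs next).1 (ket x) =
      if Holds cs x then Gate.lin ⟨[], op, t⟩ (ket x) else ket x := by
  cases cs with
  | nil => simp [multiCtl]
  | cons c cs => exact run_ctlChain ht hcs hx

theorem elementary_ctlChain {op : Op} {t next : ℕ} {c : ℕ × Fin 2} {cs : List (ℕ × Fin 2)}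
    (ht : t < next) (hcs : ∀ d ∈ c :: cs, d.1 < next ∧ d.1 ≠ t)
    (hnd : ((c :: cs).map Prod.fst).Nodup) :
    ∀ g ∈ (ctlChain op t c cs next).1, g.Elementary (ctlChain op t c cs next).2 := by
  induction cs generalizing c next with
  | nil =>
    intro g hg
    simp only [ctlChain, List.mem_singleton] at hg ⊢
    subst hg
    have := hcs c (by simp)
    refine ⟨by simp, ?_, ?_⟩
    · simpa [Gate.wires] using fun h => this.2 h.symm
    · simpa [Gate.wires] using ⟨ht, this.1⟩
  | cons d ds ih =>
    have hc := hcs c (by simp)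
    have hd := hcs d (by simp)
    have hcd : c.1 ≠ d.1 := by
      simp only [List.map_cons, List.nodup_cons, List.mem_cons, not_or] at hnd
      exact hnd.1.1
    have hle := ctlChain_le op t (next, 1) ds (next + 1)
    have hg : Gate.Elementary (ctlChain op t c (d :: ds) next).2 ⟨[c, d], .not, next⟩ := by
      simp only [ctlChain]
      refine ⟨by simp, ?_, ?_⟩
      · simp only [Gate.wires, List.map_cons, List.map_nil, List.nodup_cons, List.mem_cons,
          List.not_mem_nil, or_false, not_or, not_false_eq_true, List.nodup_nil, and_true]
        exact ⟨⟨hc.1.ne', hd.1.ne'⟩, hcd⟩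
      · intro w hw
        simp only [Gate.wires, List.map_cons, List.map_nil, List.mem_cons, List.not_mem_nil,
          or_false] at hw
        rcases hw with rfl | rfl | rfl <;> omega
    intro g hg'
    have hg'' : g = ⟨[c, d], .not, next⟩ ∨ g ∈ (ctlChain op t (next, 1) ds (next + 1)).1 := by
      simp only [ctlChain, List.cons_append, List.mem_cons, List.mem_append, List.not_mem_nil,
        or_false] at hg'
      tauto
    rcases hg'' with rfl | h
    · exact hg
    · refine ih (c := (next, 1)) (by omega) ?_ ?_ g h
      · intro e he
        rcases List.mem_cons.mp he with rfl | he
        · exact ⟨by simp, by simp; omega⟩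
        · have := hcs e (by simp [he]); exact ⟨by omega, this.2⟩
      · simp only [List.map_cons, List.nodup_cons] at hnd ⊢
        refine ⟨fun h => ?_, hnd.2.2⟩
        obtain ⟨e, he, h⟩ := List.mem_map.mp h
        exact (hcs e (by simp [he])).1.ne h

theorem elementary_multiCtl {op : Op} {t next : ℕ} {cs : List (ℕ × Fin 2)}
    (ht : t < next) (hcs : ∀ d ∈ cs, d.1 < next ∧ d.1 ≠ t) (hnd : (cs.map Prod.fst).Nodup) :
    ∀ g ∈ (multiCtl op t cs next).1, g.Elementary (multiCtl op t cs next).2 := by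
  cases cs with
  | nil =>
    intro g hg
    simp only [multiCtl, List.mem_singleton] at hg ⊢
    subst hg
    exact ⟨by simp, by simp [Gate.wires], by simpa [Gate.wires] using ht⟩
  | cons c cs => exact elementary_ctlChain ht hcs hnd

theorem op_ctlChain (t : ℕ) (c : ℕ × Fin 2) (cs : List (ℕ × Fin 2)) (next : ℕ) :
    ∀ g ∈ (ctlChain .not t c cs next).1, g.op = .not := by
  induction cs generalizing c next with
  | nil => simp [ctlChain]
  | cons d ds ih =>
    intro g hg
    simp only [ctlChain, List.cons_append, List.mem_cons, List.mem_append, List.not_mem_nil,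
      or_false] at hg
    rcases hg with rfl | h | rfl
    exacts [rfl, ih _ _ g h, rfl]

theorem op_multiCtl (t : ℕ) (cs : List (ℕ × Fin 2)) (next : ℕ) :
    ∀ g ∈ (multiCtl .not t cs next).1, g.op = .not := by
  cases cs with
  | nil => simp [multiCtl]
  | cons c cs => exact op_ctlChain _ _ _ _

theorem Gate.Elementary.isNot {m : ℕ} {g : Gate} (h : g.Elementary m) (hop : g.op = .not) :
    g.IsNot := ⟨hop, Gate.ctl_ne_of_nodup h.2.1⟩

/-- A multiply controlled NOT gate. -/
theorem run_multiCtl_not {t next : ℕ} {cs : List (ℕ × Fin 2)}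
    (ht : t < next) (hcs : ∀ d ∈ cs, d.1 < next ∧ d.1 ≠ t) {x : Bits} (hx : Fresh next x) :
    run (multiCtl .not t cs next).1 (ket x) =
      ket (if Holds cs x then Function.update x t (x t + 1) else x) := by
  rw [run_multiCtl ht hcs hx, Gate.lin_not rfl]
  simp only [Gate.flip, holds_nil, if_true]
  split_ifs <;> rfl

/-! ## Controlled permutations -/

/-- The composition of a list of transpositions. -/
def swaps (l : List (ℕ × ℕ)) : Equiv.Perm ℕ := (l.map fun p => Equiv.swap p.1 p.2).prod

theorem swaps_cons (p : ℕ × ℕ) (l : List (ℕ × ℕ)) (w : ℕ) :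
    swaps (p :: l) w = Equiv.swap p.1 p.2 (swaps l w) := by
  simp [swaps]

theorem swaps_of_notMem {l : List (ℕ × ℕ)} {w : ℕ} (h : ∀ p ∈ l, w ≠ p.1 ∧ w ≠ p.2) :
    swaps l w = w := by
  induction l with
  | nil => rfl
  | cons p l ih =>
    rw [swaps_cons, ih fun q hq => h q (by simp [hq])]
    exact Equiv.swap_apply_of_ne_of_ne (h p (by simp)).1 (h p (by simp)).2

theorem swaps_of_mem {l : List (ℕ × ℕ)}
    (h : l.Pairwise fun p q => p.1 ≠ q.1 ∧ p.1 ≠ q.2 ∧ p.2 ≠ q.1 ∧ p.2 ≠ q.2) {p : ℕ × ℕ}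
    (hp : p ∈ l) : swaps l p.1 = p.2 ∧ swaps l p.2 = p.1 := by
  induction l with
  | nil => simp at hp
  | cons q l ih =>
    rw [List.pairwise_cons] at h
    rw [swaps_cons, swaps_cons]
    rcases List.mem_cons.mp hp with rfl | hp
    · rw [swaps_of_notMem fun r hr => ⟨(h.1 r hr).1, (h.1 r hr).2.1⟩,
        swaps_of_notMem fun r hr => ⟨(h.1 r hr).2.2.1, (h.1 r hr).2.2.2⟩]
      exact ⟨Equiv.swap_apply_left _ _, Equiv.swap_apply_right _ _⟩
    · obtain ⟨h1, h2⟩ := ih h.2 hp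
      have := h.1 p hp
      rw [h1, h2]
      exact ⟨Equiv.swap_apply_of_ne_of_ne this.2.1.symm this.2.2.2.symm,
        Equiv.swap_apply_of_ne_of_ne this.1.symm this.2.2.1.symm⟩

/-- A swap is three controlled NOTs, and only the middle one needs the control: without it the outer
two cancel. -/
theorem flips_cswap {c x y : ℕ} (hcx : c ≠ x) (hcy : c ≠ y) (hxy : x ≠ y) (z : Bits) :
    flips (cswap c x y) z = if z c = 1 then z ∘ Equiv.swap x y else z := by
  funext w
  have h2 : ∀ v : Fin 2, v = 0 ∨ v = 1 := by decide
  have e2 : (1 : Fin 2) + 1 = 0 := by decide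
  simp only [cswap, flips_cons, flips_nil, Gate.flip, holds_cons, holds_nil, and_true]
  by_cases hwx : w = x
  · subst hwx
    rcases h2 (z c) with hc | hc <;> rcases h2 (z w) with hx | hx <;> rcases h2 (z y) with hy | hy <;>
      simp [hc, hx, hy, hcx, hxy, hxy.symm, e2]
  · by_cases hwy : w = y
    · subst hwy
      rcases h2 (z c) with hc | hc <;> rcases h2 (z x) with hx | hx <;>
        rcases h2 (z w) with hy | hy <;>
        simp [hc, hx, hy, hcx, hxy, hxy.symm, e2]
    · rcases h2 (z c) with hc | hc <;> rcases h2 (z x) with hx | hx <;>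
        rcases h2 (z y) with hy | hy <;>
        simp [hc, hx, hy, hcx, hxy, hxy.symm, e2, hwx, hwy,
          Equiv.swap_apply_of_ne_of_ne hwx hwy]

/-- No control wire is moved, so all the factors see the same value `b`. Basis states are functions
of wires, hence gates executed one after the other compose on the right, in the order of the list.
-/
theorem flips_cswaps {l : List ℕ} {c : ℕ → ℕ} {s : ℕ → ℕ × ℕ} {b : Fin 2} {z : Bits}
    (hne : ∀ j ∈ l, c j ≠ (s j).1 ∧ c j ≠ (s j).2 ∧ (s j).1 ≠ (s j).2)
    (hc : ∀ i ∈ l, ∀ j ∈ l, c i ≠ (s j).1 ∧ c i ≠ (s j).2) (hz : ∀ j ∈ l, z (c j) = b) :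
    flips (l.flatMap fun j => cswap (c j) (s j).1 (s j).2) z =
      if b = 1 then z ∘ swaps (l.map s) else z := by
  induction l generalizing z with
  | nil => simp [swaps]
  | cons j l ih =>
    have hj := hne j (by simp)
    rw [List.flatMap_cons, flips_append, flips_cswap hj.1 hj.2.1 hj.2.2, hz j (by simp)]
    rw [ih (fun i hi => hne i (by simp [hi]))
      (fun i hi i' hi' => hc i (by simp [hi]) i' (by simp [hi']))]
    · split_ifs
      · funext w
        simp only [Function.comp_apply, List.map_cons, swaps_cons]
      · rfl
    · intro i hi
      have hi' := hz i (by simp [hi])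
      split_ifs
      · have := hc i (by simp [hi]) j (by simp)
        rw [Function.comp_apply, Equiv.swap_apply_of_ne_of_ne this.1 this.2, hi']
      · exact hi'

/-- The copies of the control of a controlled permutation. -/
def copyWire (b next j : ℕ) : ℕ := if j = 0 then b else next + (j - 1)

/-- The copies form a binary heap with root `b`: copy `j + 1` is read off copy `(j + 1) / 2`, which
already exists when the gates are executed in the order of the list. -/
theorem flips_fanOut {b next : ℕ} (hb : b < next) {x : Bits} (hx : Fresh next x) (K : ℕ) :
    flips ((List.range K).map fun j =>
      (⟨[(copyWire b next ((j + 1) / 2), 1)], .not, copyWire b next (j + 1)⟩ : Gate)) x =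
      fun w => if next ≤ w ∧ w < next + K then x b else x w := by
  induction K with
  | zero =>
    funext w
    simp only [List.range_zero, List.map_nil, flips_nil]
    rw [if_neg (by omega)]
  | succ K ih =>
    rw [List.range_succ, List.map_append, flips_append, ih]
    simp only [List.map_cons, List.map_nil, flips_cons, flips_nil, Gate.flip, holds_cons, holds_nil,
      and_true]
    have hcopy : copyWire b next (K + 1) = next + K := by simp [copyWire]
    have hctl : (if next ≤ copyWire b next ((K + 1) / 2) ∧
        copyWire b next ((K + 1) / 2) < next + K then x b else
        x (copyWire b next ((K + 1) / 2))) = x b := by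
      unfold copyWire
      split_ifs with h1 h2 h3
      · omega
      · rfl
      · rfl
      · omega
    rw [hctl, hcopy]
    have h2 : ∀ v : Fin 2, v = 0 ∨ v = 1 := by decide
    funext w
    by_cases hw : w = next + K
    · subst hw
      rcases h2 (x b) with h | h <;> simp [h, hx (next + K) (by omega)]
    · have : (next ≤ w ∧ w < next + (K + 1)) ↔ (next ≤ w ∧ w < next + K) := by omega
      simp only [this]
      split_ifs <;> simp [*]

/-- The permutation of wires performed by a controlled permutation. -/
def ctlPermEquiv (src dst : List ℕ) (next : ℕ) : Equiv.Perm ℕ :=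
  swaps ((List.range src.length).map fun j => (src.getD j 0, next + src.length + j)) *
    swaps ((List.range src.length).map fun j => (next + src.length + j, dst.getD j 0))

theorem op_ctlPerm (b : ℕ) (src dst : List ℕ) (next : ℕ) :
    ∀ g ∈ (ctlPerm b src dst next).1, g.op = .not := by
  intro g hg
  simp only [ctlPerm, List.mem_append, List.mem_map, List.mem_flatMap, cswap, List.mem_cons,
    List.not_mem_nil, or_false] at hg
  rcases hg with (⟨j, _, rfl⟩ | ⟨j, _, rfl | rfl | rfl⟩) | ⟨j, _, rfl | rfl | rfl⟩ <;> rfl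

/-- The two layers of swaps touch only qubits and the scratch wires above the copies, so the copies
written by the fan-out control both layers unchanged. -/
theorem flips_ctlPerm {b next : ℕ} {src dst : List ℕ} (hb : b < next)
    (hsrc : ∀ w ∈ src, w < next) (hdst : ∀ w ∈ dst, w < next)
    (hlen : src.length = dst.length) {x : Bits} (hx : Fresh next x) :
    flips (ctlPerm b src dst next).1 x = if x b = 1 then
      (fun w => if next ≤ w ∧ w < next + src.length then 1 else x w) ∘ ctlPermEquiv src dst next
      else x := by
  have hs : ∀ j, j < src.length → src.getD j 0 < next := fun j hj => by
    rw [List.getD_eq_getElem _ _ hj]; exact hsrc _ (List.getElem_mem _)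
  have hd : ∀ j, j < src.length → dst.getD j 0 < next := fun j hj => by
    rw [List.getD_eq_getElem _ _ (by omega)]; exact hdst _ (List.getElem_mem _)
  simp only [ctlPerm, flips_append]
  have hf := flips_fanOut hb hx src.length
  simp only [copyWire] at hf
  rw [hf]
  have key : ∀ j, (if j + 1 = 0 then b else next + (j + 1 - 1)) = next + j := by
    intro j; simp
  simp only [key]
  rw [flips_cswaps (l := List.range src.length) (c := fun j => next + j)
    (s := fun j => (src.getD j 0, next + src.length + j)) (b := x b)]
  rotate_left
  · intro j hj
    have := hs j (by simpa using hj)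
    have := List.mem_range.mp hj
    dsimp only
    omega
  · intro i hi j hj
    have := hs j (by simpa using hj)
    have := List.mem_range.mp hi
    dsimp only
    omega
  · intro j hj
    have := List.mem_range.mp hj
    rw [if_pos (by omega)]
  rw [flips_cswaps (l := List.range src.length) (c := fun j => next + j)
    (s := fun j => (next + src.length + j, dst.getD j 0)) (b := x b)]
  rotate_left
  · intro j hj
    have := hd j (by simpa using hj)
    have := List.mem_range.mp hj
    dsimp only
    omega
  · intro i hi j hj
    have := hd j (by simpa using hj)
    have := List.mem_range.mp hi
    dsimp only
    omega
  · intro j hj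
    have hj' := List.mem_range.mp hj
    split_ifs with h
    · rw [Function.comp_apply, swaps_of_notMem, if_pos (by omega)]
      intro p hp
      obtain ⟨i, hi, rfl⟩ := List.mem_map.mp hp
      have := hs i (by simpa using hi)
      dsimp only
      omega
    · exact if_pos (by omega)
  by_cases h : x b = 1
  · simp only [if_pos h]
    rw [h]
    rfl
  · simp only [if_neg h]
    funext w
    split_ifs with hw
    · rw [hx w hw.1]
      revert h; generalize x b = v; revert v; decide
    · rfl

theorem pairwise_range_map {K : ℕ} {s : ℕ → ℕ × ℕ}
    (h : ∀ i j, i < j → j < K → (s i).1 ≠ (s j).1 ∧ (s i).1 ≠ (s j).2 ∧ (s i).2 ≠ (s j).1 ∧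
      (s i).2 ≠ (s j).2) : ((List.range K).map s).Pairwise
        fun p q => p.1 ≠ q.1 ∧ p.1 ≠ q.2 ∧ p.2 ≠ q.1 ∧ p.2 ≠ q.2 := by
  rw [List.pairwise_map]
  exact List.pairwise_lt_range.imp_of_mem fun _ hb hab => h _ _ hab (List.mem_range.mp hb)

theorem getD_ne {l : List ℕ} (hl : l.Nodup) {i j : ℕ} (hij : i < j) (hj : j < l.length) :
    l.getD i 0 ≠ l.getD j 0 := by
  rw [List.getD_eq_getElem _ _ (hij.trans hj), List.getD_eq_getElem _ _ hj]
  exact fun h => hij.ne ((hl.getElem_inj_iff).mp h)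

/-- Precomposition reverses the direction: a wire of `dst` goes to its scratch wire by the second
layer and from there to `src` by the first one. Each layer is a set of disjoint swaps as soon as
`src` and `dst` are separately duplicate-free; an overlap between them is harmless thanks to the
scratch wires. -/
theorem ctlPermEquiv_dst {next : ℕ} {src dst : List ℕ} (hsn : src.Nodup) (hdn : dst.Nodup)
    (hsrc : ∀ w ∈ src, w < next) (hdst : ∀ w ∈ dst, w < next) (hlen : src.length = dst.length)
    {w : ℕ} (hw : w ∈ dst) :
    ctlPermEquiv src dst next w = relabel dst src w := by
  have hs : ∀ j, j < src.length → src.getD j 0 < next := fun j hj => by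
    rw [List.getD_eq_getElem _ _ hj]; exact hsrc _ (List.getElem_mem _)
  have hd : ∀ j, j < src.length → dst.getD j 0 < next := fun j hj => by
    rw [List.getD_eq_getElem _ _ (by omega)]; exact hdst _ (List.getElem_mem _)
  obtain ⟨j, hj, rfl⟩ := List.mem_iff_getElem.mp hw
  rw [relabel_getElem hdn hlen.symm, ctlPermEquiv, Equiv.Perm.mul_apply]
  have h1 := (swaps_of_mem (pairwise_range_map (K := src.length)
    (s := fun j => (next + src.length + j, dst.getD j 0)) (fun i j hij hj => by
      have := hd i (by omega); have := hd j (by omega)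
      have := getD_ne hdn hij (by omega)
      dsimp only
      omega)) (List.mem_map.mpr ⟨j, List.mem_range.mpr (by omega), rfl⟩)).2
  dsimp only at h1
  rw [List.getD_eq_getElem _ _ hj] at h1
  rw [h1]
  have h2 := (swaps_of_mem (pairwise_range_map (K := src.length)
    (s := fun j => (src.getD j 0, next + src.length + j)) (fun i j hij hj => by
      have := hs i (by omega); have := hs j (by omega)
      have := getD_ne hsn hij (by omega)
      dsimp only
      omega)) (List.mem_map.mpr ⟨j, List.mem_range.mpr (by omega), rfl⟩)).2
  dsimp only at h2
  rw [h2, List.getD_eq_getElem]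

theorem ctlPermEquiv_other {next : ℕ} {src dst : List ℕ} (hlen : src.length = dst.length)
    {w : ℕ} (hws : w ∉ src) (hwd : w ∉ dst) (hw : w < next ∨ next + 2 * src.length ≤ w) :
    ctlPermEquiv src dst next w = w := by
  have h₂ : swaps ((List.range src.length).map fun j => (next + src.length + j, dst.getD j 0)) w =
      w := by
    refine swaps_of_notMem fun p hp => ?_
    obtain ⟨i, hi, rfl⟩ := List.mem_map.mp hp
    have hi := List.mem_range.mp hi
    refine ⟨by dsimp only; omega, fun h => hwd ?_⟩
    dsimp only at h
    rw [h, List.getD_eq_getElem _ _ (by omega)]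
    exact List.getElem_mem _
  rw [ctlPermEquiv, Equiv.Perm.mul_apply, h₂]
  refine swaps_of_notMem fun p hp => ?_
  obtain ⟨i, hi, rfl⟩ := List.mem_map.mp hp
  have hi := List.mem_range.mp hi
  refine ⟨fun h => hws ?_, by dsimp only; omega⟩
  dsimp only at h
  rw [h, List.getD_eq_getElem _ _ hi]
  exact List.getElem_mem _

end PLP

/-! ### Composition of controlled permutations, and the ideal circuit of a dictionary. -/

namespace PLP

theorem ctlPerm_snd (b : ℕ) (src dst : List ℕ) (next : ℕ) :
    (ctlPerm b src dst next).2 = next + 2 * src.length := rfl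

theorem elementary_ctlPerm {b next : ℕ} {src dst : List ℕ} (hb : b < next)
    (hsrc : ∀ w ∈ src, w < next) (hdst : ∀ w ∈ dst, w < next) (hlen : src.length = dst.length) :
    ∀ g ∈ (ctlPerm b src dst next).1, g.Elementary (ctlPerm b src dst next).2 := by
  have hs : ∀ j, j < src.length → src.getD j 0 < next := fun j hj => by
    rw [List.getD_eq_getElem _ _ hj]; exact hsrc _ (List.getElem_mem _)
  have hd : ∀ j, j < src.length → dst.getD j 0 < next := fun j hj => by
    rw [List.getD_eq_getElem _ _ (by omega)]; exact hdst _ (List.getElem_mem _)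
  have hsw : ∀ c x y M, c ≠ x → c ≠ y → x ≠ y → c < M → x < M → y < M →
      ∀ g ∈ cswap c x y, g.Elementary M := by
    intro c x y M hcx hcy hxy hc hx hy g hg
    simp only [cswap, List.mem_cons, List.not_mem_nil, or_false] at hg
    rcases hg with rfl | rfl | rfl <;>
      refine ⟨by simp, ?_, ?_⟩ <;> simp [Gate.wires, *, Ne.symm]
  rw [ctlPerm_snd]
  intro g hg
  simp only [ctlPerm, List.mem_append, List.mem_map, List.mem_flatMap, List.mem_range] at hg
  rcases hg with (⟨j, hj, rfl⟩ | ⟨j, hj, hg⟩) | ⟨j, hj, hg⟩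
  · refine ⟨by simp, ?_, ?_⟩
    · simp only [Gate.wires, List.map_cons, List.map_nil, List.nodup_cons, List.mem_singleton,
        List.not_mem_nil, not_false_eq_true, List.nodup_nil, and_true]
      split_ifs
      all_goals first | contradiction | omega
    · intro w hw
      simp only [Gate.wires, List.map_cons, List.map_nil, List.mem_cons, List.not_mem_nil,
        or_false] at hw
      rcases hw with rfl | rfl <;> split_ifs <;> omega
  · have := hs j hj
    simp only [Nat.add_eq_zero_iff, one_ne_zero, and_false, if_false, Nat.add_sub_cancel] at hg
    exact hsw _ _ _ _ (by omega) (by omega) (by omega) (by omega) (by omega) (by omega) g hg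
  · have := hd j hj
    simp only [Nat.add_eq_zero_iff, one_ne_zero, and_false, if_false, Nat.add_sub_cancel] at hg
    exact hsw _ _ _ _ (by omega) (by omega) (by omega) (by omega) (by omega) (by omega) g hg

theorem ctlPerms_le (dst : List ℕ) (ms : List (ℕ × List ℕ)) (next : ℕ) :
    next ≤ (ctlPerms dst ms next).2 := by
  induction ms generalizing next with
  | nil => exact le_rfl
  | cons m ms ih =>
    simp only [ctlPerms]
    refine le_trans ?_ (ih _)
    rw [ctlPerm_snd]; omega

theorem op_ctlPerms (dst : List ℕ) (ms : List (ℕ × List ℕ)) (next : ℕ) :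
    ∀ g ∈ (ctlPerms dst ms next).1, g.op = .not := by
  induction ms generalizing next with
  | nil => simp [ctlPerms]
  | cons m ms ih =>
    intro g hg
    simp only [ctlPerms, List.mem_append] at hg
    rcases hg with hg | hg
    exacts [op_ctlPerm _ _ _ _ g hg, ih _ g hg]

theorem ctlPerms_append (dst : List ℕ) (ms ms' : List (ℕ × List ℕ)) (next : ℕ) :
    ctlPerms dst (ms ++ ms') next =
      ((ctlPerms dst ms next).1 ++ (ctlPerms dst ms' (ctlPerms dst ms next).2).1,
        (ctlPerms dst ms' (ctlPerms dst ms next).2).2) := by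
  induction ms generalizing next with
  | nil => rfl
  | cons m ms ih => simp [ctlPerms, ih]

/-- The permutations of wires smaller than `next` for the calls merged in an entry. -/
def PermsOk (next : ℕ) (dst : List ℕ) (ms : List (ℕ × List ℕ)) : Prop :=
  (∀ w ∈ dst, w < next) ∧
    ∀ m ∈ ms, m.1 < next ∧ (∀ w ∈ m.2, w < next) ∧ m.2.length = dst.length

theorem PermsOk.mono {a b : ℕ} (h : a ≤ b) {dst : List ℕ} {ms : List (ℕ × List ℕ)}
    (H : PermsOk a dst ms) : PermsOk b dst ms :=
  ⟨fun w hw => (H.1 w hw).trans_le h, fun m hm => ⟨(H.2 m hm).1.trans_le h,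
    fun w hw => ((H.2 m hm).2.1 w hw).trans_le h, (H.2 m hm).2.2⟩⟩

theorem elementary_ctlPerms {next : ℕ} {dst : List ℕ} {ms : List (ℕ × List ℕ)}
    (H : PermsOk next dst ms) :
    ∀ g ∈ (ctlPerms dst ms next).1, g.Elementary (ctlPerms dst ms next).2 := by
  induction ms generalizing next with
  | nil => simp [ctlPerms]
  | cons m ms ih =>
    intro g hg
    have hm := H.2 m (by simp)
    simp only [ctlPerms, List.mem_append] at hg ⊢
    rcases hg with hg | hg
    · exact (elementary_ctlPerm hm.1 hm.2.1 H.1 hm.2.2 g hg).mono (ctlPerms_le _ _ _)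
    · have hle : next ≤ (ctlPerm m.1 m.2 dst next).2 := by rw [ctlPerm_snd]; omega
      exact ih (PermsOk.mono hle ⟨H.1, fun m hm => H.2 m (by simp [hm])⟩) g hg

theorem flips_ctlPerms_inactive {next : ℕ} {dst : List ℕ} {ms : List (ℕ × List ℕ)}
    (H : PermsOk next dst ms) {x : Bits} (hx : Fresh next x) (h0 : ∀ m ∈ ms, x m.1 = 0) :
    flips (ctlPerms dst ms next).1 x = x := by
  induction ms generalizing next with
  | nil => simp [ctlPerms]
  | cons m ms ih =>
    have hm := H.2 m (by simp)
    have hle : next ≤ (ctlPerm m.1 m.2 dst next).2 := by rw [ctlPerm_snd]; omega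
    simp only [ctlPerms, flips_append]
    rw [flips_ctlPerm hm.1 hm.2.1 H.1 hm.2.2 hx, h0 m (by simp), if_neg (by decide)]
    exact ih (PermsOk.mono hle ⟨H.1, fun m hm => H.2 m (by simp [hm])⟩) (hx.mono hle)
      fun m hm => h0 m (by simp [hm])

theorem relabel_mem {dst src : List ℕ} (hl : src.length = dst.length) {w : ℕ} (hw : w ∈ dst) :
    relabel dst src w ∈ src := by
  rw [relabel, List.getD_eq_getElem _ _ (by rw [hl]; exact List.idxOf_lt_length_of_mem hw)]
  exact List.getElem_mem _

/-- The effect of the controlled permutations when exactly one of the controls has the value `1`: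
the qubits on the wires of this call are moved to the wires `dst`. -/
theorem flips_ctlPerms_active {n next : ℕ} (hn : n ≤ next) {dst : List ℕ}
    {l₁ l₂ : List (ℕ × List ℕ)} {m : ℕ × List ℕ} (H : PermsOk next dst (l₁ ++ m :: l₂))
    (hdn : dst.Nodup) (hsn : m.2.Nodup) (hd : ∀ w ∈ dst, w < n) (hs : ∀ w ∈ m.2, w < n)
    (hbits : ∀ m' ∈ l₂, n ≤ m'.1) :
    ∃ u : Bits → Bits, ∀ x, Fresh next x → (∀ m' ∈ l₁, x m'.1 = 0) → x m.1 = 1 →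
      (∀ m' ∈ l₂, x m'.1 = 0) →
      flips (ctlPerms dst (l₁ ++ m :: l₂) next).1 x = u x ∧
      (∀ w ∈ dst, u x w = x (relabel dst m.2 w)) ∧
      (∀ w ∈ dst, ∀ v, u (Function.update x (relabel dst m.2 w) v) =
        Function.update (u x) w v) ∧
      (∀ w, w < next → w ∉ m.2 → w ∉ dst → u x w = x w) ∧
      Fresh (ctlPerms dst (l₁ ++ m :: l₂) next).2 (u x) := by
  have hle := ctlPerms_le dst l₁ next
  set next' := (ctlPerms dst l₁ next).2 with hnext'
  have hm := (H.mono hle).2 m (by simp)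
  have hle' : next' ≤ (ctlPerm m.1 m.2 dst next').2 := by rw [ctlPerm_snd]; omega
  have hd' : ∀ w ∈ dst, w < next' := fun w hw => (hd w hw).trans_le (hn.trans hle)
  have hs' : ∀ w ∈ m.2, w < next' := fun w hw => (hs w hw).trans_le (hn.trans hle)
  set ρ := ctlPermEquiv m.2 dst next' with hρ
  have hρd : ∀ w ∈ dst, ρ w = relabel dst m.2 w := fun w hw =>
    ctlPermEquiv_dst hsn hdn hs' hd' hm.2.2 hw
  -- Only one permutation acts; its copies and scratch wires begin at `next'`, after those reserved
  -- by the inactive permutations of `l₁`.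
  let u : Bits → Bits := fun x =>
    (fun w => if next' ≤ w ∧ w < next' + m.2.length then 1 else x w) ∘ ρ
  have huw : ∀ x w, w ∉ m.2 → w ∉ dst → (w < next' ∨ next' + 2 * m.2.length ≤ w) →
      u x w = x w := by
    intro x w h1 h2 h3
    simp only [u, Function.comp_apply]
    rw [hρ, ctlPermEquiv_other hm.2.2 h1 h2 h3, if_neg (by omega)]
  have hfu : ∀ x, Fresh next x → Fresh (ctlPerm m.1 m.2 dst next').2 (u x) := by
    intro x hx w hw
    rw [ctlPerm_snd] at hw
    rw [huw x w (fun h => by have := hs' w h; omega) (fun h => by have := hd' w h; omega)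
      (Or.inr hw)]
    exact hx w (by omega)
  refine ⟨u, fun x hx h₁ hb h₂ => ⟨?_, ?_, ?_, ?_, ?_⟩⟩
  · rw [ctlPerms_append, flips_append, flips_ctlPerms_inactive
      ⟨H.1, fun m hm => H.2 m (by simp [hm])⟩ hx h₁]
    simp only [ctlPerms, flips_append, ← hnext']
    rw [flips_ctlPerm hm.1 hm.2.1 hd' hm.2.2 (hx.mono hle), if_pos hb]
    change flips _ (u x) = u x
    -- The controls in `l₂` lie at or above `n`, outside the qubits being moved, and below the
    -- copies, so they are still `0`.
    refine flips_ctlPerms_inactive (PermsOk.mono (hle.trans hle')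
      ⟨H.1, fun m hm => H.2 m (by simp [hm])⟩) (hfu x hx) ?_
    intro m' hm'
    have hlt := (H.2 m' (by simp [hm'])).1
    have hge := hbits m' hm'
    rw [huw x _ (fun h => by have := hs _ h; omega) (fun h => by have := hd _ h; omega)
      (Or.inl (by omega)), h₂ m' hm']
  · intro w hw
    have := hs' _ (relabel_mem hm.2.2 hw)
    simp only [u, Function.comp_apply]
    rw [hρd w hw, if_neg (by omega)]
  · intro w hw v
    have hlt := hs' _ (relabel_mem hm.2.2 hw)
    funext z
    simp only [u, Function.comp_apply, Function.update_apply]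
    by_cases hz : z = w
    · rw [if_pos hz, hz, hρd w hw, if_neg (by omega), if_pos rfl]
    · rw [if_neg hz]
      have : ρ z ≠ relabel dst m.2 w := by
        rw [← hρd w hw]; exact fun h => hz (ρ.injective h)
      rw [if_neg this]
  · intro w hw h1 h2
    exact huw x w h1 h2 (Or.inl (by omega))
  · rw [ctlPerms_append]
    simp only [ctlPerms]
    exact (hfu x hx).mono (ctlPerms_le _ _ _)

/-! ## Specification of the pending calls -/

section

variable {P : Program}

/-- The ancillas of an entry. -/
def Entry.ancs {N : ℕ} {ar : Fin N → ℕ} (e : Entry ar) : List ℕ :=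
  e.anchor :: e.merged.map Prod.fst

/-- The ancillas of a dictionary. -/
def ancs {N : ℕ} {ar : Fin N → ℕ} (D : List (Entry ar)) : List ℕ := D.flatMap Entry.ancs

theorem mem_ancs {N : ℕ} {ar : Fin N → ℕ} {D : List (Entry ar)} {w : ℕ} :
    w ∈ ancs D ↔ ∃ e ∈ D, w ∈ e.ancs := List.mem_flatMap

theorem ancs_append {N : ℕ} {ar : Fin N → ℕ} (D D' : List (Entry ar)) :
    ancs (D ++ D') = ancs D ++ ancs D' := List.flatMap_append

/-- An entry for error-free calls, with ancillas smaller than `next`. The qubits are on the wires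
smaller than `n`. -/
structure EntryOk (P : Program) (n next : ℕ) (e : Entry P.arity) : Prop where
  good : Good n e.args
  ne : ∀ j, e.args j ≠ []
  ok : ∃ A ⊆ Set.Iio n, (P.unroll e.proc e.args).Ok A
  merged : ∀ m ∈ e.merged, ∃ args : Fin (P.arity e.proc) → List ℕ,
    Good n args ∧ sizes args = sizes e.args ∧ m.2 = allWires args
  anc : ∀ w ∈ e.ancs, n ≤ w ∧ w < next

theorem EntryOk.mono {n a b : ℕ} (h : a ≤ b) {e : Entry P.arity} (he : EntryOk P n a e) :
    EntryOk P n b e :=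
  ⟨he.good, he.ne, he.ok, he.merged, fun w hw => ⟨(he.anc w hw).1, (he.anc w hw).2.trans_le h⟩⟩

/-- A call of the body of an entry, on the wires `src`. -/
noncomputable def Entry.mergedGates (e : Entry P.arity) (src : List ℕ) : List Gate :=
  ((P.unroll e.proc e.args).rename (relabel (allWires e.args) src)).gates

/-- The gates for the calls merged in an entry, with arbitrarily many controls. -/
noncomputable def Entry.spec (e : Entry P.arity) : List Gate :=
  (P.unroll e.proc e.args).gates.map
      (Gate.addCtls ((e.anchor, 1) :: e.merged.map fun m => (m.1, 0))) ++
    e.merged.flatMap fun m => (e.mergedGates m.2).map (Gate.addCtls [(m.1, 1)])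

/-- The gates for the calls of a dictionary, with arbitrarily many controls. -/
noncomputable def spec (D : List (Entry P.arity)) : List Gate := D.flatMap Entry.spec

@[simp] theorem spec_nil : spec ([] : List (Entry P.arity)) = [] := rfl

@[simp] theorem spec_cons (e : Entry P.arity) (D : List (Entry P.arity)) :
    spec (e :: D) = e.spec ++ spec D := rfl

@[simp] theorem spec_append (D D' : List (Entry P.arity)) :
    spec (D ++ D') = spec D ++ spec D' := List.flatMap_append

/-- The basis states agree on the ancillas. -/
def SameAnc (n : ℕ) (x : Bits) : Set Bits := {y | ∀ w, n ≤ w → y w = x w}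

theorem run_sameAnc {n : ℕ} {gs : List Gate} (h : ∀ g ∈ gs, g.tgt < n) (x : Bits) :
    run gs (ket x) ∈ On (SameAnc n x) :=
  run_mem fun _ hy w hw => hy w fun g hg => ((h g hg).trans_le hw).ne

theorem unroll_lt {n : ℕ} (hclone : P.NoCloning) (hrec : P.RecHalving) {p : Fin P.nprocs}
    {args : Fin (P.arity p) → List ℕ} (h : Good n args) :
    (P.unroll p args).WiresIn (Set.Iio n) :=
  (Program.unroll_wiresIn hclone hrec p args).mono (by rintro _ ⟨j, hj⟩; exact h.lt j _ hj)

/-- Shows that the relabelled body of the entry, as used in `Entry.spec`, is the unrolling of the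
merged call itself. -/
theorem EntryOk.mergedGates_eq {n next : ℕ} (hclone : P.NoCloning) (hrec : P.RecHalving)
    {e : Entry P.arity} (he : EntryOk P n next e) {args : Fin (P.arity e.proc) → List ℕ}
    (hs : sizes args = sizes e.args) :
    e.mergedGates (allWires args) = (P.unroll e.proc args).gates := by
  rw [Entry.mergedGates, ← Program.unroll_map hclone hrec]
  congr 2
  exact (args_eq_map_relabel he.good.nodup_allWires hs.symm).symm

theorem EntryOk.mergedGates_tgt {n next : ℕ} (hclone : P.NoCloning) (hrec : P.RecHalving)
    {e : Entry P.arity} (he : EntryOk P n next e) {m : ℕ × List ℕ} (hm : m ∈ e.merged) :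
    ∀ g ∈ e.mergedGates m.2, g.tgt < n := by
  obtain ⟨args, hg, hs, hw⟩ := he.merged m hm
  rw [hw, he.mergedGates_eq hclone hrec hs]
  exact (unroll_lt hclone hrec hg).tgt

theorem EntryOk.spec_tgt {n next : ℕ} (hclone : P.NoCloning) (hrec : P.RecHalving)
    {e : Entry P.arity} (he : EntryOk P n next e) : ∀ g ∈ e.spec, g.tgt < n := by
  intro g hg
  simp only [Entry.spec, List.mem_append, List.mem_map, List.mem_flatMap] at hg
  rcases hg with ⟨g, hg, rfl⟩ | ⟨m, hm, g, hg, rfl⟩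
  · exact (unroll_lt hclone hrec he.good).tgt g hg
  · exact he.mergedGates_tgt hclone hrec hm g hg

theorem spec_tgt {n next : ℕ} (hclone : P.NoCloning) (hrec : P.RecHalving)
    {D : List (Entry P.arity)} (h : ∀ e ∈ D, EntryOk P n next e) : ∀ g ∈ spec D, g.tgt < n := by
  intro g hg
  obtain ⟨e, he, hg⟩ := List.mem_flatMap.mp hg
  exact (h e he).spec_tgt hclone hrec g hg

/-- The calls of a list with controls of value `0` have no effect. -/
theorem run_merged_inactive {n : ℕ} {G : List ℕ → List Gate} {ms : List (ℕ × List ℕ)}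
    (hG : ∀ m ∈ ms, ∀ g ∈ G m.2, g.tgt < n) (hms : ∀ m ∈ ms, n ≤ m.1) {x : Bits}
    (h0 : ∀ m ∈ ms, x m.1 = 0) :
    run (ms.flatMap fun m => (G m.2).map (Gate.addCtls [(m.1, 1)])) (ket x) = ket x := by
  induction ms with
  | nil => rfl
  | cons m ms ih =>
    rw [List.flatMap_cons, run_append, run_addCtls, if_neg]
    · exact ih (fun m hm => hG m (by simp [hm])) (fun m hm => hms m (by simp [hm]))
        fun m hm => h0 m (by simp [hm])
    · simp [h0 m (by simp)]
    · intro g hg c hc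
      obtain rfl := List.mem_singleton.mp hc
      exact ((hG m (by simp) g hg).trans_le (hms m (by simp))).ne

theorem EntryOk.run_first {n next : ℕ} (hclone : P.NoCloning) (hrec : P.RecHalving)
    {e : Entry P.arity} (he : EntryOk P n next e) (x : Bits) :
    run ((P.unroll e.proc e.args).gates.map
      (Gate.addCtls ((e.anchor, 1) :: e.merged.map fun m => (m.1, 0)))) (ket x) =
      if x e.anchor = 1 ∧ ∀ m ∈ e.merged, x m.1 = 0 then
        run (P.unroll e.proc e.args).gates (ket x) else ket x := by
  rw [run_addCtls]
  · have : Holds ((e.anchor, 1) :: e.merged.map fun m => (m.1, 0)) x ↔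
        x e.anchor = 1 ∧ ∀ m ∈ e.merged, x m.1 = 0 := by
      rw [holds_cons, Holds, List.forall_mem_map]
    simp only [this]
  · intro g hg c hc
    have := (unroll_lt hclone hrec he.good).tgt g hg
    have hc' : c.1 ∈ e.ancs := by
      simp only [List.mem_cons, List.mem_map] at hc
      rcases hc with rfl | ⟨m, hm, rfl⟩
      · simp [Entry.ancs]
      · simp only [Entry.ancs, List.mem_cons, List.mem_map]; exact Or.inr ⟨m, hm, rfl⟩
    exact (lt_of_lt_of_le this (he.anc _ hc').1).ne

theorem EntryOk.le_merged {n next : ℕ} {e : Entry P.arity} (he : EntryOk P n next e) :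
    ∀ m ∈ e.merged, n ≤ m.1 := fun m hm =>
  (he.anc m.1 (by simp only [Entry.ancs, List.mem_cons, List.mem_map]; exact Or.inr ⟨m, hm, rfl⟩)).1

theorem EntryOk.run_spec_inactive {n next : ℕ} (hclone : P.NoCloning) (hrec : P.RecHalving)
    {e : Entry P.arity} (he : EntryOk P n next e) {x : Bits} (ha : x e.anchor = 0)
    (hm : ∀ m ∈ e.merged, x m.1 = 0) :
    run e.spec (ket x) = ket x := by
  rw [Entry.spec, run_append, he.run_first hclone hrec, if_neg (by simp [ha])]
  exact run_merged_inactive (fun m hm => he.mergedGates_tgt hclone hrec hm)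
    (EntryOk.le_merged he) hm

theorem EntryOk.run_spec_first {n next : ℕ} (hclone : P.NoCloning) (hrec : P.RecHalving)
    {e : Entry P.arity} (he : EntryOk P n next e) {x : Bits} (ha : x e.anchor = 1)
    (hm : ∀ m ∈ e.merged, x m.1 = 0) :
    run e.spec (ket x) = run (P.unroll e.proc e.args).gates (ket x) := by
  rw [Entry.spec, run_append, he.run_first hclone hrec, if_pos ⟨ha, hm⟩]
  refine run_id_of_forall (V := SameAnc n x) ?_
    (run_sameAnc (unroll_lt hclone hrec he.good).tgt x)
  intro y hy
  refine run_merged_inactive (fun m hm => he.mergedGates_tgt hclone hrec hm)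
    (EntryOk.le_merged he) fun m hm' => ?_
  rw [hy _ (he.le_merged m hm'), hm m hm']

/-- The bit of `m` disables the first call through its negative control; the other merged calls are
disabled by their own bits. These bits are ancillas, which the gates on qubits do not change. -/
theorem EntryOk.run_spec_merged {n next : ℕ} (hclone : P.NoCloning) (hrec : P.RecHalving)
    {e : Entry P.arity} (he : EntryOk P n next e) {x : Bits}
    {l₁ l₂ : List (ℕ × List ℕ)} {m : ℕ × List ℕ}
    (hl : e.merged = l₁ ++ m :: l₂) (h₁ : ∀ m' ∈ l₁, x m'.1 = 0) (hm : x m.1 = 1)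
    (h₂ : ∀ m' ∈ l₂, x m'.1 = 0) :
    run e.spec (ket x) = run (e.mergedGates m.2) (ket x) := by
  have hmem : m ∈ e.merged := by simp [hl]
  have ht := fun m hm => he.mergedGates_tgt hclone hrec (m := m) hm
  have hle := EntryOk.le_merged he
  rw [Entry.spec, run_append, he.run_first hclone hrec, if_neg]
  · rw [hl] at ht hle ⊢
    rw [List.flatMap_append, run_append, run_merged_inactive
      (fun m hm => ht m (by simp [hm])) (fun m hm => hle m (by simp [hm])) h₁,
      List.flatMap_cons, run_append, run_addCtls, if_pos (by simp [hm])]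
    · refine run_id_of_forall (V := SameAnc n x) ?_ (run_sameAnc (ht m (by simp)) x)
      intro y hy
      refine run_merged_inactive (fun m hm => ht m (by simp [hm]))
        (fun m hm => hle m (by simp [hm])) fun m' hm' => ?_
      rw [hy _ (hle m' (by simp [hm'])), h₂ m' hm']
    · intro g hg c hc
      obtain rfl := List.mem_singleton.mp hc
      exact ((ht m (by simp) g hg).trans_le (hle m (by simp))).ne
  · rintro ⟨-, h⟩
    rw [h m hmem] at hm
    exact absurd hm (by decide)

/-- At most one of the calls merged in the entry is pending. -/
def Entry.Conf (e : Entry P.arity) (x : Bits) : Prop :=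
  (x e.anchor = 0 → ∀ m ∈ e.merged, x m.1 = 0) ∧
    e.merged.Pairwise fun m m' => x m.1 = 0 ∨ x m'.1 = 0

/-- At most one of the calls of the dictionary is pending. -/
def Conf (D : List (Entry P.arity)) (x : Bits) : Prop :=
  (∀ e ∈ D, e.Conf x) ∧ D.Pairwise fun e e' => x e.anchor = 0 ∨ x e'.anchor = 0

theorem conf_of_zero {D : List (Entry P.arity)} {x : Bits} (h : ∀ w ∈ ancs D, x w = 0) :
    Conf D x := by
  have ha : ∀ e ∈ D, x e.anchor = 0 := fun e he => h _ (mem_ancs.mpr ⟨e, he, by simp [Entry.ancs]⟩)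
  have hm : ∀ e ∈ D, ∀ m ∈ e.merged, x m.1 = 0 := fun e he m hm => h _ (mem_ancs.mpr ⟨e, he, by
    simp only [Entry.ancs, List.mem_cons, List.mem_map]; exact Or.inr ⟨m, hm, rfl⟩⟩)
  refine ⟨fun e he => ⟨fun _ => hm e he, ?_⟩, ?_⟩
  · exact List.pairwise_of_forall_mem_list fun m hm' m' _ => Or.inl (hm e he m hm')
  · exact List.pairwise_of_forall_mem_list fun e he e' _ => Or.inl (ha e he)

theorem Conf.congr {n next : ℕ} {D : List (Entry P.arity)} (h : ∀ e ∈ D, EntryOk P n next e)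
    {x y : Bits} (hy : y ∈ SameAnc n x) (hx : Conf D x) : Conf D y := by
  have ha : ∀ e ∈ D, y e.anchor = x e.anchor := fun e he =>
    hy _ ((h e he).anc _ (by simp [Entry.ancs])).1
  have hm : ∀ e ∈ D, ∀ m ∈ e.merged, y m.1 = x m.1 := fun e he m hm =>
    hy _ ((h e he).le_merged m hm)
  refine ⟨fun e he => ⟨fun h0 m hm' => ?_, ?_⟩, ?_⟩
  · rw [hm e he m hm']
    exact (hx.1 e he).1 (by rw [← ha e he]; exact h0) m hm'
  · refine (hx.1 e he).2.imp_of_mem fun {m m'} h h' H => ?_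
    rwa [hm e he m h, hm e he m' h']
  · refine hx.2.imp_of_mem fun {e e'} h h' H => ?_
    rwa [ha e h, ha e' h']

theorem run_spec_of_inactive {n next : ℕ} (hclone : P.NoCloning) (hrec : P.RecHalving)
    {D : List (Entry P.arity)} (h : ∀ e ∈ D, EntryOk P n next e) {x : Bits} (hc : Conf D x)
    (h0 : ∀ e ∈ D, x e.anchor = 0) : run (spec D) (ket x) = ket x := by
  induction D with
  | nil => rfl
  | cons e D ih =>
    rw [spec_cons, run_append, (h e (by simp)).run_spec_inactive hclone hrec (h0 e (by simp))
      ((hc.1 e (by simp)).1 (h0 e (by simp)))]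
    exact ih (fun e he => h e (by simp [he])) ⟨fun e he => hc.1 e (by simp [he]),
      (List.pairwise_cons.mp hc.2).2⟩ fun e he => h0 e (by simp [he])

theorem fin_two_ne_zero_iff {v : Fin 2} : v ≠ 0 ↔ v = 1 := by revert v; decide

theorem run_spec_of_active {n next : ℕ} (hclone : P.NoCloning) (hrec : P.RecHalving)
    {D : List (Entry P.arity)} (h : ∀ e ∈ D, EntryOk P n next e) {x : Bits} (hc : Conf D x)
    {e : Entry P.arity} (he : e ∈ D) (hx : x e.anchor = 1) :
    run (spec D) (ket x) = run e.spec (ket x) := by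
  induction D with
  | nil => simp at he
  | cons d D ih =>
    have hp := List.pairwise_cons.mp hc.2
    have hc' : Conf D x := ⟨fun e he => hc.1 e (by simp [he]), hp.2⟩
    have hD : ∀ e ∈ D, EntryOk P n next e := fun e he => h e (by simp [he])
    rw [spec_cons, run_append]
    rcases List.mem_cons.mp he with rfl | he'
    · refine run_id_of_forall (V := SameAnc n x) ?_
        (run_sameAnc ((h e (by simp)).spec_tgt hclone hrec) x)
      intro y hy
      refine run_spec_of_inactive hclone hrec hD (hc'.congr hD hy) fun e' he' => ?_
      rw [hy _ ((hD e' he').anc _ (by simp [Entry.ancs])).1]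
      rcases hp.1 e' he' with h | h
      · rw [hx] at h; exact absurd h (by decide)
      · exact h
    · have hd : x d.anchor = 0 := by
        rcases hp.1 e he' with h | h
        · exact h
        · rw [hx] at h; exact absurd h (by decide)
      rw [(h d (by simp)).run_spec_inactive hclone hrec hd ((hc.1 d (by simp)).1 hd)]
      exact ih hD hc' he'

theorem Conf.subset {D D' : List (Entry P.arity)} {x : Bits} (h : List.Sublist D' D)
    (hc : Conf D x) : Conf D' x :=
  ⟨fun e he => hc.1 e (h.subset he), hc.2.sublist h⟩

theorem Conf.perm {D D' : List (Entry P.arity)} {x : Bits} (h : D.Perm D') (hc : Conf D x) :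
    Conf D' x :=
  ⟨fun e he => hc.1 e (h.mem_iff.mpr he), h.pairwise hc.2 fun H => H.symm⟩

/-- In a configuration at most one entry is active and the others act as the identity, so the order
does not matter. This permits sorting the dictionary by size. -/
theorem run_spec_perm {n next : ℕ} (hclone : P.NoCloning) (hrec : P.RecHalving)
    {D D' : List (Entry P.arity)} (h : ∀ e ∈ D, EntryOk P n next e) (hp : D.Perm D') {x : Bits}
    (hc : Conf D x) : run (spec D) (ket x) = run (spec D') (ket x) := by
  have h' : ∀ e ∈ D', EntryOk P n next e := fun e he => h e (hp.mem_iff.mpr he)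
  by_cases ha : ∃ e ∈ D, x e.anchor = 1
  · obtain ⟨e, he, hx⟩ := ha
    rw [run_spec_of_active hclone hrec h hc he hx,
      run_spec_of_active hclone hrec h' (hc.perm hp) (hp.mem_iff.mp he) hx]
  · push Not at ha
    have h0 : ∀ e ∈ D, x e.anchor = 0 := fun e he => by
      by_contra h; exact ha e he (fin_two_ne_zero_iff.mp h)
    rw [run_spec_of_inactive hclone hrec h hc h0, run_spec_of_inactive hclone hrec h' (hc.perm hp)
      fun e he => h0 e (hp.mem_iff.mpr he)]

end

end PLP

namespace PLP

/-! ## Correctness of the compilation of statements -/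

section

variable {P : Program}

/-- The controls are distinct, and neither fresh nor accessible. -/
def CtlOk (A : Set ℕ) (next : ℕ) (cs : List (ℕ × Fin 2)) : Prop :=
  (cs.map Prod.fst).Nodup ∧ ∀ c ∈ cs, c.1 < next ∧ c.1 ∉ A

theorem CtlOk.mono {A B : Set ℕ} {a b : ℕ} (h : a ≤ b) (hB : B ⊆ A) {cs : List (ℕ × Fin 2)}
    (hc : CtlOk A a cs) : CtlOk B b cs :=
  ⟨hc.1, fun c h' => ⟨(hc.2 c h').1.trans_le h, fun hb => (hc.2 c h').2 (hB hb)⟩⟩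

theorem CtlOk.snoc {A : Set ℕ} {next : ℕ} {cs : List (ℕ × Fin 2)} (hc : CtlOk A next cs) {w : ℕ}
    (hw : w ∈ A) (hlt : w < next) (b : Fin 2) : CtlOk (A \ {w}) next (cs ++ [(w, b)]) := by
  constructor
  · rw [List.map_append, List.nodup_append]
    refine ⟨hc.1, by simp, ?_⟩
    intro v hv v' hv' e
    simp only [List.map_cons, List.map_nil, List.mem_singleton] at hv'
    obtain ⟨c, h, rfl⟩ := List.mem_map.mp hv
    subst hv'
    exact (hc.2 c h).2 (by rw [e]; exact hw)
  · intro c h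
    rcases List.mem_append.mp h with h | h
    · exact ⟨(hc.2 c h).1, fun h' => (hc.2 c h).2 h'.1⟩
    · obtain rfl := List.mem_singleton.mp h
      exact ⟨hlt, fun h' => h'.2 rfl⟩

/-- The gates `r.1` apply the tree `t` under the controls `cs`, where the wires from `next` to
`r.2` are used as ancillas. -/
structure CallSpec (t : Tree) (cs : List (ℕ × Fin 2)) (next : ℕ) (r : List Gate × ℕ) : Prop where
  le : next ≤ r.2
  elem : ∀ g ∈ r.1, g.Elementary r.2
  off : ∀ x, Fresh next x → ¬ Holds cs x → run r.1 (ket x) = ket x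
  on : ∀ x, Fresh next x → Holds cs x → run r.1 (ket x) = run t.gates (ket x)

/-- The calls of the procedure `p` are correctly compiled by `cc`. -/
def CallOk (P : Program) (n : ℕ) (cc : (p : Fin P.nprocs) → (Fin (P.arity p) → List ℕ) →
    List (ℕ × Fin 2) → ℕ → List Gate × ℕ) (p : Fin P.nprocs) : Prop :=
  ∀ args A cs next, Good n args → (∀ j, args j ≠ []) → A ⊆ Set.Iio n → (P.unroll p args).Ok A →
    CtlOk A next cs → n ≤ next → CallSpec (P.unroll p args) cs next (cc p args cs next)

/-- An error-free tree writes only accessible wires; the controls are inaccessible, and ancillas lie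
above the qubits. -/
theorem run_tree_stable {n next : ℕ} {A : Set ℕ} {t : Tree} {cs : List (ℕ × Fin 2)}
    (hok : t.Ok A) (hA : A ⊆ Set.Iio n) (hn : n ≤ next) (hcs : CtlOk A next cs) {x : Bits}
    (hx : Fresh next x) (hh : Holds cs x) :
    run t.gates (ket x) ∈ On {y | Fresh next y ∧ Holds cs y ∧ y ∈ SameAnc n x} := by
  refine run_mem fun y hy => ?_
  have hy' : ∀ w, w ∉ A → y w = x w := fun w hw => hy w fun g hg h =>
    hw (h ▸ hok.wiresIn.tgt g hg)
  have hanc : ∀ w, n ≤ w → y w = x w := fun w hw => hy' w fun h => by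
    have := hA h; simp only [Set.mem_Iio] at this; omega
  exact ⟨fun w hw => by rw [hanc w (hn.trans hw)]; exact hx w hw,
    (holds_congr fun c hc => hy' _ (hcs.2 c hc).2).mpr hh, hanc⟩

/-- With no call to be anchored on any path, nothing becomes pending: all gates go to `pre` and the
dictionary is untouched. -/
theorem compile_width_zero {n : ℕ} {cc : (p : Fin P.nprocs) → (Fin (P.arity p) → List ℕ) →
    List (ℕ × Fin 2) → ℕ → List Gate × ℕ} {R : Fin P.nprocs → Prop} [DecidablePred R] {V : Type}
    {f : V → List ℕ} (hf : Good n f) {S : Stmt P.arity V}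
    (hcc : ∀ c ∈ S.calls, ¬ R c.1 → CallOk P n cc c.1) (hS : S.NoCloning) (hw : S.width R = 0)
    {A : Set ℕ} (hA : A ⊆ Set.Iio n) (hok : (S.tree P.unroll f).Ok A) {cs : List (ℕ × Fin 2)}
    {s : CState P.arity} (hcs : CtlOk A s.next cs) (hn : n ≤ s.next) :
    (S.compile cc R f cs s).post = [] ∧ (S.compile cc R f cs s).state.dict = s.dict ∧
      CallSpec (S.tree P.unroll f) cs s.next
        ((S.compile cc R f cs s).pre, (S.compile cc R f cs s).state.next) := by
  have hskip : ∀ s : CState P.arity, CallSpec Tree.skip cs s.next ([], s.next) := fun s =>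
    ⟨le_rfl, by simp, fun _ _ _ => rfl, fun _ _ _ => rfl⟩
  induction S generalizing A cs s with
  | skip => exact ⟨rfl, rfl, hskip s⟩
  | app q U =>
    simp only [Stmt.tree, Stmt.compile] at hok ⊢
    by_cases hv : q.Valid f
    · rw [if_pos hv] at hok ⊢
      have hq : (q.eval f : ℕ) ∈ A := hok
      have hqn : (q.eval f : ℕ) < n := hA hq
      have hne : ∀ d ∈ cs, d.1 < s.next ∧ d.1 ≠ (q.eval f : ℕ) := fun d hd =>
        ⟨(hcs.2 d hd).1, fun e => (hcs.2 d hd).2 (by rw [e]; exact hq)⟩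
      refine ⟨trivial, trivial, multiCtl_le _ _ _ _,
        elementary_multiCtl (hqn.trans_le hn) hne hcs.1, ?_, ?_⟩
      · intro x hx hh
        rw [run_multiCtl (hqn.trans_le hn) hne hx, if_neg hh]
      · intro x hx hh
        rw [run_multiCtl (hqn.trans_le hn) hne hx, if_pos hh]
        rfl
    · rw [if_neg hv] at hok
      exact hok.elim
  | seq S₀ S₁ ih₀ ih₁ =>
    simp only [Stmt.width, Nat.add_eq_zero_iff] at hw
    obtain ⟨p₀, d₀, c₀⟩ := ih₀ (fun c hc => hcc c (by simp [Stmt.calls, hc])) hS.1 hw.1 hA hok.1 hcs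
      hn hskip
    obtain ⟨p₁, d₁, c₁⟩ := ih₁ (fun c hc => hcc c (by simp [Stmt.calls, hc])) hS.2 hw.2 hA hok.2
      (s := (S₀.compile cc R f cs s).state) (hcs.mono c₀.le le_rfl) (hn.trans c₀.le) hskip
    simp only [Stmt.compile, Stmt.tree, hw.1, if_true, p₀, List.append_nil]
    refine ⟨p₁, d₁.trans d₀, c₀.le.trans c₁.le, ?_, ?_, ?_⟩
    · intro g hg
      rcases List.mem_append.mp hg with hg | hg
      exacts [(c₀.elem g hg).mono c₁.le, c₁.elem g hg]
    · intro x hx hh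
      simp only [run_append]
      rw [c₀.off x hx hh, c₁.off x (hx.mono c₀.le) hh]
    · intro x hx hh
      simp only [Tree.gates, run_append]
      rw [c₀.on x hx hh]
      refine lin_agree ?_ (run_tree_stable hok.1 hA hn hcs hx hh)
      rintro y ⟨hy, hy', -⟩
      exact c₁.on y (hy.mono c₀.le) hy'
  | ite b S₁ S₀ ih₁ ih₀ =>
    simp only [Stmt.width, Nat.max_eq_zero_iff] at hw
    simp only [Stmt.compile, Stmt.tree] at hok ⊢
    split_ifs at hok ⊢
    · exact ih₁ (fun c hc => hcc c (by simp [Stmt.calls, hc])) hS.1 hw.1 hA hok hcs hn hskip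
    · exact ih₀ (fun c hc => hcc c (by simp [Stmt.calls, hc])) hS.2 hw.2 hA hok hcs hn hskip
  | qcase q S₀ S₁ ih₀ ih₁ =>
    simp only [Stmt.width, Nat.max_eq_zero_iff] at hw
    simp only [Stmt.tree] at hok ⊢
    by_cases hv : q.Valid f
    · rw [if_pos hv] at hok ⊢
      have hqn : (q.eval f : ℕ) < s.next := lt_of_lt_of_le (hA hok.1) hn
      have hA' : A \ {(q.eval f : ℕ)} ⊆ Set.Iio n := Set.sdiff_subset.trans hA
      obtain ⟨p₀, d₀, c₀⟩ := ih₀ (fun c hc => hcc c (by simp [Stmt.calls, hc])) hS.1 hw.1 hA'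
        hok.2.1 (hcs.snoc hok.1 hqn 0) hn fun s =>
          ⟨le_rfl, by simp, fun _ _ _ => rfl, fun _ _ _ => rfl⟩
      obtain ⟨p₁, d₁, c₁⟩ := ih₁ (fun c hc => hcc c (by simp [Stmt.calls, hc])) hS.2 hw.2 hA'
        hok.2.2 (s := (S₀.compile cc R f (cs ++ [(q.eval f, 0)]) s).state)
        ((hcs.snoc hok.1 hqn 1).mono c₀.le le_rfl) (hn.trans c₀.le) fun s =>
          ⟨le_rfl, by simp, fun _ _ _ => rfl, fun _ _ _ => rfl⟩
      simp only [Stmt.compile, p₀, p₁, List.append_nil]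
      refine ⟨trivial, d₁.trans d₀, c₀.le.trans c₁.le, ?_, ?_, ?_⟩
      · intro g hg
        rcases List.mem_append.mp hg with hg | hg
        exacts [(c₀.elem g hg).mono c₁.le, c₁.elem g hg]
      · intro x hx hh
        simp only [run_append]
        rw [c₀.off x hx fun h => hh ((holds_append _ _ _).mp h).1,
          c₁.off x (hx.mono c₀.le) fun h => hh ((holds_append _ _ _).mp h).1]
      · intro x hx hh
        rw [run_qcase hok]
        simp only [run_append]
        by_cases h0 : x (q.eval f) = 0
        · have hh0 : Holds (cs ++ [((q.eval f : ℕ), (0 : Fin 2))]) x := by simp [hh, h0]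
          rw [if_pos h0, c₀.on x hx hh0]
          -- The first branch cannot write the wire of the `qcase`, so the controls of the second
          -- branch still fail.
          refine run_id_of_forall ?_ (run_tree_stable hok.2.1 hA' hn (hcs.snoc hok.1 hqn 0) hx hh0)
          rintro y ⟨hy, hy', -⟩
          refine c₁.off y (hy.mono c₀.le) fun h => ?_
          have e0 := ((holds_append _ _ _).mp hy').2
          have e1 := ((holds_append _ _ _).mp h).2
          simp only [holds_cons, holds_nil, and_true] at e0 e1
          rw [e0] at e1
          exact absurd e1 (by decide)
        · rw [if_neg h0, c₀.off x hx (by simp [h0]), c₁.on x (hx.mono c₀.le)]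
          simp [hh, fin_two_ne_zero_iff.mp h0]
    · rw [if_neg hv] at hok
      exact hok.elim
  | call p args =>
    have hR : ¬ R p := by
      intro h; simp [Stmt.width, h] at hw
    simp only [Stmt.compile, Stmt.tree, if_neg hR] at hok ⊢
    split_ifs at hok ⊢ with he
    · exact ⟨rfl, rfl, hskip s⟩
    · refine ⟨rfl, rfl, ?_⟩
      exact hcc ⟨p, args⟩ (by simp [Stmt.calls]) hR _ A cs s.next (hf.eval hS) (by simpa using he)
        hA hok hcs hn

/-- The key of an entry. -/
def Entry.key {N : ℕ} {ar : Fin N → ℕ} (e : Entry ar) : Fin N × List ℕ := (e.proc, sizes e.args)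

theorem Entry.serves_iff {N : ℕ} {ar : Fin N → ℕ} (e : Entry ar) (p : Fin N) (l : List ℕ) :
    e.serves p l = true ↔ e.key = (p, l) := by
  simp [Entry.serves, Entry.key]

/-- A dictionary with distinct keys and distinct ancillas. -/
structure DictOk (P : Program) (n : ℕ) (s : CState P.arity) : Prop where
  entry : ∀ e ∈ s.dict, EntryOk P n s.next e
  keys : (s.dict.map Entry.key).Nodup
  nodup : (ancs s.dict).Nodup

theorem DictOk.anc {n : ℕ} {s : CState P.arity} (h : DictOk P n s) :
    ∀ w ∈ ancs s.dict, n ≤ w ∧ w < s.next := by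
  intro w hw
  obtain ⟨e, he, hw⟩ := mem_ancs.mp hw
  exact (h.entry e he).anc w hw

/-- The states in which a statement is executed: the controls are satisfied, and no call is
pending. -/
def Start (cs : List (ℕ × Fin 2)) (s : CState P.arity) : Set Bits :=
  {x | Fresh s.next x ∧ Holds cs x ∧ ∀ w ∈ ancs s.dict, x w = 0}

/-- The states reached from `x` before the pending calls. -/
def Middle (n : ℕ) (cs : List (ℕ × Fin 2)) (s s' : CState P.arity) (x : Bits) : Set Bits :=
  {y | Fresh s'.next y ∧ Holds cs y ∧ Conf s'.dict y ∧
    (∀ w, n ≤ w → w < s.next → w ∉ ancs s.dict → y w = x w) ∧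
    run (spec s'.dict) (ket y) ∈ On {z | ∀ c ∈ cs, z c.1 = y c.1}}

/-- The specification of the compilation of a statement. -/
structure StmtSpec (P : Program) (n : ℕ) (t : Tree) (cs : List (ℕ × Fin 2)) (s : CState P.arity)
    (out : Output P.arity) : Prop where
  le : s.next ≤ out.state.next
  elem_pre : ∀ g ∈ out.pre, g.Elementary out.state.next
  elem_post : ∀ g ∈ out.post, g.Elementary out.state.next
  dict : DictOk P n out.state
  anc_mem : ∀ w ∈ ancs out.state.dict, w ∈ ancs s.dict ∨ s.next ≤ w
  off_pre : ∀ x, Fresh s.next x → ¬ Holds cs x → run out.pre (ket x) = ket x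
  off_post : ∀ x, Fresh s.next x → ¬ Holds cs x → run out.post (ket x) = ket x
  spec_eq : ∀ x, Fresh s.next x →
    run (spec out.state.dict) (ket x) = run (spec s.dict) (ket x)
  conf : ∀ x, Fresh s.next x → Conf s.dict x → Conf out.state.dict x
  on : ∀ x ∈ Start cs s,
    run out.post (run (spec out.state.dict) (run out.pre (ket x))) = run t.gates (ket x)
  mid : ∀ x ∈ Start cs s, run out.pre (ket x) ∈ On (Middle n cs s out.state x)

theorem DictOk.mono {n : ℕ} {s s' : CState P.arity} (h : DictOk P n s) (hd : s'.dict = s.dict)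
    (hle : s.next ≤ s'.next) : DictOk P n s' :=
  ⟨by rw [hd]; exact fun e he => (h.entry e he).mono hle, by rw [hd]; exact h.keys,
    by rw [hd]; exact h.nodup⟩

theorem run_spec_zero {n : ℕ} (hclone : P.NoCloning) (hrec : P.RecHalving) {s : CState P.arity}
    (hd : DictOk P n s) {x : Bits} (h0 : ∀ w ∈ ancs s.dict, x w = 0) :
    run (spec s.dict) (ket x) = ket x :=
  run_spec_of_inactive hclone hrec hd.entry (conf_of_zero h0) fun e he =>
    h0 _ (mem_ancs.mpr ⟨e, he, by simp [Entry.ancs]⟩)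

/-- A statement that announces no call fits the general invariant with an empty `post`: all ancillas
of the dictionary are still `0`, where the ideal circuit of the dictionary is the identity. -/
theorem CallSpec.stmtSpec {n : ℕ} (hclone : P.NoCloning) (hrec : P.RecHalving) {A : Set ℕ}
    (hA : A ⊆ Set.Iio n) {t : Tree} (hok : t.Ok A) {cs : List (ℕ × Fin 2)} {s : CState P.arity}
    (hcs : CtlOk A s.next cs) (hn : n ≤ s.next) (hd : DictOk P n s) {out : Output P.arity}
    (hpost : out.post = []) (hdict : out.state.dict = s.dict)
    (h : CallSpec t cs s.next (out.pre, out.state.next)) : StmtSpec P n t cs s out where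
  le := h.le
  elem_pre := h.elem
  elem_post := by simp [hpost]
  dict := hd.mono hdict h.le
  anc_mem w hw := Or.inl (hdict ▸ hw)
  off_pre := h.off
  off_post := by simp [hpost]
  spec_eq x hx := by rw [hdict]
  conf x hx hc := by rw [hdict]; exact hc
  on x hx := by
    obtain ⟨h1, h2, h3⟩ := hx
    rw [hpost, hdict, h.on x h1 h2, run_nil]
    refine run_id_of_forall ?_ (run_tree_stable hok hA hn hcs h1 h2)
    rintro y ⟨-, -, hy⟩
    exact run_spec_zero hclone hrec hd fun w hw => by rw [hy w (hd.anc w hw).1, h3 w hw]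
  mid x hx := by
    obtain ⟨h1, h2, h3⟩ := hx
    rw [h.on x h1 h2]
    refine On_mono ?_ (run_tree_stable hok hA hn hcs h1 h2)
    rintro y ⟨hy, hy', hy''⟩
    have h0 : ∀ w ∈ ancs s.dict, y w = 0 := fun w hw => by
      rw [hy'' w (hd.anc w hw).1, h3 w hw]
    refine ⟨hy.mono h.le, hy', hdict ▸ conf_of_zero h0, fun w hw _ _ => hy'' w hw, ?_⟩
    rw [hdict, run_spec_zero hclone hrec hd h0]
    exact ket_mem_On fun c _ => rfl

/-! ### Anchoring and merging -/

theorem Gate.rename_id (g : Gate) : g.rename id = g := by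
  simp [Gate.rename]

/-- The specification of a call that is announced by setting the ancillas in `W`. -/
theorem StmtSpec.of_set_ancillas {n : ℕ} {A : Set ℕ}
    (hA : A ⊆ Set.Iio n) {t : Tree} (hok : t.Ok A) {cs : List (ℕ × Fin 2)} {s : CState P.arity}
    (hcs : CtlOk A s.next cs) (hcs' : ∀ c ∈ cs, c.1 ∉ ancs s.dict) (hn : n ≤ s.next)
    (hd : DictOk P n s) {out : Output P.arity} (hle : s.next ≤ out.state.next)
    (helem : ∀ g ∈ out.pre, g.Elementary out.state.next) (hop : ∀ g ∈ out.pre, g.op = .not)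
    (hpost : out.post = out.pre.reverse) (hd' : DictOk P n out.state)
    (hancs : ∀ w ∈ ancs out.state.dict, w ∈ ancs s.dict ∨ s.next ≤ w)
    (hoff : ∀ x, Fresh s.next x → ¬ Holds cs x → run out.pre (ket x) = ket x)
    (hspec : ∀ x, Fresh s.next x →
      run (spec out.state.dict) (ket x) = run (spec s.dict) (ket x))
    (hconf : ∀ x, Fresh s.next x → Conf s.dict x → Conf out.state.dict x)
    {W : List ℕ} (hW : ∀ w ∈ W, (w ∈ ancs s.dict ∨ s.next ≤ w) ∧ w < out.state.next)
    (hpre : ∀ x ∈ Start cs s, run out.pre (ket x) = ket fun w => if w ∈ W then 1 else x w)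
    (hconf' : ∀ x ∈ Start cs s, Conf out.state.dict fun w => if w ∈ W then 1 else x w)
    (hcall : ∀ x ∈ Start cs s, run (spec out.state.dict) (ket fun w => if w ∈ W then 1 else x w) =
      run t.gates (ket fun w => if w ∈ W then 1 else x w)) :
    StmtSpec P n t cs s out := by
  have hnot : ∀ g ∈ out.pre, g.IsNot := fun g hg => (helem g hg).isNot (hop g hg)
  have hWn : ∀ w ∈ W, n ≤ w := fun w hw => by
    rcases (hW w hw).1 with h | h
    exacts [(hd.anc w h).1, hn.trans h]
  have hWcs : ∀ c ∈ cs, c.1 ∉ W := fun c hc h => by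
    rcases (hW _ h).1 with h | h
    exacts [hcs' c hc h, absurd (hcs.2 c hc).1 (by omega)]
  refine ⟨hle, helem, ?_, hd', hancs, hoff, ?_, hspec, hconf, ?_, ?_⟩
  · rw [hpost]; exact fun g hg => helem g (List.mem_reverse.mp hg)
  · intro x hx hh
    have := run_reverse_run hnot (ket x)
    rwa [hoff x hx hh, ← hpost] at this
  · intro x hx
    rw [hpre x hx, hcall x hx, ← hpre x hx]
    -- `pre` sets ancillas at or above `n`, while the tree works on qubits below `n`, so they
    -- commute: conjugation with the identity renaming. Afterwards `post` undoes `pre`.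
    have key := run_conj (gs := t.gates) (σ := id)
      (u := fun x w => if w ∈ W then 1 else x w) (L := run out.pre) (Z := Start cs s) hpre
      (by
        intro x hx g hg w hw
        have : w < n := hA (hok.wiresIn.gates g hg w hw)
        simp only [id]
        rw [if_neg fun h => by have := hWn w h; omega])
      (by
        intro x hx g hg v
        have hgA : g.tgt ∈ A := hok.wiresIn.tgt g hg
        have hgn : g.tgt < n := hA hgA
        have hgW : g.tgt ∉ W := fun h => by have := hWn _ h; omega
        constructor
        · funext w
          simp only [id, Function.update_apply]
          by_cases hw : w = g.tgt
          · subst hw; simp [hgW]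
          · simp [hw]
        · obtain ⟨h1, h2, h3⟩ := hx
          refine ⟨fun w hw => ?_, ?_, fun w hw => ?_⟩
          · simp only [id]
            rw [Function.update_of_ne (by omega)]; exact h1 w hw
          · refine (holds_congr fun c hc => ?_).mpr h2
            simp only [id]
            refine Function.update_of_ne (fun e => (hcs.2 c hc).2 (by rw [e]; exact hgA)) _ _
          · have := (hd.anc w hw).1
            simp only [id]
            rw [Function.update_of_ne (by omega)]; exact h3 w hw) hx
    rw [key, hpost, run_reverse_run hnot]
    congr 2
    simp [funext Gate.rename_id]
  · intro x hx
    rw [hpre x hx]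
    refine ket_mem_On ⟨fun w hw => ?_, ?_, hconf' x hx, fun w hw hw' hw'' => ?_, ?_⟩
    · dsimp only
      rw [if_neg fun h => by have := (hW w h).2; omega]
      exact hx.1 w (hle.trans hw)
    · refine (holds_congr fun c hc => ?_).mpr hx.2.1
      rw [if_neg (hWcs c hc)]
    · dsimp only
      rw [if_neg fun h => ?_]
      rcases (hW w h).1 with h | h
      exacts [hw'' h, absurd hw' (by omega)]
    · rw [hcall x hx]
      refine run_mem fun y hy c hc => hy _ fun g hg e => (hcs.2 c hc).2 ?_
      rw [← e]; exact hok.wiresIn.tgt g hg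

theorem fin_two_add_one_of_zero {v : Fin 2} (h : v = 0) : v + 1 = 1 := by rw [h]; rfl

/-- A call whose key is new. -/
theorem stmtSpec_anchor {n : ℕ} (hclone : P.NoCloning) (hrec : P.RecHalving) {A : Set ℕ}
    (hA : A ⊆ Set.Iio n) {p : Fin P.nprocs} {args : Fin (P.arity p) → List ℕ}
    (hargs : Good n args) (hne : ∀ j, args j ≠ []) (hok : (P.unroll p args).Ok A)
    {cs : List (ℕ × Fin 2)} {s : CState P.arity} (hcs : CtlOk A s.next cs)
    (hcs' : ∀ c ∈ cs, c.1 ∉ ancs s.dict) (hn : n ≤ s.next) (hd : DictOk P n s)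
    (hnew : ∀ e ∈ s.dict, e.key ≠ (p, sizes args)) :
    StmtSpec P n (P.unroll p args) cs s ⟨(multiCtl .not s.next cs (s.next + 1)).1,
      (multiCtl .not s.next cs (s.next + 1)).1.reverse,
      ⟨(multiCtl .not s.next cs (s.next + 1)).2, s.dict ++ [⟨p, args, s.next, []⟩]⟩⟩ := by
  have hle := multiCtl_le .not s.next cs (s.next + 1)
  set e₀ : Entry P.arity := ⟨p, args, s.next, []⟩ with he₀
  have hc1 : ∀ d ∈ cs, d.1 < s.next + 1 ∧ d.1 ≠ s.next := fun d hd =>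
    ⟨by have := (hcs.2 d hd).1; omega, (hcs.2 d hd).1.ne⟩
  have hE : EntryOk P n (multiCtl .not s.next cs (s.next + 1)).2 e₀ := by
    refine ⟨hargs, hne, ⟨A, hA, hok⟩, by simp [he₀], ?_⟩
    intro w hw
    simp only [he₀, Entry.ancs, List.map_nil, List.mem_singleton] at hw
    subst hw
    exact ⟨hn, by omega⟩
  have hancs : ancs (s.dict ++ [e₀]) = ancs s.dict ++ [s.next] := by
    rw [ancs_append]; simp [ancs, he₀, Entry.ancs]
  have hD : DictOk P n ⟨(multiCtl .not s.next cs (s.next + 1)).2, s.dict ++ [e₀]⟩ := by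
    refine ⟨fun e he => ?_, ?_, ?_⟩
    · rcases List.mem_append.mp he with he | he
      · exact (hd.entry e he).mono (by dsimp only; omega)
      · obtain rfl := List.mem_singleton.mp he
        exact hE
    · simp only [List.map_append, List.map_cons, List.map_nil]
      rw [List.nodup_append]
      refine ⟨hd.keys, by simp, ?_⟩
      intro k hk k' hk' e
      obtain ⟨e', he', rfl⟩ := List.mem_map.mp hk
      rw [List.mem_singleton] at hk'
      exact hnew e' he' (e.trans hk')
    · dsimp only
      rw [hancs, List.nodup_append]
      refine ⟨hd.nodup, by simp, ?_⟩
      intro w hw w' hw' e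
      rw [List.mem_singleton] at hw'
      have := (hd.anc w hw).2
      omega
  have hpre : ∀ x, Fresh s.next x → run (multiCtl .not s.next cs (s.next + 1)).1 (ket x) =
      ket (if Holds cs x then Function.update x s.next (x s.next + 1) else x) :=
    fun x hx => run_multiCtl_not (by omega) hc1 (hx.mono (by omega))
  have hconfx : ∀ x, Fresh s.next x → Conf s.dict x → Conf (s.dict ++ [e₀]) x := by
    intro x hx hc
    have h0 : x e₀.anchor = 0 := hx _ le_rfl
    refine ⟨fun e he => ?_, ?_⟩
    · rcases List.mem_append.mp he with he | he
      · exact hc.1 e he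
      · obtain rfl := List.mem_singleton.mp he
        exact ⟨fun _ m hm => by simp [he₀] at hm, by simp [he₀]⟩
    · rw [List.pairwise_append]
      refine ⟨hc.2, by simp, fun e he e' he' => ?_⟩
      obtain rfl := List.mem_singleton.mp he'
      exact Or.inr h0
  have hstart : ∀ x ∈ Start cs s, (fun w => if w ∈ [s.next] then (1 : Fin 2) else x w) =
      Function.update x s.next (x s.next + 1) := by
    intro x hx
    funext w
    rw [Function.update_apply]
    simp only [List.mem_singleton]
    rw [fin_two_add_one_of_zero (hx.1 _ le_rfl)]
  have hup : ∀ x ∈ Start cs s, ∀ w ∈ ancs s.dict,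
      (fun w => if w ∈ [s.next] then (1 : Fin 2) else x w) w = 0 := by
    intro x hx w hw
    have := (hd.anc w hw).2
    dsimp only
    rw [if_neg (by simp; omega)]
    exact hx.2.2 w hw
  have hconf' : ∀ x ∈ Start cs s, Conf (s.dict ++ [e₀])
      fun w => if w ∈ [s.next] then 1 else x w := by
    intro x hx
    have hc := conf_of_zero (hup x hx)
    refine ⟨fun e he => ?_, ?_⟩
    · rcases List.mem_append.mp he with he | he
      · exact hc.1 e he
      · obtain rfl := List.mem_singleton.mp he
        exact ⟨fun _ m hm => by simp [he₀] at hm, by simp [he₀]⟩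
    · rw [List.pairwise_append]
      refine ⟨hc.2, by simp, fun e he e' he' => Or.inl ?_⟩
      exact hup x hx _ (mem_ancs.mpr ⟨e, he, by simp [Entry.ancs]⟩)
  refine StmtSpec.of_set_ancillas hA hok hcs hcs' hn hd (W := [s.next]) (by dsimp only; omega)
    (elementary_multiCtl (by omega) hc1 hcs.1) (op_multiCtl _ _ _) rfl hD ?_ ?_ ?_ hconfx ?_ ?_
    hconf' ?_
  · intro w hw
    rw [hancs] at hw
    rcases List.mem_append.mp hw with hw | hw
    · exact Or.inl hw
    · rw [List.mem_singleton] at hw; exact Or.inr hw.ge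
  · intro x hx hh
    rw [hpre x hx, if_neg hh]
  · intro x hx
    rw [spec_append, run_append]
    refine run_id_of_forall (V := SameAnc n x) ?_
      (run_sameAnc (spec_tgt hclone hrec hd.entry) x)
    intro y hy
    rw [spec_cons, spec_nil, List.append_nil]
    refine hE.run_spec_inactive hclone hrec ?_ (by simp [he₀])
    rw [hy _ hn]; exact hx _ le_rfl
  · intro w hw
    rw [List.mem_singleton] at hw
    exact ⟨Or.inr hw.ge, by dsimp only; omega⟩
  · intro x hx
    rw [hstart x hx, hpre x hx.1, if_pos hx.2.1]
  · intro x hx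
    -- With only the new anchor set, the ideal circuit of the dictionary reduces to the call itself.
    rw [run_spec_of_active hclone hrec hD.entry (hconf' x hx) (e := e₀) (by simp)
      (by simp [he₀]), hE.run_spec_first hclone hrec (by simp [he₀]) (by simp [he₀])]

end

end PLP

/-! ### Calls merged into an existing entry. -/

namespace PLP

section

variable {P : Program}

/-- A further call is merged in an entry. -/
def Entry.addCall (e : Entry P.arity) (m : ℕ × List ℕ) : Entry P.arity :=
  { e with merged := e.merged ++ [m] }

/-- While the new bit is `0`, the additional negative control of the first call is satisfied and the
additional call is skipped; earlier pending calls keep their meaning. -/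
theorem run_spec_addCall {n next next' : ℕ} (hclone : P.NoCloning) (hrec : P.RecHalving)
    {e : Entry P.arity} {m : ℕ × List ℕ} (he : EntryOk P n next e)
    (he' : EntryOk P n next' (e.addCall m)) {x : Bits} (hx : x m.1 = 0) :
    run (e.addCall m).spec (ket x) = run e.spec (ket x) := by
  have hm : m ∈ (e.addCall m).merged := by simp [Entry.addCall]
  have ht := he'.mergedGates_tgt hclone hrec hm
  have hn := he'.le_merged m hm
  have hsplit : run (e.addCall m).spec (ket x) =
      run ((e.mergedGates m.2).map (Gate.addCtls [(m.1, 1)])) (run e.spec (ket x)) := by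
    rw [Entry.spec, run_append, he'.run_first hclone hrec, Entry.spec, run_append,
      he.run_first hclone hrec]
    have hc : (x (e.addCall m).anchor = 1 ∧ ∀ m' ∈ (e.addCall m).merged, x m'.1 = 0) ↔
        (x e.anchor = 1 ∧ ∀ m' ∈ e.merged, x m'.1 = 0) := by
      constructor
      · rintro ⟨h1, h2⟩
        exact ⟨h1, fun m' h => h2 m' (by simp [Entry.addCall, h])⟩
      · rintro ⟨h1, h2⟩
        refine ⟨h1, fun m' h => ?_⟩
        simp only [Entry.addCall, List.mem_append, List.mem_singleton] at h
        rcases h with h | rfl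
        exacts [h2 m' h, hx]
    simp only [hc]
    rw [← run_append]
    simp only [Entry.addCall, List.flatMap_append, List.flatMap_cons, List.flatMap_nil,
      List.append_nil]
    rfl
  rw [hsplit]
  refine run_id_of_forall (V := SameAnc n x) ?_ (run_sameAnc (he.spec_tgt hclone hrec) x)
  intro y hy
  rw [run_addCtls, if_neg]
  · simp [hy _ hn, hx]
  · intro g hg c hc
    obtain rfl := List.mem_singleton.mp hc
    exact ((ht g hg).trans_le hn).ne

theorem Entry.ancs_addCall {e : Entry P.arity} {m : ℕ × List ℕ} :
    (e.addCall m).ancs = e.ancs ++ [m.1] := by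
  simp [Entry.addCall, Entry.ancs]

theorem ancs_cons {N : ℕ} {ar : Fin N → ℕ} (e : Entry ar) (D : List (Entry ar)) :
    ancs (e :: D) = e.ancs ++ ancs D := rfl

/-- A call whose key is present. -/
theorem stmtSpec_merge {n : ℕ} (hclone : P.NoCloning) (hrec : P.RecHalving) {A : Set ℕ}
    (hA : A ⊆ Set.Iio n) {D₁ D₂ : List (Entry P.arity)} {e : Entry P.arity}
    {args : Fin (P.arity e.proc) → List ℕ}
    (hargs : Good n args) (hok : (P.unroll e.proc args).Ok A)
    (hsz : sizes args = sizes e.args)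
    {cs : List (ℕ × Fin 2)} {s : CState P.arity} (hcs : CtlOk A s.next cs)
    (hcs' : ∀ c ∈ cs, c.1 ∉ ancs s.dict) (hn : n ≤ s.next) (hd : DictOk P n s)
    (hsplit : s.dict = D₁ ++ e :: D₂) {r₁ r₂ : List Gate × ℕ}
    (hr₁ : r₁ = multiCtl .not e.anchor cs (s.next + 1)) (hr₂ : r₂ = multiCtl .not s.next cs r₁.2) :
    StmtSpec P n (P.unroll e.proc args) cs s ⟨r₁.1 ++ r₂.1, (r₁.1 ++ r₂.1).reverse,
      ⟨r₂.2, D₁ ++ e.addCall (s.next, allWires args) :: D₂⟩⟩ := by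
  have hle₁ : s.next + 1 ≤ r₁.2 := by rw [hr₁]; exact multiCtl_le _ _ _ _
  have hle₂ : r₁.2 ≤ r₂.2 := by rw [hr₂]; exact multiCtl_le _ _ _ _
  set m : ℕ × List ℕ := (s.next, allWires args) with hm
  set e' := e.addCall m with he'
  have hemem : e ∈ s.dict := by simp [hsplit]
  have hE := hd.entry e hemem
  have haanc : e.anchor ∈ ancs s.dict := mem_ancs.mpr ⟨e, hemem, by simp [Entry.ancs]⟩
  have haln := hd.anc _ haanc
  have hc1 : ∀ d ∈ cs, d.1 < s.next + 1 ∧ d.1 ≠ e.anchor := fun d hd' =>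
    ⟨by have := (hcs.2 d hd').1; omega, fun h => hcs' d hd' (by rw [h]; exact haanc)⟩
  have hc2 : ∀ d ∈ cs, d.1 < r₁.2 ∧ d.1 ≠ s.next := fun d hd' =>
    ⟨by have := (hcs.2 d hd').1; omega, (hcs.2 d hd').1.ne⟩
  have hE' : EntryOk P n r₂.2 e' := by
    refine ⟨hE.good, hE.ne, hE.ok, ?_, ?_⟩
    · intro m' hm'
      simp only [he', Entry.addCall, List.mem_append, List.mem_singleton] at hm'
      rcases hm' with hm' | rfl
      · exact hE.merged m' hm'
      · exact ⟨args, hargs, hsz, rfl⟩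
    · intro w hw
      rw [he', Entry.ancs_addCall, List.mem_append, List.mem_singleton] at hw
      rcases hw with hw | rfl
      · have := hE.anc w hw; omega
      · dsimp only [m]; omega
  have hperm : (ancs (D₁ ++ e' :: D₂)).Perm (ancs s.dict ++ [s.next]) := by
    rw [hsplit, ancs_append, ancs_append, ancs_cons, ancs_cons, he', Entry.ancs_addCall]
    simp only [List.append_assoc]
    refine List.Perm.append_left _ (List.Perm.append_left _ ?_)
    exact List.perm_append_comm
  have hancs : ∀ w ∈ ancs (D₁ ++ e' :: D₂), w ∈ ancs s.dict ∨ s.next ≤ w := by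
    intro w hw
    rcases List.mem_append.mp (hperm.mem_iff.mp hw) with h | h
    · exact Or.inl h
    · rw [List.mem_singleton] at h; exact Or.inr h.ge
  have hD : DictOk P n ⟨r₂.2, D₁ ++ e' :: D₂⟩ := by
    refine ⟨fun d hd' => ?_, ?_, ?_⟩
    · have : d ∈ s.dict ∨ d = e' := by
        simp only [List.mem_append, List.mem_cons] at hd'
        rw [hsplit]
        simp only [List.mem_append, List.mem_cons]
        tauto
      rcases this with h | rfl
      · exact (hd.entry d h).mono (by dsimp only; omega)
      · exact hE'
    · have : (D₁ ++ e' :: D₂).map Entry.key = s.dict.map Entry.key := by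
        rw [hsplit]; simp [he', Entry.addCall, Entry.key]
      rw [this]; exact hd.keys
    · rw [hperm.nodup_iff, List.nodup_append]
      refine ⟨hd.nodup, by simp, ?_⟩
      intro w hw w' hw' e
      rw [List.mem_singleton] at hw'
      have := (hd.anc w hw).2
      omega
  have hnd := hd.nodup
  rw [hsplit, ancs_append, ancs_cons] at hnd
  have hothers : ∀ d, d ∈ D₁ ∨ d ∈ D₂ → ∀ w ∈ d.ancs, w ≠ e.anchor ∧ w ≠ s.next := by
    intro d hdm w hw
    have hdd : d ∈ s.dict := by rw [hsplit]; rcases hdm with h | h <;> simp [h]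
    refine ⟨fun h => ?_, (hd.anc w (mem_ancs.mpr ⟨d, hdd, hw⟩)).2.ne⟩
    have hae : e.anchor ∈ e.ancs := by simp [Entry.ancs]
    rcases hdm with hdm | hdm
    · exact (List.nodup_append.mp hnd).2.2 w (mem_ancs.mpr ⟨d, hdm, hw⟩) e.anchor
        (by simp [hae]) h
    · exact (List.nodup_append.mp (List.nodup_append.mp hnd).2.1).2.2 e.anchor hae w
        (mem_ancs.mpr ⟨d, hdm, hw⟩) h.symm
  have hmerged : ∀ m' ∈ e.merged, m'.1 ≠ e.anchor ∧ m'.1 ≠ s.next := by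
    intro m' hm'
    have h1 : m'.1 ∈ e.ancs := by
      simp only [Entry.ancs, List.mem_cons, List.mem_map]; exact Or.inr ⟨m', hm', rfl⟩
    refine ⟨fun h => ?_, ((hE.anc _ h1).2).ne⟩
    have := (List.nodup_append.mp (List.nodup_append.mp hnd).2.1).1
    rw [Entry.ancs, List.nodup_cons] at this
    exact this.1 (h ▸ List.mem_map_of_mem hm')
  have hanchors : ∀ x : Bits, (D₁ ++ e' :: D₂).Pairwise (fun d d' => x d.anchor = 0 ∨ x d'.anchor = 0)
      ↔ s.dict.Pairwise (fun d d' => x d.anchor = 0 ∨ x d'.anchor = 0) := by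
    intro x
    rw [← List.pairwise_map (f := fun d : Entry P.arity => d.anchor)
      (R := fun a b => x a = 0 ∨ x b = 0), ← List.pairwise_map (f := fun d : Entry P.arity => d.anchor)
      (R := fun a b => x a = 0 ∨ x b = 0), hsplit]
    simp [he', Entry.addCall]
  have hpre : ∀ x, Fresh s.next x → run (r₁.1 ++ r₂.1) (ket x) =
      ket (if Holds cs x then Function.update (Function.update x e.anchor (x e.anchor + 1)) s.next
        (x s.next + 1) else x) := by
    intro x hx
    have hx1 : Fresh (s.next + 1) x := hx.mono (by omega)
    rw [run_append, hr₁, run_multiCtl_not (by omega) hc1 hx1, hr₂]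
    split_ifs with hh
    · rw [run_multiCtl_not (by omega) hc2 (fun w hw => by
        rw [Function.update_of_ne (by omega)]; exact hx w (by omega)), if_pos,
        Function.update_of_ne (by omega)]
      exact (holds_congr fun c hc => Function.update_of_ne (hc1 c hc).2 _ _).mpr hh
    · rw [run_multiCtl_not (by omega) hc2 (hx.mono (by omega)), if_neg hh]
  have hy0 : ∀ x ∈ Start cs s, ∀ w ∈ ancs s.dict, w ≠ e.anchor → w ≠ s.next →
      (if w ∈ [e.anchor, s.next] then (1 : Fin 2) else x w) = 0 := by
    intro x hx w hw h1 h2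
    rw [if_neg (by simp [h1, h2])]
    exact hx.2.2 w hw
  have hzero : ∀ x ∈ Start cs s, ∀ d, d ∈ D₁ ∨ d ∈ D₂ → ∀ w ∈ d.ancs,
      (if w ∈ [e.anchor, s.next] then (1 : Fin 2) else x w) = 0 := by
    intro x hx d hdm w hw
    have hdd : d ∈ s.dict := by rw [hsplit]; rcases hdm with h | h <;> simp [h]
    exact hy0 x hx w (mem_ancs.mpr ⟨d, hdd, hw⟩) (hothers d hdm w hw).1 (hothers d hdm w hw).2
  have hzerom : ∀ x ∈ Start cs s, ∀ m' ∈ e.merged,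
      (if m'.1 ∈ [e.anchor, s.next] then (1 : Fin 2) else x m'.1) = 0 := by
    intro x hx m' hm'
    refine hy0 x hx _ (mem_ancs.mpr ⟨e, hemem, ?_⟩) (hmerged m' hm').1 (hmerged m' hm').2
    simp only [Entry.ancs, List.mem_cons, List.mem_map]; exact Or.inr ⟨m', hm', rfl⟩
  have hconf' : ∀ x ∈ Start cs s, Conf (D₁ ++ e' :: D₂)
      fun w => if w ∈ [e.anchor, s.next] then 1 else x w := by
    intro x hx
    have hz := hzero x hx
    refine ⟨fun d hd' => ?_, ?_⟩
    · have hdm : (d ∈ D₁ ∨ d ∈ D₂) ∨ d = e' := by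
        simp only [List.mem_append, List.mem_cons] at hd'; tauto
      rcases hdm with h | rfl
      · have hm0 : ∀ m' ∈ d.merged,
            (if m'.1 ∈ [e.anchor, s.next] then (1 : Fin 2) else x m'.1) = 0 := fun m' hm' =>
          hz d h _ (by simp only [Entry.ancs, List.mem_cons, List.mem_map]; exact Or.inr ⟨m', hm', rfl⟩)
        exact ⟨fun _ => hm0, List.pairwise_of_forall_mem_list fun a ha b _ => Or.inl (hm0 a ha)⟩
      · refine ⟨fun h => ?_, ?_⟩
        · simp [he', Entry.addCall] at h
        · simp only [he', Entry.addCall]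
          rw [List.pairwise_append]
          refine ⟨List.pairwise_of_forall_mem_list fun a ha b _ => Or.inl (hzerom x hx a ha),
            by simp, fun a ha b _ => Or.inl (hzerom x hx a ha)⟩
    · rw [List.pairwise_append, List.pairwise_cons]
      have ha : ∀ d, d ∈ D₁ ∨ d ∈ D₂ →
          (if d.anchor ∈ [e.anchor, s.next] then (1 : Fin 2) else x d.anchor) = 0 :=
        fun d h => hz d h _ (by simp [Entry.ancs])
      exact ⟨List.pairwise_of_forall_mem_list fun a h b _ => Or.inl (ha a (Or.inl h)),
        ⟨fun b h => Or.inr (ha b (Or.inr h)),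
          List.pairwise_of_forall_mem_list fun a h b _ => Or.inl (ha a (Or.inr h))⟩,
        fun a h b _ => Or.inl (ha a (Or.inl h))⟩
  -- A merged call sets two bits: the anchor, since the shared body has to run, and its own bit,
  -- which moves its qubits and distinguishes it from the first call of the entry.
  refine StmtSpec.of_set_ancillas hA hok hcs hcs' hn hd (W := [e.anchor, s.next])
    (by dsimp only; omega) ?_ ?_ rfl hD hancs ?_ ?_ ?_ ?_ ?_ hconf' ?_
  · intro g hg
    rcases List.mem_append.mp hg with hg | hg
    · rw [hr₁] at hg
      have := elementary_multiCtl (by omega) hc1 hcs.1 g hg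
      rw [← hr₁] at this
      exact this.mono hle₂
    · rw [hr₂] at hg
      have := elementary_multiCtl (by omega) hc2 hcs.1 g hg
      rwa [← hr₂] at this
  · intro g hg
    rcases List.mem_append.mp hg with hg | hg
    · rw [hr₁] at hg; exact op_multiCtl _ _ _ g hg
    · rw [hr₂] at hg; exact op_multiCtl _ _ _ g hg
  · intro x hx hh
    rw [hpre x hx, if_neg hh]
  · intro x hx
    dsimp only
    rw [hsplit, spec_append, spec_append, run_append, run_append, spec_cons, spec_cons]
    refine lin_agree (V := SameAnc n x) ?_ (run_sameAnc (spec_tgt hclone hrec (next := s.next)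
      fun d hd' => hd.entry d (by simp [hsplit, hd'])) x)
    intro y hy
    rw [run_append, run_append, run_spec_addCall hclone hrec hE hE']
    rw [hy _ hn]; exact hx _ le_rfl
  · intro x hx hc
    refine ⟨fun d hd' => ?_, (hanchors x).mpr hc.2⟩
    have hdm : d ∈ s.dict ∨ d = e' := by
      rw [hsplit]
      simp only [List.mem_append, List.mem_cons] at hd' ⊢; tauto
    rcases hdm with h | rfl
    · exact hc.1 d h
    · have := hc.1 e hemem
      have hm0 : x m.1 = 0 := hx _ le_rfl
      refine ⟨fun h m' hm' => ?_, ?_⟩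
      · simp only [he', Entry.addCall, List.mem_append, List.mem_singleton] at hm'
        rcases hm' with hm' | rfl
        exacts [this.1 h m' hm', hm0]
      · simp only [he', Entry.addCall]
        rw [List.pairwise_append]
        refine ⟨this.2, by simp, fun a _ b hb => Or.inr ?_⟩
        obtain rfl := List.mem_singleton.mp hb
        exact hm0
  · intro w hw
    simp only [List.mem_cons, List.not_mem_nil, or_false] at hw
    rcases hw with rfl | rfl
    · exact ⟨Or.inl haanc, by dsimp only; omega⟩
    · exact ⟨Or.inr le_rfl, by dsimp only; omega⟩
  · intro x hx
    rw [hpre x hx.1, if_pos hx.2.1]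
    congr 1
    funext w
    simp only [Function.update_apply, List.mem_cons, List.not_mem_nil, or_false]
    rw [fin_two_add_one_of_zero (hx.1 _ le_rfl), fin_two_add_one_of_zero (hx.2.2 _ haanc)]
    by_cases h1 : w = s.next <;> by_cases h2 : w = e.anchor <;> simp [h1, h2]
  · intro x hx
    rw [run_spec_of_active hclone hrec hD.entry (hconf' x hx) (e := e') (by simp)
      (by simp [he', Entry.addCall]),
      hE'.run_spec_merged hclone hrec (l₁ := e.merged) (l₂ := []) (m := m) rfl (hzerom x hx)
        (by simp [hm]) (by simp)]
    have : e'.mergedGates m.2 = (P.unroll e.proc args).gates :=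
      hE.mergedGates_eq hclone hrec hsz
    rw [this]

theorem stmtSpec_anchorMerge {n : ℕ} (hclone : P.NoCloning) (hrec : P.RecHalving) {A : Set ℕ}
    (hA : A ⊆ Set.Iio n) {p : Fin P.nprocs} {args : Fin (P.arity p) → List ℕ}
    (hargs : Good n args) (hne : ∀ j, args j ≠ []) (hok : (P.unroll p args).Ok A)
    {cs : List (ℕ × Fin 2)} {s : CState P.arity} (hcs : CtlOk A s.next cs)
    (hcs' : ∀ c ∈ cs, c.1 ∉ ancs s.dict) (hn : n ≤ s.next) (hd : DictOk P n s) :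
    StmtSpec P n (P.unroll p args) cs s (anchorMerge p args cs s) := by
  unfold anchorMerge
  split
  · rename_i h
    refine stmtSpec_anchor hclone hrec hA hargs hne hok hcs hcs' hn hd fun e he hk => ?_
    have := List.find?_eq_none.mp h e he
    exact this ((Entry.serves_iff _ _ _).mpr hk)
  · rename_i e h
    have hserves := List.find?_some h
    have hemem := List.mem_of_find?_eq_some h
    have hkey := (Entry.serves_iff _ _ _).mp hserves
    obtain ⟨D₁, D₂, hsplit⟩ := List.append_of_mem hemem
    obtain ⟨rfl, hsz⟩ := Prod.mk.injEq _ _ _ _ ▸ hkey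
    -- The update is written for all entries serving the call; as keys are distinct, it changes
    -- exactly the entry that was found.
    have hmap : (s.dict.map fun e' => if e'.serves e.proc (sizes args) then
        { e' with merged := e'.merged ++ [(s.next, allWires args)] } else e') =
        D₁ ++ e.addCall (s.next, allWires args) :: D₂ := by
      have hk := hd.keys
      rw [hsplit, List.map_append, List.map_cons] at hk
      have hno : ∀ d, d ∈ D₁ ∨ d ∈ D₂ → ¬ d.serves e.proc (sizes args) = true := by
        intro d hdm hs
        have hdk := (Entry.serves_iff _ _ _).mp hs
        rw [← hkey] at hdk
        rcases hdm with hdm | hdm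
        · exact (List.nodup_append.mp hk).2.2 _ (List.mem_map_of_mem hdm) _ (by simp) hdk
        · exact (List.nodup_cons.mp (List.nodup_append.mp hk).2.1).1
            (hdk ▸ List.mem_map_of_mem hdm)
      have hid : ∀ D : List (Entry P.arity), (∀ d ∈ D, d ∈ D₁ ∨ d ∈ D₂) →
          (D.map fun e' => if e'.serves e.proc (sizes args) then
            { e' with merged := e'.merged ++ [(s.next, allWires args)] } else e') = D := by
        intro D hD
        refine (List.map_congr_left fun d hd' => ?_).trans (List.map_id D)
        rw [if_neg (hno d (hD d hd'))]; rfl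
      rw [hsplit, List.map_append, List.map_cons, if_pos hserves, hid D₁ fun d => Or.inl,
        hid D₂ fun d => Or.inr]
      rfl
    rw [hmap]
    exact stmtSpec_merge hclone hrec hA hargs hok hsz.symm hcs hcs' hn hd hsplit rfl rfl

end

end PLP

/-! ### Composition of statement specifications. -/

namespace PLP

section

variable {P : Program}

theorem holds_snoc {cs : List (ℕ × Fin 2)} {w : ℕ} {b : Fin 2} {x : Bits} :
    Holds (cs ++ [(w, b)]) x ↔ Holds cs x ∧ x w = b := by simp

/-- The specification of a sequence whose first statement has width `0`. -/
theorem StmtSpec.seq_left {n : ℕ} {A : Set ℕ} (hA : A ⊆ Set.Iio n) {t₀ t₁ : Tree} (hok : t₀.Ok A)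
    {cs : List (ℕ × Fin 2)} {s : CState P.arity} (hcs : CtlOk A s.next cs) (hn : n ≤ s.next)
    (hd : DictOk P n s) {r₀ r₁ : Output P.arity} (hdict : r₀.state.dict = s.dict)
    (h₀ : CallSpec t₀ cs s.next (r₀.pre, r₀.state.next)) (h₁ : StmtSpec P n t₁ cs r₀.state r₁) :
    StmtSpec P n (.seq t₀ t₁) cs s ⟨r₀.pre ++ r₁.pre, r₁.post, r₁.state⟩ where
  le := h₀.le.trans h₁.le
  elem_pre g hg := by
    rcases List.mem_append.mp hg with hg | hg
    exacts [(h₀.elem g hg).mono h₁.le, h₁.elem_pre g hg]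
  elem_post := h₁.elem_post
  dict := h₁.dict
  anc_mem w hw := by
    rcases h₁.anc_mem w hw with h | h
    · exact Or.inl (hdict ▸ h)
    · exact Or.inr (h₀.le.trans h)
  off_pre x hx hh := by
    simp only [run_append]
    rw [h₀.off x hx hh, h₁.off_pre x (hx.mono h₀.le) hh]
  off_post x hx hh := h₁.off_post x (hx.mono h₀.le) hh
  spec_eq x hx := by rw [h₁.spec_eq x (hx.mono h₀.le), hdict]
  conf x hx hc := h₁.conf x (hx.mono h₀.le) (by rw [hdict]; exact hc)
  on x hx := by
    simp only [run_append, Tree.gates]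
    rw [h₀.on x hx.1 hx.2.1]
    refine lin_agree (L := run r₁.post ∘ₗ run (spec r₁.state.dict) ∘ₗ run r₁.pre) ?_
      (run_tree_stable hok hA hn hcs hx.1 hx.2.1)
    rintro y ⟨hy, hy', hy''⟩
    refine h₁.on y ⟨hy.mono h₀.le, hy', fun w hw => ?_⟩
    rw [hdict] at hw
    rw [hy'' w (hd.anc w hw).1, hx.2.2 w hw]
  mid x hx := by
    simp only [run_append]
    rw [h₀.on x hx.1 hx.2.1]
    refine lin_maps ?_ (run_tree_stable hok hA hn hcs hx.1 hx.2.1)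
    rintro y ⟨hy, hy', hy''⟩
    refine On_mono ?_ (h₁.mid y ⟨hy.mono h₀.le, hy', fun w hw => ?_⟩)
    · rintro z ⟨z1, z2, z3, z4, z5⟩
      refine ⟨z1, z2, z3, fun w h1 h2 h3 => ?_, z5⟩
      rw [z4 w h1 (h2.trans_le h₀.le) (by rw [hdict]; exact h3), hy'' w h1]
    · rw [hdict] at hw
      rw [hy'' w (hd.anc w hw).1, hx.2.2 w hw]

/-- The specification of a sequence whose second statement has width `0`. -/
theorem StmtSpec.seq_right {n : ℕ} {A : Set ℕ} (hA : A ⊆ Set.Iio n) {t₀ t₁ : Tree} (hok : t₀.Ok A)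
    {cs : List (ℕ × Fin 2)} {s : CState P.arity} (hcs : CtlOk A s.next cs) (hn : n ≤ s.next)
    {r₀ r₁ : Output P.arity} (hdict : r₁.state.dict = r₀.state.dict)
    (h₀ : StmtSpec P n t₀ cs s r₀) (h₁ : CallSpec t₁ cs r₀.state.next (r₁.pre, r₁.state.next)) :
    StmtSpec P n (.seq t₀ t₁) cs s ⟨r₀.pre, r₀.post ++ r₁.pre, r₁.state⟩ where
  le := h₀.le.trans h₁.le
  elem_pre g hg := (h₀.elem_pre g hg).mono h₁.le
  elem_post g hg := by
    rcases List.mem_append.mp hg with hg | hg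
    exacts [(h₀.elem_post g hg).mono h₁.le, h₁.elem g hg]
  dict := h₀.dict.mono hdict h₁.le
  anc_mem w hw := h₀.anc_mem w (hdict ▸ hw)
  off_pre := h₀.off_pre
  off_post x hx hh := by
    simp only [run_append]
    rw [h₀.off_post x hx hh, h₁.off x (hx.mono h₀.le) hh]
  spec_eq x hx := by rw [hdict, h₀.spec_eq x hx]
  conf x hx hc := by rw [hdict]; exact h₀.conf x hx hc
  on x hx := by
    simp only [run_append, Tree.gates]
    rw [hdict, h₀.on x hx]
    refine lin_agree ?_ (run_tree_stable hok hA hn hcs hx.1 hx.2.1)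
    rintro y ⟨hy, hy', -⟩
    exact h₁.on y (hy.mono h₀.le) hy'
  mid x hx := by
    refine On_mono ?_ (h₀.mid x hx)
    rintro z ⟨z1, z2, z3, z4, z5⟩
    exact ⟨z1.mono h₁.le, z2, by rw [hdict]; exact z3, z4, by rw [hdict]; exact z5⟩

/-- The specification of a `qcase`. -/
theorem StmtSpec.qcase {n : ℕ} (hclone : P.NoCloning) (hrec : P.RecHalving) {A : Set ℕ}
    (hA : A ⊆ Set.Iio n) {t₀ t₁ : Tree} {q : ℕ}
    (hok : (Tree.qcase q t₀ t₁).Ok A) {cs : List (ℕ × Fin 2)} {s : CState P.arity}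
    (hcs : CtlOk A s.next cs) (hn : n ≤ s.next) {r₀ r₁ : Output P.arity}
    (h₀ : StmtSpec P n t₀ (cs ++ [(q, 0)]) s r₀)
    (h₁ : StmtSpec P n t₁ (cs ++ [(q, 1)]) r₀.state r₁) :
    StmtSpec P n (.qcase q t₀ t₁) cs s ⟨r₀.pre ++ r₁.pre, r₁.post ++ r₀.post, r₁.state⟩ := by
  have hqn : q < n := hA hok.1
  have hA' : A \ {q} ⊆ Set.Iio n := Set.sdiff_subset.trans hA
  have hcs0 := hcs.snoc hok.1 (hqn.trans_le hn) 0
  have hcs1 := hcs.snoc hok.1 (hqn.trans_le hn) 1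
  have hno1 : ∀ y : Bits, y q = 0 → ¬ Holds (cs ++ [(q, 1)]) y := fun y hy h => by
    have := (holds_snoc.mp h).2
    rw [hy] at this; exact absurd this (by decide)
  have hno0 : ∀ y : Bits, y q = 1 → ¬ Holds (cs ++ [(q, 0)]) y := fun y hy h => by
    have := (holds_snoc.mp h).2
    rw [hy] at this; exact absurd this (by decide)
  have hspecx : ∀ y, run (spec r₀.state.dict) (ket y) ∈ On (SameAnc n y) := fun y =>
    run_sameAnc (spec_tgt hclone hrec h₀.dict.entry) y
  -- The second branch is compiled with the dictionary left by the first one; the ancillas created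
  -- there are fresh in `x`, so nothing is pending.
  have hstart : ∀ x ∈ Start cs s, x q = 1 → x ∈ Start (cs ++ [(q, 1)]) r₀.state := by
    intro x hx hq
    refine ⟨hx.1.mono h₀.le, holds_snoc.mpr ⟨hx.2.1, hq⟩, fun w hw => ?_⟩
    rcases h₀.anc_mem w hw with h | h
    exacts [hx.2.2 w h, hx.1 w h]
  have hmid : ∀ x, ∀ y ∈ Middle n (cs ++ [(q, 0)]) s r₀.state x, run r₁.pre (ket y) = ket y ∧
      run (spec r₁.state.dict) (ket y) = run (spec r₀.state.dict) (ket y) := by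
    rintro x y ⟨y1, y2, y3, y4, y5⟩
    exact ⟨h₁.off_pre y y1 (hno1 y (holds_snoc.mp y2).2), h₁.spec_eq y y1⟩
  refine ⟨h₀.le.trans h₁.le, ?_, ?_, h₁.dict, ?_, ?_, ?_, ?_, ?_, ?_, ?_⟩
  · intro g hg
    rcases List.mem_append.mp hg with hg | hg
    exacts [(h₀.elem_pre g hg).mono h₁.le, h₁.elem_pre g hg]
  · intro g hg
    rcases List.mem_append.mp hg with hg | hg
    exacts [h₁.elem_post g hg, (h₀.elem_post g hg).mono h₁.le]
  · intro w hw
    rcases h₁.anc_mem w hw with h | h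
    · exact h₀.anc_mem w h
    · exact Or.inr (h₀.le.trans h)
  · intro x hx hh
    simp only [run_append]
    rw [h₀.off_pre x hx fun h => hh (holds_snoc.mp h).1,
      h₁.off_pre x (hx.mono h₀.le) fun h => hh (holds_snoc.mp h).1]
  · intro x hx hh
    simp only [run_append]
    rw [h₁.off_post x (hx.mono h₀.le) fun h => hh (holds_snoc.mp h).1,
      h₀.off_post x hx fun h => hh (holds_snoc.mp h).1]
  · intro x hx
    rw [h₁.spec_eq x (hx.mono h₀.le), h₀.spec_eq x hx]
  · intro x hx hc
    exact h₁.conf x (hx.mono h₀.le) (h₀.conf x hx hc)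
  · intro x hx
    rw [run_qcase hok]
    simp only [run_append]
    by_cases hq : x q = 0
    · have hx0 : x ∈ Start (cs ++ [(q, 0)]) s := ⟨hx.1, holds_snoc.mpr ⟨hx.2.1, hq⟩, hx.2.2⟩
      rw [if_pos hq, ← h₀.on x hx0]
      congr 1
      -- For `q = 0` the second branch has to vanish: its `pre` and `post` are switched off, and its
      -- additions to the dictionary do not change the ideal circuit.
      refine lin_agree (L := run r₁.post ∘ₗ run (spec r₁.state.dict) ∘ₗ run r₁.pre) ?_
        (h₀.mid x hx0)
      intro y hy
      obtain ⟨e1, e2⟩ := hmid x y hy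
      obtain ⟨y1, y2, y3, y4, y5⟩ := hy
      simp only [LinearMap.comp_apply]
      rw [e1, e2]
      -- Discarding `r₁.post` after the pending calls needs both facts about them: they preserve the
      -- ancillas, and, by the last clause of `Middle`, also the controls, among them `q`.
      have hboth : run (spec r₀.state.dict) (ket y) ∈ On (SameAnc n y ∩
          {z | ∀ c ∈ cs ++ [(q, (0 : Fin 2))], z c.1 = y c.1}) := by
        exact (Finsupp.mem_supported _ _).mpr (Set.subset_inter
          ((Finsupp.mem_supported _ _).mp (hspecx y)) ((Finsupp.mem_supported _ _).mp y5))
      refine run_id_of_forall ?_ hboth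
      rintro z ⟨z1, z2⟩
      refine h₁.off_post z (fun w hw => ?_) (hno1 z ?_)
      · rw [z1 w (hn.trans (h₀.le.trans hw))]; exact y1 w hw
      · rw [z2 (q, 0) (by simp)]; exact (holds_snoc.mp y2).2
    · have hq1 := fin_two_ne_zero_iff.mp hq
      have hx1 := hstart x hx hq1
      rw [if_neg hq, h₀.off_pre x hx.1 (hno0 x hq1), h₁.on x hx1]
      refine run_id_of_forall ?_ (run_tree_stable hok.2.2 hA' hn hcs1 hx.1 hx1.2.1)
      rintro y ⟨y1, y2, y3⟩
      exact h₀.off_post y y1 (hno0 y (holds_snoc.mp y2).2)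
  · intro x hx
    simp only [run_append]
    by_cases hq : x q = 0
    · have hx0 : x ∈ Start (cs ++ [(q, 0)]) s := ⟨hx.1, holds_snoc.mpr ⟨hx.2.1, hq⟩, hx.2.2⟩
      refine lin_maps ?_ (h₀.mid x hx0)
      intro y hy
      obtain ⟨e1, e2⟩ := hmid x y hy
      obtain ⟨y1, y2, y3, y4, y5⟩ := hy
      rw [e1]
      refine ket_mem_On ⟨y1.mono h₁.le, (holds_snoc.mp y2).1, h₁.conf y y1 y3, y4, ?_⟩
      rw [e2]
      refine On_mono ?_ y5
      intro z hz c hc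
      exact hz c (by simp [hc])
    · have hq1 := fin_two_ne_zero_iff.mp hq
      have hx1 := hstart x hx hq1
      rw [h₀.off_pre x hx.1 (hno0 x hq1)]
      refine On_mono ?_ (h₁.mid x hx1)
      rintro z ⟨z1, z2, z3, z4, z5⟩
      refine ⟨z1, (holds_snoc.mp z2).1, z3, fun w h1 h2 h3 => z4 w h1 (h2.trans_le h₀.le) ?_,
        On_mono ?_ z5⟩
      · intro hw
        rcases h₀.anc_mem w hw with h | h
        exacts [h3 h, absurd h2 (by omega)]
      · intro y hy c hc
        exact hy c (by simp [hc])

/-- Compilation of a statement of width at most `1`. -/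
theorem stmtSpec_compile {n : ℕ} (hclone : P.NoCloning) (hrec : P.RecHalving)
    {cc : (p : Fin P.nprocs) → (Fin (P.arity p) → List ℕ) →
    List (ℕ × Fin 2) → ℕ → List Gate × ℕ} {R : Fin P.nprocs → Prop} [DecidablePred R] {V : Type}
    {f : V → List ℕ} (hf : Good n f) {S : Stmt P.arity V}
    (hcc : ∀ c ∈ S.calls, ¬ R c.1 → CallOk P n cc c.1) (hS : S.NoCloning) (hw : S.width R ≤ 1)
    {A : Set ℕ} (hA : A ⊆ Set.Iio n) (hok : (S.tree P.unroll f).Ok A) {cs : List (ℕ × Fin 2)}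
    {s : CState P.arity} (hcs : CtlOk A s.next cs) (hcs' : ∀ c ∈ cs, c.1 ∉ ancs s.dict)
    (hn : n ≤ s.next) (hd : DictOk P n s) :
    StmtSpec P n (S.tree P.unroll f) cs s (S.compile cc R f cs s) := by
  -- Width `0` is settled beforehand, so the induction only meets statements that have a call to
  -- anchor on some path.
  by_cases h0 : S.width R = 0
  · obtain ⟨h1, h2, h3⟩ := compile_width_zero hf hcc hS h0 hA hok hcs hn
    exact h3.stmtSpec hclone hrec hA hok hcs hn hd h1 h2
  induction S generalizing A cs s with
  | skip => exact absurd rfl h0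
  | app => exact absurd rfl h0
  | seq S₀ S₁ ih₀ ih₁ =>
    have hcc₀ : ∀ c ∈ S₀.calls, ¬ R c.1 → CallOk P n cc c.1 := fun c hc =>
      hcc c (by simp [Stmt.calls, hc])
    have hcc₁ : ∀ c ∈ S₁.calls, ¬ R c.1 → CallOk P n cc c.1 := fun c hc =>
      hcc c (by simp [Stmt.calls, hc])
    simp only [Stmt.width] at hw h0
    simp only [Stmt.tree, Stmt.compile]
    -- Total width at most `1`: one side has width `0` and goes entirely before the pending calls of
    -- the other side, or entirely after them.
    by_cases hw₀ : S₀.width R = 0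
    · obtain ⟨h1, h2, h3⟩ := compile_width_zero hf hcc₀ hS.1 hw₀ hA hok.1 hcs hn
      rw [if_pos hw₀, h1, List.append_nil]
      refine StmtSpec.seq_left hA hok.1 hcs hn hd h2 h3 ?_
      exact ih₁ hcc₁ hS.2 (by omega) hA hok.2 (hcs.mono h3.le le_rfl) (by rw [h2]; exact hcs')
        (hn.trans h3.le) (hd.mono h2 h3.le) (by omega)
    · rw [if_neg hw₀]
      have h := ih₀ hcc₀ hS.1 (by omega) hA hok.1 hcs hcs' hn hd hw₀
      obtain ⟨h1, h2, h3⟩ := compile_width_zero hf hcc₁ hS.2 (by omega) hA hok.2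
        (s := (S₀.compile cc R f cs s).state) (hcs.mono h.le le_rfl) (hn.trans h.le)
      rw [h1, List.append_nil]
      exact StmtSpec.seq_right hA hok.1 hcs hn h2 h h3
  | ite b S₁ S₀ ih₁ ih₀ =>
    have hcc₀ : ∀ c ∈ S₀.calls, ¬ R c.1 → CallOk P n cc c.1 := fun c hc =>
      hcc c (by simp [Stmt.calls, hc])
    have hcc₁ : ∀ c ∈ S₁.calls, ¬ R c.1 → CallOk P n cc c.1 := fun c hc =>
      hcc c (by simp [Stmt.calls, hc])
    simp only [Stmt.width, max_le_iff] at hw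
    simp only [Stmt.tree, Stmt.compile] at hok ⊢
    split_ifs at hok ⊢
    · by_cases h : S₁.width R = 0
      · obtain ⟨h1, h2, h3⟩ := compile_width_zero hf hcc₁ hS.1 h hA hok hcs hn
        exact h3.stmtSpec hclone hrec hA hok hcs hn hd h1 h2
      · exact ih₁ hcc₁ hS.1 hw.1 hA hok hcs hcs' hn hd h
    · by_cases h : S₀.width R = 0
      · obtain ⟨h1, h2, h3⟩ := compile_width_zero hf hcc₀ hS.2 h hA hok hcs hn
        exact h3.stmtSpec hclone hrec hA hok hcs hn hd h1 h2
      · exact ih₀ hcc₀ hS.2 hw.2 hA hok hcs hcs' hn hd h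
  | qcase q S₀ S₁ ih₀ ih₁ =>
    have hcc₀ : ∀ c ∈ S₀.calls, ¬ R c.1 → CallOk P n cc c.1 := fun c hc =>
      hcc c (by simp [Stmt.calls, hc])
    have hcc₁ : ∀ c ∈ S₁.calls, ¬ R c.1 → CallOk P n cc c.1 := fun c hc =>
      hcc c (by simp [Stmt.calls, hc])
    simp only [Stmt.width, max_le_iff] at hw
    simp only [Stmt.tree] at hok ⊢
    by_cases hv : q.Valid f
    · rw [if_pos hv] at hok ⊢
      have hqn : (q.eval f : ℕ) < n := hA hok.1
      have hA' : A \ {(q.eval f : ℕ)} ⊆ Set.Iio n := Set.sdiff_subset.trans hA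
      have hcs0 := hcs.snoc hok.1 (hqn.trans_le hn) 0
      have hcs1 := hcs.snoc hok.1 (hqn.trans_le hn) 1
      have hnq : ∀ b : Fin 2, ∀ c ∈ cs ++ [((q.eval f : ℕ), b)], c.1 ∉ ancs s.dict := by
        intro b c hc h
        rcases List.mem_append.mp hc with hc | hc
        · exact hcs' c hc h
        · obtain rfl := List.mem_singleton.mp hc
          exact absurd (hd.anc _ h).1 (by simpa using hqn)
      have h₀ : StmtSpec P n (S₀.tree P.unroll f) (cs ++ [((q.eval f : ℕ), 0)]) s
          (S₀.compile cc R f (cs ++ [((q.eval f : ℕ), 0)]) s) := by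
        by_cases h : S₀.width R = 0
        · obtain ⟨h1, h2, h3⟩ := compile_width_zero hf hcc₀ hS.1 h hA' hok.2.1 hcs0 hn
          exact h3.stmtSpec hclone hrec hA' hok.2.1 hcs0 hn hd h1 h2
        · exact ih₀ hcc₀ hS.1 hw.1 hA' hok.2.1 hcs0 (hnq 0) hn hd h
      simp only [Stmt.compile]
      refine StmtSpec.qcase hclone hrec hA hok hcs hn h₀ ?_
      have hcs1' := hcs1.mono h₀.le le_rfl
      have hn' := hn.trans h₀.le
      by_cases h : S₁.width R = 0
      · obtain ⟨h1, h2, h3⟩ := compile_width_zero hf hcc₁ hS.2 h hA' hok.2.2 hcs1' hn'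
        exact h3.stmtSpec hclone hrec hA' hok.2.2 hcs1' hn' h₀.dict h1 h2
      · refine ih₁ hcc₁ hS.2 hw.2 hA' hok.2.2 hcs1' (fun c hc hm => ?_) hn' h₀.dict h
        rcases h₀.anc_mem _ hm with h | h
        · exact hnq 1 c hc h
        · exact absurd (hcs1.2 c hc).1 (by omega)
    · rw [if_neg hv] at hok
      exact hok.elim
  | call p args =>
    have hR : R p := by
      by_contra h; simp [Stmt.width, h] at h0
    simp only [Stmt.compile, Stmt.tree, if_pos hR] at hok ⊢
    split_ifs at hok ⊢ with he
    · exact CallSpec.stmtSpec (t := Tree.skip) hclone hrec hA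
        (show Tree.skip.Ok A from trivial) hcs hn hd rfl rfl
        ⟨le_rfl, by simp, fun _ _ _ => rfl, fun _ _ _ => rfl⟩
    · exact stmtSpec_anchorMerge hclone hrec hA (hf.eval hS) (by simpa using he) hok hcs hcs' hn hd

end

end PLP

namespace PLP

/-! ## Correctness of the compilation of entries -/

section

variable {P : Program}

/-- The specification of the compilation of the entries `es`, in a state whose dictionary does not
contain them. -/
structure EntriesSpec (P : Program) (n : ℕ) (es : List (Entry P.arity)) (s : CState P.arity)
    (out : Output P.arity) : Prop where
  le : s.next ≤ out.state.next
  elem_pre : ∀ g ∈ out.pre, g.Elementary out.state.next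
  elem_post : ∀ g ∈ out.post, g.Elementary out.state.next
  dict : DictOk P n out.state
  anc_mem : ∀ w ∈ ancs out.state.dict, w ∈ ancs s.dict ∨ s.next ≤ w
  eq : ∀ x, Fresh s.next x → Conf (es ++ s.dict) x →
    run out.post (run (spec out.state.dict) (run out.pre (ket x))) =
      run (spec (es ++ s.dict)) (ket x)
  mid : ∀ x, Fresh s.next x → Conf (es ++ s.dict) x →
    run out.pre (ket x) ∈ On {y | Fresh out.state.next y ∧ Conf out.state.dict y}

theorem Entry.anchor_mem (e : Entry P.arity) : e.anchor ∈ e.ancs := by simp [Entry.ancs]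

theorem Entry.merged_mem {e : Entry P.arity} {m : ℕ × List ℕ} (hm : m ∈ e.merged) :
    m.1 ∈ e.ancs := by
  simp only [Entry.ancs, List.mem_cons, List.mem_map]
  exact Or.inr ⟨m, hm, rfl⟩

theorem Conf.zero {D : List (Entry P.arity)} {x : Bits} (hc : Conf D x)
    (h0 : ∀ e ∈ D, x e.anchor = 0) : ∀ w ∈ ancs D, x w = 0 := by
  intro w hw
  obtain ⟨e, he, hw⟩ := mem_ancs.mp hw
  simp only [Entry.ancs, List.mem_cons, List.mem_map] at hw
  rcases hw with rfl | ⟨m, hm, rfl⟩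
  exacts [h0 e he, (hc.1 e he).1 (h0 e he) m hm]

theorem Conf.append {D D' : List (Entry P.arity)} {x : Bits} (hc : Conf D x) (hc' : Conf D' x)
    (h : ∀ e ∈ D, x e.anchor = 1 → ∀ w ∈ ancs D', x w = 0) : Conf (D ++ D') x := by
  refine ⟨fun e he => ?_, List.pairwise_append.mpr ⟨hc.2, hc'.2, fun e he e' he' => ?_⟩⟩
  · rcases List.mem_append.mp he with he | he
    exacts [hc.1 e he, hc'.1 e he]
  · by_cases h0 : x e.anchor = 0
    · exact Or.inl h0
    · exact Or.inr (h e he (fin_two_ne_zero_iff.mp h0) _ (mem_ancs.mpr ⟨e', he', e'.anchor_mem⟩))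

theorem Conf.of_append {D D' : List (Entry P.arity)} {x : Bits} (hc : Conf (D ++ D') x) :
    Conf D x ∧ Conf D' x ∧ ∀ e ∈ D, x e.anchor = 1 → ∀ w ∈ ancs D', x w = 0 := by
  have h' := hc.subset (List.sublist_append_right D D')
  refine ⟨hc.subset (List.sublist_append_left _ _), h', fun e he h1 => h'.zero fun e' he' => ?_⟩
  rcases (List.pairwise_append.mp hc.2).2.2 e he e' he' with h | h
  · rw [h1] at h; exact absurd h (by decide)
  · exact h

theorem SameAnc.fresh {n next : ℕ} (hn : n ≤ next) {x y : Bits} (hy : y ∈ SameAnc n x)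
    (hx : Fresh next x) : Fresh next y := fun w hw => by
  rw [hy w (hn.trans hw)]; exact hx w hw

/-- The compilation of an active entry, once the qubits are in place. -/
theorem EntriesSpec.active {n : ℕ} (hclone : P.NoCloning) (hrec : P.RecHalving)
    {t : Tree} {a : ℕ} {es : List (Entry P.arity)} {s : CState P.arity} {r r' : Output P.arity}
    (hE : ∀ e ∈ es, EntryOk P n s.next e) (hdis : ∀ w ∈ ancs es, w ∉ ancs s.dict)
    (h : StmtSpec P n t [(a, 1)] s r) (h' : EntriesSpec P n es r.state r')
    {y : Bits} (hy : Fresh s.next y) (ha : y a = 1) (h0 : ∀ w ∈ ancs s.dict, y w = 0)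
    (h1 : ∀ w ∈ ancs es, y w = 0) :
    run r.post (run r'.post (run (spec r'.state.dict) (run r'.pre (run r.pre (ket y))))) =
      run t.gates (ket y) ∧
    run r'.pre (run r.pre (ket y)) ∈ On {z | Fresh r'.state.next z ∧ Conf r'.state.dict z} := by
  have hst : y ∈ Start [(a, 1)] s := ⟨hy, by simp [ha], h0⟩
  have hmid : ∀ z ∈ Middle n [(a, 1)] s r.state y,
      Fresh r.state.next z ∧ Conf (es ++ r.state.dict) z ∧ Conf es z ∧
        ∀ e ∈ es, z e.anchor = 0 := by
    rintro z ⟨z1, -, z3, z4, -⟩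
    have hz : ∀ w ∈ ancs es, z w = 0 := fun w hw => by
      obtain ⟨e, he, hwe⟩ := mem_ancs.mp hw
      have := (hE e he).anc w hwe
      rw [z4 w this.1 this.2 (hdis w hw), h1 w hw]
    have hz' : ∀ e ∈ es, z e.anchor = 0 := fun e he => hz _ (mem_ancs.mpr ⟨e, he, e.anchor_mem⟩)
    refine ⟨z1, (conf_of_zero hz).append z3 fun e he h => ?_, conf_of_zero hz, hz'⟩
    rw [hz' e he] at h; exact absurd h (by decide)
  constructor
  · rw [← h.on y hst]
    congr 1
    -- While the call of this body is active, the remaining entries are idle, so that only the calls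
    -- announced by the body are pending.
    refine lin_agree (L := run r'.post ∘ₗ run (spec r'.state.dict) ∘ₗ run r'.pre) ?_ (h.mid y hst)
    intro z hz
    obtain ⟨z1, z2, z3, z4⟩ := hmid z hz
    simp only [LinearMap.comp_apply]
    rw [h'.eq z z1 z2, spec_append, run_append, run_spec_of_inactive hclone hrec hE z3 z4]
  · refine lin_maps ?_ (h.mid y hst)
    intro z hz
    obtain ⟨z1, z2, z3, z4⟩ := hmid z hz
    exact h'.mid z z1 z2

/-- Basis states are of three kinds. If the anchor is `0`, permutations and body are inert. If it is
`1` and no merged bit is set, the permutations are inert and the body serves the first call. If one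
merged bit is set, the permutation brings the qubits of that call into place, and `run_conj` turns
the body between the permutation and its inverse into the merged call. In the last two cases all
other entries are idle. -/
theorem EntriesSpec.cons {n : ℕ} (hclone : P.NoCloning) (hrec : P.RecHalving)
    {e : Entry P.arity} {es : List (Entry P.arity)} {s : CState P.arity} {r r' : Output P.arity}
    (hn : n ≤ s.next) (he : EntryOk P n s.next e) (hE : ∀ e ∈ es, EntryOk P n s.next e)
    (hd : DictOk P n s) (hnod : (ancs ((e :: es) ++ s.dict)).Nodup)
    (h : StmtSpec P n (P.unroll e.proc e.args) [(e.anchor, 1)]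
      ⟨(ctlPerms (allWires e.args) e.merged s.next).2, s.dict⟩ r)
    (h' : EntriesSpec P n es r.state r') :
    EntriesSpec P n (e :: es) s
      ⟨(ctlPerms (allWires e.args) e.merged s.next).1 ++ r.pre ++ r'.pre,
        r'.post ++ r.post ++ (ctlPerms (allWires e.args) e.merged s.next).1.reverse,
        r'.state⟩ := by
  have hle := ctlPerms_le (allWires e.args) e.merged s.next
  have hperm : PermsOk s.next (allWires e.args) e.merged := by
    refine ⟨fun w hw => (he.good.lt_allWires w hw).trans_le hn, fun m hm => ?_⟩
    obtain ⟨args, h1, h2, h3⟩ := he.merged m hm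
    refine ⟨(he.anc _ (Entry.merged_mem hm)).2, ?_, ?_⟩
    · rw [h3]; exact fun w hw => (h1.lt_allWires w hw).trans_le hn
    · rw [h3, length_allWires, length_allWires, tot_eq_of_sizes_eq h2]
  have helem := elementary_ctlPerms hperm
  have hop := op_ctlPerms (allWires e.args) e.merged s.next
  set π := ctlPerms (allWires e.args) e.merged s.next with hπ
  have hnot : ∀ g ∈ π.1, g.IsNot := fun g hg => (helem g hg).isNot (hop g hg)
  have hle' : π.2 ≤ r'.state.next := h.le.trans h'.le
  have hdis : ∀ w ∈ ancs es, w ∉ ancs s.dict := by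
    rw [List.cons_append, ancs_cons, ancs_append] at hnod
    have := (List.nodup_append.mp (List.nodup_append.mp hnod).2.1).2.2
    exact fun w hw hw' => this w hw w hw' rfl
  have hall : ∀ e' ∈ (e :: es) ++ s.dict, EntryOk P n s.next e' := by
    intro e' he'
    rcases List.mem_append.mp he' with h | h
    · rcases List.mem_cons.mp h with rfl | h
      exacts [he, hE e' h]
    · exact hd.entry e' h
  have hπ0 : ∀ x, Fresh s.next x → (∀ m ∈ e.merged, x m.1 = 0) → run π.1 (ket x) = ket x := by
    intro x hx h0
    rw [run_not hop, flips_ctlPerms_inactive hperm hx h0]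
  have hπ0' : ∀ x, Fresh s.next x → (∀ m ∈ e.merged, x m.1 = 0) →
      run π.1.reverse (ket x) = ket x := by
    intro x hx h0
    have := run_reverse_run hnot (ket x)
    rwa [hπ0 x hx h0] at this
  have hact : ∀ x, Fresh s.next x → Conf ((e :: es) ++ s.dict) x → x e.anchor = 1 →
      (∀ w ∈ ancs es, x w = 0) ∧ ∀ w ∈ ancs s.dict, x w = 0 := by
    intro x hx hc h1
    have := (Conf.of_append (D := [e]) (D' := es ++ s.dict) hc).2.2 e (by simp) h1
    rw [ancs_append] at this
    exact ⟨fun w hw => this w (by simp [hw]), fun w hw => this w (by simp [hw])⟩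
  -- the states with a merged call
  have hmer : ∀ x, Fresh s.next x → Conf ((e :: es) ++ s.dict) x → x e.anchor = 1 →
      (¬ ∀ m ∈ e.merged, x m.1 = 0) → ∃ y, run π.1 (ket x) = ket y ∧ Fresh π.2 y ∧
        y e.anchor = 1 ∧ (∀ w ∈ ancs es, y w = 0) ∧ (∀ w ∈ ancs s.dict, y w = 0) ∧
        run π.1.reverse (run (P.unroll e.proc e.args).gates (ket y)) = run e.spec (ket x) := by
    intro x hx hc h1 hm
    push Not at hm
    obtain ⟨m, hm, hxm⟩ := hm
    have hxm := fin_two_ne_zero_iff.mp hxm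
    obtain ⟨l₁, l₂, hl⟩ := List.append_of_mem hm
    obtain ⟨args, hg, hsz, hargs⟩ := he.merged m hm
    have hpw := (hc.1 e (by simp)).2
    rw [hl, List.pairwise_append, List.pairwise_cons] at hpw
    have hz1 : ∀ m' ∈ l₁, x m'.1 = 0 := fun m' hm' => by
      rcases hpw.2.2 m' hm' m (by simp) with h | h
      · exact h
      · rw [hxm] at h; exact absurd h (by decide)
    have hz2 : ∀ m' ∈ l₂, x m'.1 = 0 := fun m' hm' => by
      rcases hpw.2.1.1 m' hm' with h | h
      · rw [hxm] at h; exact absurd h (by decide)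
      · exact h
    have hsrc : ∀ w ∈ m.2, w < n := by rw [hargs]; exact hg.lt_allWires
    have hdst := he.good.lt_allWires
    have hbits : ∀ m' ∈ e.merged, n ≤ m'.1 := he.le_merged
    rw [hl] at hperm hbits
    obtain ⟨u, hu⟩ := flips_ctlPerms_active hn hperm he.good.nodup_allWires
      (by rw [hargs]; exact hg.nodup_allWires) hdst hsrc fun m' hm' => hbits m' (by simp [hm'])
    rw [← hl, ← hπ] at hu
    -- Apart from freshness, only the bits of merged calls are constrained, so the set is stable
    -- under the updates of qubits that `run_conj` performs.
    let Z : Set Bits := {x | Fresh s.next x ∧ (∀ m' ∈ l₁, x m'.1 = 0) ∧ x m.1 = 1 ∧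
      ∀ m' ∈ l₂, x m'.1 = 0}
    have hxZ : x ∈ Z := ⟨hx, hz1, hxm, hz2⟩
    have hL : ∀ x ∈ Z, run π.1 (ket x) = ket (u x) := by
      rintro x ⟨a1, a2, a3, a4⟩
      rw [run_not hop, (hu x a1 a2 a3 a4).1]
    have hkeep : ∀ w, n ≤ w → w < s.next → u x w = x w := fun w hw hw' =>
      (hu x hx hz1 hxm hz2).2.2.2.1 w hw' (fun h => by have := hsrc w h; omega)
        fun h => by have := hdst w h; omega
    refine ⟨u x, hL x hxZ, (hu x hx hz1 hxm hz2).2.2.2.2, ?_, ?_, ?_, ?_⟩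
    · have := he.anc _ e.anchor_mem
      rw [hkeep _ this.1 this.2, h1]
    · intro w hw
      obtain ⟨e', he', hwe⟩ := mem_ancs.mp hw
      have := (hE e' he').anc w hwe
      rw [hkeep _ this.1 this.2, (hact x hx hc h1).1 w hw]
    · intro w hw
      have := hd.anc w hw
      rw [hkeep _ this.1 this.2, (hact x hx hc h1).2 w hw]
    · have hwires := unroll_lt hclone hrec he.good
      have hwin : ∀ g ∈ (P.unroll e.proc e.args).gates, ∀ w ∈ g.wires, w ∈ allWires e.args :=
        fun g hg w hw => mem_allWires.mpr
          ((Program.unroll_wiresIn hclone hrec e.proc e.args).gates g hg w hw)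
      have hlen := (hperm.2 m (by simp)).2.2
      rw [← hL x hxZ, run_conj (σ := relabel (allWires e.args) m.2) hL ?_ ?_ hxZ,
        run_reverse_run hnot, he.run_spec_merged hclone hrec hl hz1 hxm hz2, Entry.mergedGates,
        Tree.gates_rename]
      · rintro x ⟨a1, a2, a3, a4⟩ g hg w hw
        exact (hu x a1 a2 a3 a4).2.1 w (hwin g hg w hw)
      · rintro x ⟨a1, a2, a3, a4⟩ g hg v
        have ht := hwin g hg g.tgt (by simp [Gate.wires])
        refine ⟨(hu x a1 a2 a3 a4).2.2.1 _ ht v, ?_⟩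
        have hlt := hsrc _ (relabel_mem hlen ht)
        refine ⟨fun w hw => ?_, fun m' hm' => ?_, ?_, fun m' hm' => ?_⟩
        · rw [Function.update_of_ne (by omega)]; exact a1 w hw
        · have := hbits m' (by simp [hm'])
          rw [Function.update_of_ne (by omega)]; exact a2 m' hm'
        · have := hbits m (by simp)
          rw [Function.update_of_ne (by omega)]; exact a3
        · have := hbits m' (by simp [hm'])
          rw [Function.update_of_ne (by omega)]; exact a4 m' hm'
  refine ⟨hle.trans hle', ?_, ?_, h'.dict, ?_, ?_, ?_⟩
  · intro g hg
    simp only [List.mem_append] at hg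
    rcases hg with (hg | hg) | hg
    exacts [(helem g hg).mono hle', (h.elem_pre g hg).mono h'.le, h'.elem_pre g hg]
  · intro g hg
    simp only [List.mem_append, List.mem_reverse] at hg
    rcases hg with (hg | hg) | hg
    exacts [h'.elem_post g hg, (h.elem_post g hg).mono h'.le, (helem g hg).mono hle']
  · intro w hw
    rcases h'.anc_mem w hw with h1 | h1
    · rcases h.anc_mem w h1 with h2 | h2
      exacts [Or.inl h2, Or.inr (hle.trans h2)]
    · exact Or.inr (hle.trans (h.le.trans h1))
  · intro x hx hc
    have hx' : Fresh π.2 x := hx.mono hle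
    simp only [run_append]
    by_cases ha : x e.anchor = 0
    · have hm0 := (hc.1 e (by simp)).1 ha
      obtain ⟨c1, c2, c3⟩ := (hc.subset (List.sublist_cons_self _ _) : Conf (es ++ s.dict) x).of_append
      have hc' : Conf (es ++ r.state.dict) x := by
        refine c1.append (h.conf x hx' c2) fun e' he' h1 w hw => ?_
        rcases h.anc_mem w hw with h2 | h2
        exacts [c3 e' he' h1 w h2, hx' w h2]
      have hspec := hx.mono (hle.trans h.le)
      rw [hπ0 x hx hm0, h.off_pre x hx' (by simp [ha]), h'.eq x hspec hc']
      have hsame : run (spec (es ++ r.state.dict)) (ket x) ∈ On (SameAnc n x) := by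
        refine run_sameAnc (spec_tgt (next := r.state.next) hclone hrec ?_) x
        intro e' he'
        rcases List.mem_append.mp he' with h1 | h1
        exacts [(hE e' h1).mono (hle.trans h.le), h.dict.entry e' h1]
      rw [run_id_of_forall (gs := r.post) ?_ hsame, run_id_of_forall (gs := π.1.reverse) ?_ hsame]
      · rw [List.cons_append, spec_cons, run_append, he.run_spec_inactive hclone hrec ha hm0]
        simp only [spec_append, run_append]
        refine lin_agree ?_ (run_sameAnc (spec_tgt hclone hrec hE) x)
        intro y hy
        exact h.spec_eq y (SameAnc.fresh (hn.trans hle) hy hx')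
      · intro y hy
        refine hπ0' y (SameAnc.fresh hn hy hx) fun m hm => ?_
        rw [hy _ (he.le_merged m hm), hm0 m hm]
      · intro y hy
        refine h.off_post y (SameAnc.fresh (hn.trans hle) hy hx') ?_
        simp [hy _ (he.anc _ e.anchor_mem).1, ha]
    · have ha := fin_two_ne_zero_iff.mp ha
      rw [run_spec_of_active hclone hrec hall hc (e := e) (by simp) ha]
      by_cases hm0 : ∀ m ∈ e.merged, x m.1 = 0
      · obtain ⟨z1, z2⟩ := hact x hx hc ha
        rw [hπ0 x hx hm0, (EntriesSpec.active (s := ⟨π.2, s.dict⟩) hclone hrec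
          (fun e he => (hE e he).mono hle) hdis h h' hx' ha z2 z1).1,
          he.run_spec_first hclone hrec ha hm0]
        refine run_id_of_forall ?_ (run_sameAnc (unroll_lt hclone hrec he.good).tgt x)
        intro y hy
        refine hπ0' y (SameAnc.fresh hn hy hx) fun m hm => ?_
        rw [hy _ (he.le_merged m hm), hm0 m hm]
      · obtain ⟨y, y1, y2, y3, y4, y5, y6⟩ := hmer x hx hc ha hm0
        rw [y1, (EntriesSpec.active (s := ⟨π.2, s.dict⟩) hclone hrec
          (fun e he => (hE e he).mono hle) hdis h h' y2 y3 y5 y4).1, y6]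
  · intro x hx hc
    have hx' : Fresh π.2 x := hx.mono hle
    simp only [run_append]
    by_cases ha : x e.anchor = 0
    · have hm0 := (hc.1 e (by simp)).1 ha
      obtain ⟨c1, c2, c3⟩ := (hc.subset (List.sublist_cons_self _ _) : Conf (es ++ s.dict) x).of_append
      have hc' : Conf (es ++ r.state.dict) x := by
        refine c1.append (h.conf x hx' c2) fun e' he' h1 w hw => ?_
        rcases h.anc_mem w hw with h2 | h2
        exacts [c3 e' he' h1 w h2, hx' w h2]
      rw [hπ0 x hx hm0, h.off_pre x hx' (by simp [ha])]
      exact h'.mid x (hx.mono (hle.trans h.le)) hc'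
    · have ha := fin_two_ne_zero_iff.mp ha
      by_cases hm0 : ∀ m ∈ e.merged, x m.1 = 0
      · obtain ⟨z1, z2⟩ := hact x hx hc ha
        rw [hπ0 x hx hm0]
        exact (EntriesSpec.active (s := ⟨π.2, s.dict⟩) hclone hrec
          (fun e he => (hE e he).mono hle) hdis h h' hx' ha z2 z1).2
      · obtain ⟨y, y1, y2, y3, y4, y5, y6⟩ := hmer x hx hc ha hm0
        rw [y1]
        exact (EntriesSpec.active (s := ⟨π.2, s.dict⟩) hclone hrec
          (fun e he => (hE e he).mono hle) hdis h h' y2 y3 y5 y4).2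

/-- Each body may announce calls in the common dictionary; their ancillas are freshly allocated,
hence distinct from those of the entries still to be compiled. -/
theorem entriesSpec_compileEntries {n : ℕ} (hclone : P.NoCloning) (hrec : P.RecHalving)
    {cc : (p : Fin P.nprocs) → (Fin (P.arity p) → List ℕ) →
    List (ℕ × Fin 2) → ℕ → List Gate × ℕ} {R : Fin P.nprocs → Prop} [DecidablePred R]
    {es : List (Entry P.arity)} {s : CState P.arity} (hn : n ≤ s.next)
    (hE : ∀ e ∈ es, EntryOk P n s.next e) (hd : DictOk P n s) (hnod : (ancs (es ++ s.dict)).Nodup)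
    (hw : ∀ e ∈ es, (P.body e.proc).width R ≤ 1)
    (hcc : ∀ e ∈ es, ∀ q, P.Calls e.proc q → ¬ R q → CallOk P n cc q) :
    EntriesSpec P n es s (P.compileEntries cc R es s) := by
  induction es generalizing s with
  | nil =>
    refine ⟨le_rfl, by simp [Program.compileEntries], by simp [Program.compileEntries], hd,
      fun w hw => Or.inl hw, fun x _ _ => rfl, fun x hx hc => ket_mem_On ⟨hx, hc⟩⟩
  | cons e es ih =>
    have he := hE e (by simp)
    have hle := ctlPerms_le (allWires e.args) e.merged s.next
    have hE' : ∀ e ∈ es, EntryOk P n s.next e := fun e he => hE e (by simp [he])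
    obtain ⟨A, hA, hok⟩ := he.ok
    have hanc := he.anc _ e.anchor_mem
    have hnod' := hnod
    rw [List.cons_append, ancs_cons, ancs_append, List.nodup_append, List.nodup_append] at hnod'
    have h : StmtSpec P n (P.unroll e.proc e.args) [(e.anchor, 1)]
        ⟨(ctlPerms (allWires e.args) e.merged s.next).2, s.dict⟩
        ((P.body e.proc).compile cc R e.args [(e.anchor, 1)]
          ⟨(ctlPerms (allWires e.args) e.merged s.next).2, s.dict⟩) := by
      rw [Program.unroll_eq hclone hrec] at hok ⊢
      refine stmtSpec_compile hclone hrec he.good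
        (fun c hc => hcc e (by simp) c.1 (Stmt.mem_callees_of_mem_calls hc)) (hclone.1 _)
        (hw e (by simp)) hA hok ⟨by simp, ?_⟩ ?_ (hn.trans hle) (hd.mono rfl hle)
      · intro c hc
        obtain rfl := List.mem_singleton.mp hc
        exact ⟨hanc.2.trans_le hle, fun h => by have := hA h; simp only [Set.mem_Iio] at this; omega⟩
      · intro c hc
        obtain rfl := List.mem_singleton.mp hc
        exact fun hm => hnod'.2.2 _ e.anchor_mem _ (List.mem_append_right _ hm) rfl
    refine EntriesSpec.cons hclone hrec hn he hE' hd hnod h ?_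
    refine ih (hn.trans (hle.trans h.le)) (fun e he => (hE' e he).mono (hle.trans h.le)) h.dict ?_
      (fun e he => hw e (by simp [he])) fun e he => hcc e (by simp [he])
    rw [ancs_append, List.nodup_append]
    refine ⟨hnod'.2.1.1, h.dict.nodup, ?_⟩
    rintro w hw w' hw' rfl
    rcases h.anc_mem w hw' with h1 | h1
    · exact hnod'.2.1.2.2 w hw w h1 rfl
    · obtain ⟨e', he', hwe⟩ := mem_ancs.mp hw
      have := ((hE' e' he').anc w hwe).2
      exact absurd (hle.trans h1) (by omega)

end

end PLP

namespace PLP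

/-! ## Correctness of the compilation of dictionaries and calls -/

section

variable {P : Program}

theorem anchorMerge_dict_forall {N : ℕ} {ar : Fin N → ℕ}
    {Q : (p : Fin N) → (Fin (ar p) → List ℕ) → Prop} {p : Fin N} {args : Fin (ar p) → List ℕ}
    {cs : List (ℕ × Fin 2)} {s : CState ar} (hs : ∀ e ∈ s.dict, Q e.proc e.args) (h : Q p args) :
    ∀ e ∈ (anchorMerge p args cs s).state.dict, Q e.proc e.args := by
  unfold anchorMerge
  split
  · intro e he
    rcases List.mem_append.mp he with he | he
    · exact hs e he
    · obtain rfl := List.mem_singleton.mp he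
      exact h
  · intro e he
    obtain ⟨e', he', rfl⟩ := List.mem_map.mp he
    cases h' : e'.serves p (sizes args)
    · simpa [h'] using hs e' he'
    · simpa [h'] using hs e' he'

/-- Merging changes neither the procedure nor the arguments of an entry, so a property of calls that
passes to the calls of a statement holds throughout the dictionary. It yields the decrease of sizes
here and the reachability of keys in the cost analysis. -/
theorem compile_dict_forall {N : ℕ} {ar : Fin N → ℕ}
    {Q : (p : Fin N) → (Fin (ar p) → List ℕ) → Prop}
    {cc : (p : Fin N) → (Fin (ar p) → List ℕ) → List (ℕ × Fin 2) → ℕ → List Gate × ℕ}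
    {R : Fin N → Prop} [DecidablePred R] {V : Type} {f : V → List ℕ} {S : Stmt ar V}
    {cs : List (ℕ × Fin 2)} {s : CState ar} (hs : ∀ e ∈ s.dict, Q e.proc e.args)
    (h : ∀ c ∈ S.calls, R c.1 → (∀ j, (c.2 j).eval f ≠ []) → Q c.1 fun j => (c.2 j).eval f) :
    ∀ e ∈ (S.compile cc R f cs s).state.dict, Q e.proc e.args := by
  induction S generalizing cs s with
  | skip => exact hs
  | app => exact hs
  | seq S₀ S₁ ih₀ ih₁ =>
    simp only [Stmt.compile]
    split_ifs <;>
    exact ih₁ (ih₀ hs fun c hc => h c (by simp [Stmt.calls, hc]))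
      fun c hc => h c (by simp [Stmt.calls, hc])
  | ite b S₁ S₀ ih₁ ih₀ =>
    simp only [Stmt.compile]
    split_ifs
    · exact ih₁ hs fun c hc => h c (by simp [Stmt.calls, hc])
    · exact ih₀ hs fun c hc => h c (by simp [Stmt.calls, hc])
  | qcase q S₀ S₁ ih₀ ih₁ =>
    exact ih₁ (ih₀ hs fun c hc => h c (by simp [Stmt.calls, hc]))
      fun c hc => h c (by simp [Stmt.calls, hc])
  | call p args =>
    simp only [Stmt.compile]
    split_ifs with he hR
    · exact hs
    · exact anchorMerge_dict_forall hs (h ⟨p, args⟩ (by simp [Stmt.calls]) hR (by simpa using he))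
    · exact hs

theorem compileEntries_dict_forall {Q : (p : Fin P.nprocs) → (Fin (P.arity p) → List ℕ) → Prop}
    {cc : (p : Fin P.nprocs) → (Fin (P.arity p) → List ℕ) → List (ℕ × Fin 2) → ℕ → List Gate × ℕ}
    {R : Fin P.nprocs → Prop} [DecidablePred R] {es : List (Entry P.arity)} {s : CState P.arity}
    (hs : ∀ e ∈ s.dict, Q e.proc e.args)
    (h : ∀ e ∈ es, ∀ c ∈ (P.body e.proc).calls, R c.1 → (∀ j, (c.2 j).eval e.args ≠ []) →
      Q c.1 fun j => (c.2 j).eval e.args) :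
    ∀ e ∈ (P.compileEntries cc R es s).state.dict, Q e.proc e.args := by
  induction es generalizing s with
  | nil => exact hs
  | cons e es ih =>
    simp only [Program.compileEntries]
    refine ih ?_ fun e he => h e (by simp [he])
    exact compile_dict_forall hs (h e (by simp))

/-- The recursive calls satisfying `R` that are made by a procedure satisfying `R` are halving, and
such a procedure has width at most `1`. -/
structure RecClass (P : Program) (R : Fin P.nprocs → Prop) [DecidablePred R] : Prop where
  width : ∀ p, R p → (P.body p).width R ≤ 1
  halves : ∀ p, R p → ∀ c ∈ (P.body p).calls, R c.1 → ∃ j, (c.2 j).Halves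

theorem Program.IsPolyLog.recClass (h : P.IsPolyLog) (p : Fin P.nprocs) :
    RecClass P (P.MutRec p) where
  width q hq := by rw [Stmt.width_congr _ hq.congr]; exact h.2 q
  halves q hq c hc hR := (h.1 q).of_mem_calls hc ((hq.congr _).mp hR)

/-- The calls of the dictionary have arguments of total size between `1` and `t`. -/
def DictLe (R : Fin P.nprocs → Prop) (t : ℕ) (p : Fin P.nprocs)
    (args : Fin (P.arity p) → List ℕ) : Prop :=
  R p ∧ 1 ≤ tot args ∧ tot args ≤ t

theorem RecClass.dictLe (hclone : P.NoCloning) {R : Fin P.nprocs → Prop} [DecidablePred R]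
    (hR : RecClass P R) {t : ℕ} {p : Fin P.nprocs} {args : Fin (P.arity p) → List ℕ}
    (hp : R p) (ht : tot args ≤ t + 1)
    {c : Σ q : Fin P.nprocs, Fin (P.arity q) → Exp (Fin (P.arity p)) .list}
    (hc : c ∈ (P.body p).calls) (hRc : R c.1) (hne : ∀ j, (c.2 j).eval args ≠ []) :
    DictLe R t c.1 fun j => (c.2 j).eval args := by
  have hh := hR.halves p hp c hc hRc
  refine ⟨hRc, ?_, ?_⟩
  · obtain ⟨j, -⟩ := hh
    have h1 : 1 ≤ ((c.2 j).eval args : List ℕ).length := List.length_pos_of_ne_nil (hne j)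
    exact h1.trans (Finset.single_le_sum (f := fun j => ((c.2 j).eval args : List ℕ).length)
      (fun _ _ => Nat.zero_le _) (Finset.mem_univ j))
  · have := sum_length_eval_lt ((hclone.1 p).of_mem_calls hc) hh hne
    omega

theorem ancs_perm {D D' : List (Entry P.arity)} (h : D.Perm D') : (ancs D).Perm (ancs D') :=
  List.Perm.flatMap_right _ h

theorem DictOk.sublist {n : ℕ} {s : CState P.arity} (h : DictOk P n s) {D : List (Entry P.arity)}
    (hs : D.Sublist s.dict) : DictOk P n ⟨s.next, D⟩ where
  entry e he := h.entry e (hs.subset he)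
  keys := h.keys.sublist (hs.map _)
  nodup := h.nodup.sublist (hs.flatMap _)

theorem compileEntries_dictLe (hclone : P.NoCloning) {R : Fin P.nprocs → Prop} [DecidablePred R]
    (hR : RecClass P R)
    {cc : (p : Fin P.nprocs) → (Fin (P.arity p) → List ℕ) → List (ℕ × Fin 2) → ℕ → List Gate × ℕ}
    {t : ℕ} {s : CState P.arity} (h : ∀ e ∈ s.dict, DictLe R (t + 1) e.proc e.args) :
    ∀ e ∈ (P.compileEntries cc R
      (s.dict.filter fun e => (allWires e.args).length = t + 1)
      ⟨s.next, s.dict.filter fun e => (allWires e.args).length ≠ t + 1⟩).state.dict,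
      DictLe R t e.proc e.args := by
  refine compileEntries_dict_forall (Q := DictLe R t) ?_ ?_
  · intro e he
    have he' := List.mem_filter.mp he
    obtain ⟨h1, h2, h3⟩ := h e he'.1
    refine ⟨h1, h2, ?_⟩
    have := he'.2
    rw [length_allWires, decide_eq_true_eq] at this
    omega
  · intro e he c hc hRc hne
    obtain ⟨h1, h2, h3⟩ := h e (List.mem_filter.mp he).1
    exact hR.dictLe hclone h1 h3 hc hRc hne

theorem filter_perm (s : CState P.arity) (t : ℕ) :
    ((s.dict.filter fun e => (allWires e.args).length = t + 1) ++
      s.dict.filter fun e => (allWires e.args).length ≠ t + 1).Perm s.dict := by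
  have := List.filter_append_perm (fun e : Entry P.arity => decide ((allWires e.args).length = t + 1))
    s.dict
  simpa using this

/-- Entries of size exactly `t + 1` are compiled in one round, and their bodies announce calls of
size at most `t` only, so the remaining dictionary satisfies the induction hypothesis. Sizes are at
least `1`, hence the dictionary is empty at `t = 0`. -/
theorem run_compileDict {n : ℕ} (hclone : P.NoCloning) (hrec : P.RecHalving)
    {cc : (p : Fin P.nprocs) → (Fin (P.arity p) → List ℕ) → List (ℕ × Fin 2) → ℕ → List Gate × ℕ}
    {R : Fin P.nprocs → Prop} [DecidablePred R] (hR : RecClass P R)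
    (hcc : ∀ p, R p → ∀ q, P.Calls p q → ¬ R q → CallOk P n cc q) (t : ℕ) {s : CState P.arity}
    (hn : n ≤ s.next) (hd : DictOk P n s) (ht : ∀ e ∈ s.dict, DictLe R t e.proc e.args) :
    s.next ≤ (P.compileDict cc R t s).2 ∧
    (∀ g ∈ (P.compileDict cc R t s).1, g.Elementary (P.compileDict cc R t s).2) ∧
    ∀ x, Fresh s.next x → Conf s.dict x →
      run (P.compileDict cc R t s).1 (ket x) = run (spec s.dict) (ket x) := by
  induction t generalizing s with
  | zero =>
    have : s.dict = [] := by
      refine List.eq_nil_iff_forall_not_mem.mpr fun e he => ?_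
      obtain ⟨-, h1, h2⟩ := ht e he
      omega
    simp [Program.compileDict, this]
  | succ t ih =>
    have hperm := filter_perm s t
    have hlt := compileEntries_dictLe hclone hR (cc := cc) ht
    simp only [Program.compileDict]
    set es := s.dict.filter fun e => (allWires e.args).length = t + 1 with hes
    set rest := s.dict.filter fun e => (allWires e.args).length ≠ t + 1 with hrest
    have hmem : ∀ e ∈ es, e ∈ s.dict := fun e he => (List.mem_filter.mp he).1
    have h : EntriesSpec P n es ⟨s.next, rest⟩ (P.compileEntries cc R es ⟨s.next, rest⟩) := by
      refine entriesSpec_compileEntries hclone hrec hn (fun e he => hd.entry e (hmem e he))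
        (hd.sublist List.filter_sublist) ?_ (fun e he => hR.width _ (ht e (hmem e he)).1)
        fun e he => hcc _ (ht e (hmem e he)).1
      exact (ancs_perm hperm).nodup_iff.mpr hd.nodup
    obtain ⟨h1, h2, h3⟩ := ih (hn.trans h.le) h.dict hlt
    refine ⟨h.le.trans h1, ?_, ?_⟩
    · intro g hg
      simp only [List.mem_append] at hg
      rcases hg with (hg | hg) | hg
      exacts [(h.elem_pre g hg).mono h1, h2 g hg, (h.elem_post g hg).mono h1]
    · intro x hx hc
      have hc' := hc.perm hperm.symm
      rw [run_spec_perm hclone hrec hd.entry hperm.symm hc, ← h.eq x hx hc']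
      simp only [run_append]
      congr 1
      refine lin_agree ?_ (h.mid x hx hc')
      rintro y ⟨y1, y2⟩
      exact h3 y y1 y2

/-- On a cycle through `p` there is a call to `p` from its own class, and such a call has a halved
argument, so `p` has a parameter. Together with nonemptiness this makes the total size of a pending
call positive. -/
theorem Program.arity_pos (hrec : P.RecHalving) {p : Fin P.nprocs} (h : P.MutRec p p) :
    0 < P.arity p := by
  obtain ⟨q, hq, hqp⟩ : ∃ q, Relation.ReflTransGen P.Calls p q ∧ P.Calls q p :=
    Relation.TransGen.tail'_iff.mp h.1
  have hm : P.MutRec q p := by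
    refine ⟨.single hqp, ?_⟩
    rcases Relation.reflTransGen_iff_eq_or_transGen.mp hq with e | e
    · subst e; exact .single hqp
    · exact e
  obtain ⟨c, hc, rfl⟩ : ∃ c ∈ (P.body q).calls, c.1 = p := by
    have : ∀ {V : Type} (S : Stmt P.arity V), p ∈ S.callees → ∃ c ∈ S.calls, c.1 = p := by
      intro V S hS
      induction S with
      | skip => simp [Stmt.callees] at hS
      | app => simp [Stmt.callees] at hS
      | call q args =>
        simp only [Stmt.callees, List.mem_singleton] at hS
        exact ⟨⟨q, args⟩, by simp [Stmt.calls], hS.symm⟩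
      | _ =>
        simp only [Stmt.callees, List.mem_append] at hS
        simp only [Stmt.calls, List.mem_append]
        grind
    exact this _ hqp
  obtain ⟨j, -⟩ := (hrec q).of_mem_calls hc hm
  exact j.pos

theorem Program.rank_pos (p : Fin P.nprocs) : 0 < P.rank p :=
  (Set.ncard_pos (Set.toFinite _)).mpr ⟨p, Relation.ReflTransGen.refl⟩

theorem tot_pos {m : ℕ} (hm : 0 < m) {args : Fin m → List ℕ} (h : ∀ j, args j ≠ []) :
    1 ≤ tot args := by
  have h1 : 1 ≤ (args ⟨0, hm⟩).length := List.length_pos_of_ne_nil (h _)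
  exact h1.trans (Finset.single_le_sum (f := fun j => (args j).length)
    (fun _ _ => Nat.zero_le _) (Finset.mem_univ _))

/-- Calls passed on to the next level leave the recursion class, so their rank is smaller; a fuel of
at least the rank suffices, and the rank never exceeds the number of procedures. -/
theorem callOk_compileCall (hclone : P.NoCloning) (hplp : P.IsPolyLog) (n d : ℕ)
    (p : Fin P.nprocs) (hp : P.rank p ≤ d) : CallOk P n (P.compileCall d) p := by
  have hrec := hplp.1
  induction d generalizing p with
  | zero => have := P.rank_pos p; omega
  | succ d ih =>
    intro args A cs next hargs hne hA hok hcs hn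
    have hd0 : DictOk P n (⟨next, []⟩ : CState P.arity) :=
      ⟨by simp, by simp, by simp [ancs]⟩
    simp only [Program.compileCall]
    split_ifs with hR
    · have h := stmtSpec_anchorMerge hclone hrec hA hargs hne hok hcs (by simp [ancs]) hn hd0
      have ht : ∀ e ∈ (anchorMerge p args cs ⟨next, []⟩).state.dict,
          DictLe (P.MutRec p) (allWires args).length e.proc e.args := by
        refine anchorMerge_dict_forall (Q := DictLe (P.MutRec p) (allWires args).length) (by simp) ?_
        exact ⟨hR, tot_pos (Program.arity_pos hrec hR) hne, (length_allWires args).ge⟩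
      obtain ⟨h1, h2, h3⟩ := run_compileDict hclone hrec (hplp.recClass p)
        (fun q hq q' hqq' hn' => ih q' (by
          have := P.rank_lt hqq' fun hm => hn' (hq.trans hm)
          rw [← hq.rank_eq] at this
          omega)) _ (hn.trans h.le) h.dict ht
      have hc0 : ∀ x, Conf ([] : List (Entry P.arity)) x := fun x => ⟨by simp, by simp⟩
      refine ⟨h.le.trans h1, ?_, ?_, ?_⟩
      · intro g hg
        simp only [List.mem_append] at hg
        rcases hg with (hg | hg) | hg
        exacts [(h.elem_pre g hg).mono h1, h2 g hg, (h.elem_post g hg).mono h1]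
      · intro x hx hh
        simp only [run_append]
        -- If the controls fail, no anchor is set, and the ideal circuit of the new dictionary acts
        -- like that of the empty one.
        rw [h.off_pre x hx hh, h3 x (hx.mono h.le) (h.conf x hx (hc0 x)), h.spec_eq x hx]
        exact h.off_post x hx hh
      · intro x hx hh
        simp only [run_append]
        have hst : x ∈ Start cs (⟨next, []⟩ : CState P.arity) := ⟨hx, hh, by simp [ancs]⟩
        rw [← h.on x hst]
        congr 1
        refine lin_agree ?_ (h.mid x hst)
        rintro y ⟨y1, -, y2, -⟩
        exact h3 y y1 y2
    · have hok' := hok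
      rw [Program.unroll_eq hclone hrec] at hok' ⊢
      obtain ⟨h1, -, h2⟩ := compile_width_zero (cc := P.compileCall d) (R := fun _ => False)
        (s := ⟨next, []⟩) hargs (fun c hc _ => ih c.1 (by
          have := P.rank_lt (Stmt.mem_callees_of_mem_calls hc) fun hm => hR (hm.trans hm.symm)
          omega)) (hclone.1 p)
        (Stmt.width_eq_zero_of_forall_not _ fun _ => id) hA hok' hcs hn
      rw [h1, List.append_nil]
      exact h2

theorem pointers_var {m : ℕ} (len : Fin m → ℕ) (q : Fin m) :
    wiresOf len (fun q => .var q) q = (List.range' 1 (len q)).map (wire len q) := by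
  simp [wiresOf, Exp.eval, Exp.base, pointers]

theorem good_wiresOf {m : ℕ} (len : Fin m → ℕ) :
    Good (total len) (wiresOf len fun q => .var q) where
  nodup q := by
    rw [pointers_var]
    refine List.Nodup.map_on ?_ List.nodup_range'
    intro k hk k' hk' e
    simp only [List.mem_range'_1] at hk hk'
    exact (wire_injective len (q := q) (q' := q) ⟨hk.1, by omega⟩ ⟨hk'.1, by omega⟩ e).2
  lt q w hw := by
    rw [pointers_var] at hw
    obtain ⟨k, hk, rfl⟩ := List.mem_map.mp hw
    simp only [List.mem_range'_1] at hk
    exact wire_lt_total len ⟨hk.1, by omega⟩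
  disj q q' hq w hw hw' := by
    rw [pointers_var] at hw hw'
    obtain ⟨k, hk, rfl⟩ := List.mem_map.mp hw
    obtain ⟨k', hk', e⟩ := List.mem_map.mp hw'
    simp only [List.mem_range'_1] at hk hk'
    exact hq (wire_injective len ⟨hk'.1, by omega⟩ ⟨hk.1, by omega⟩ e).1.symm

/-- The circuit of a program whose execution does not lead to an error. -/
theorem compile_correct (hclone : P.NoCloning) (hplp : P.IsPolyLog) (len : Fin P.nvars → ℕ)
    {A : Set ℕ} (hA : A ⊆ Set.Iio (total len))
    (hok : (P.main.tree P.unroll (wiresOf len fun q => .var q)).Ok A) :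
    (P.compile len).WellFormed ∧ ∀ ψ : QState (total len),
      (P.compile len).apply (withAncillas (P.compile len).ancillas ψ) =
        withAncillas (P.compile len).ancillas
          (applyGates (P.main.tree P.unroll (wiresOf len fun q => .var q)).gates ψ) := by
  have hw0 : P.main.width (fun _ => False) = 0 :=
    Stmt.width_eq_zero_of_forall_not _ fun _ => id
  obtain ⟨h1, -, h2⟩ := compile_width_zero (cc := P.compileCall P.nprocs) (R := fun _ => False)
    (s := ⟨total len, []⟩) (good_wiresOf len)
    (fun c hc _ => callOk_compileCall hclone hplp _ _ _ (P.rank_le _)) hclone.2 hw0 hA hok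
    (cs := []) ⟨by simp, by simp⟩ le_rfl
  have hle := h2.le
  simp only at hle
  have hfun : (fun q => (List.range' 1 (len q)).map (wire len q)) =
      wiresOf len fun q => .var q := (funext (pointers_var len)).symm
  have hgates : (P.compile len).gates = (P.main.compile (P.compileCall P.nprocs) (fun _ => False)
      (wiresOf len fun q => .var q) [] ⟨total len, []⟩).pre := by
    simp only [Program.compile]
    rw [hfun, h1, List.append_nil]
  have hanc : total len + (P.compile len).ancillas = (P.main.compile (P.compileCall P.nprocs)
      (fun _ => False) (wiresOf len fun q => .var q) [] ⟨total len, []⟩).state.next := by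
    simp only [Program.compile]
    rw [hfun]
    omega
  have hel : ∀ g ∈ (P.compile len).gates,
      g.Elementary (total len + (P.compile len).ancillas) := by
    rw [hgates, hanc]; exact h2.elem
  -- Embedding into infinitely many wires is injective and forgets the declared ancillas, so both
  -- sides become runs on the same vector.
  refine ⟨fun g hg => hel g hg, fun ψ => embed_injective ?_⟩
  rw [Circuit.apply, embed_foldl fun g hg => (hel g hg).2, embed_withAncillas,
    embed_withAncillas, hgates, applyGates, embed_foldl]
  · refine lin_agree ?_ (embed_mem ψ)
    intro x hx
    exact h2.on x hx (holds_nil x)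
  · exact fun g hg => ⟨hok.nodup g hg, fun w hw => hA (hok.wiresIn.gates g hg w hw)⟩

end

end PLP

namespace PLP

/-! ## Depth and size of gate lists -/

/-- The gates act on disjoint wires. -/
def Gate.Apart (g h : Gate) : Prop := ∀ w ∈ g.wires, w ∉ h.wires

theorem Gate.Apart.symm {g h : Gate} (H : g.Apart h) : h.Apart g := fun w hw hw' => H w hw' hw

/-- The gates can be executed in `d` time steps: there is an assignment of time steps such that
gates which share a wire are executed in the order of the list. -/
def HasDepth (gs : List Gate) (d : ℕ) : Prop :=
  ∃ l : List (Gate × ℕ), l.map Prod.fst = gs ∧ (∀ p ∈ l, p.2 < d) ∧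
    l.Pairwise fun p q => p.1.Apart q.1 ∨ p.2 < q.2

theorem hasDepth_nil (d : ℕ) : HasDepth [] d := ⟨[], rfl, by simp, by simp⟩

theorem hasDepth_singleton (g : Gate) : HasDepth [g] 1 := ⟨[(g, 0)], rfl, by simp, by simp⟩

theorem HasDepth.mono {gs : List Gate} {d d' : ℕ} (h : HasDepth gs d) (hd : d ≤ d') :
    HasDepth gs d' := by
  obtain ⟨l, h1, h2, h3⟩ := h
  exact ⟨l, h1, fun p hp => (h2 p hp).trans_le hd, h3⟩

theorem HasDepth.append {gs hs : List Gate} {d d' : ℕ} (h : HasDepth gs d) (h' : HasDepth hs d') :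
    HasDepth (gs ++ hs) (d + d') := by
  obtain ⟨l, h1, h2, h3⟩ := h
  obtain ⟨l', h1', h2', h3'⟩ := h'
  refine ⟨l ++ l'.map fun p => (p.1, d + p.2), ?_, ?_, ?_⟩
  · rw [List.map_append, h1, List.map_map, ← h1']; rfl
  · intro p hp
    rcases List.mem_append.mp hp with hp | hp
    · exact (h2 p hp).trans_le (by omega)
    · obtain ⟨q, hq, rfl⟩ := List.mem_map.mp hp
      have := h2' q hq
      dsimp only
      omega
  · rw [List.pairwise_append]
    refine ⟨h3, ?_, fun p hp q hq => ?_⟩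
    · rw [List.pairwise_map]
      exact h3'.imp fun H => H.imp id fun h => by dsimp only; omega
    · obtain ⟨q, hq, rfl⟩ := List.mem_map.mp hq
      have := h2 p hp
      exact Or.inr (by dsimp only; omega)

theorem HasDepth.parallel {gs hs : List Gate} {d : ℕ} (h : HasDepth gs d) (h' : HasDepth hs d)
    (hap : ∀ g ∈ gs, ∀ g' ∈ hs, g.Apart g') : HasDepth (gs ++ hs) d := by
  obtain ⟨l, h1, h2, h3⟩ := h
  obtain ⟨l', h1', h2', h3'⟩ := h'
  refine ⟨l ++ l', by rw [List.map_append, h1, h1'], ?_, ?_⟩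
  · intro p hp
    rcases List.mem_append.mp hp with hp | hp
    exacts [h2 p hp, h2' p hp]
  · refine List.pairwise_append.mpr ⟨h3, h3', fun p hp q hq => Or.inl (hap _ ?_ _ ?_)⟩
    · rw [← h1]; exact List.mem_map_of_mem hp
    · rw [← h1']; exact List.mem_map_of_mem hq

theorem HasDepth.flatMap {α : Type} {l : List α} {f : α → List Gate} {d : ℕ}
    (h : ∀ a ∈ l, HasDepth (f a) d)
    (hap : l.Pairwise fun a b => ∀ g ∈ f a, ∀ g' ∈ f b, g.Apart g') : HasDepth (l.flatMap f) d := by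
  induction l with
  | nil => exact hasDepth_nil d
  | cons a l ih =>
    rw [List.pairwise_cons] at hap
    rw [List.flatMap_cons]
    refine (h a (by simp)).parallel (ih (fun b hb => h b (by simp [hb])) hap.2) ?_
    intro g hg g' hg'
    obtain ⟨b, hb, hg'⟩ := List.mem_flatMap.mp hg'
    exact hap.1 b hb g hg g' hg'

theorem HasDepth.reverse {gs : List Gate} {d : ℕ} (h : HasDepth gs d) : HasDepth gs.reverse d := by
  obtain ⟨l, h1, h2, h3⟩ := h
  refine ⟨(l.map fun p => (p.1, d - 1 - p.2)).reverse, ?_, ?_, ?_⟩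
  · rw [List.map_reverse, List.map_map, ← h1]; rfl
  · intro p hp
    obtain ⟨q, hq, rfl⟩ := List.mem_map.mp (List.mem_reverse.mp hp)
    have := h2 q hq
    dsimp only
    omega
  · rw [List.pairwise_reverse, List.pairwise_map]
    refine h3.imp_of_mem fun {p q} hp hq H => ?_
    rcases H with H | H
    · exact Or.inl H.symm
    · have := h2 p hp
      have := h2 q hq
      exact Or.inr (by dsimp only; omega)

theorem hasDepth_length (gs : List Gate) : HasDepth gs gs.length := by
  induction gs with
  | nil => exact hasDepth_nil 0
  | cons g gs ih =>
    have := (hasDepth_singleton g).append ih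
    rw [List.length_cons, add_comm]
    exact this

theorem foldr_max_le {l : List ℕ} {b : ℕ} (h : ∀ a ∈ l, a ≤ b) : l.foldr max 0 ≤ b := by
  induction l with
  | nil => simp
  | cons a l ih =>
    rw [List.foldr_cons, max_le_iff]
    exact ⟨h a (by simp), ih fun a ha => h a (by simp [ha])⟩

/-- The greedy schedule is at least as fast as any valid one: throughout, the wires of a gate not
yet executed are free by the time step assigned to that gate. -/
theorem HasDepth.schedule_le {gs : List Gate} {d : ℕ} (h : HasDepth gs d) :
    (gs.foldl Gate.schedule (fun _ => 0, 0)).2 ≤ d := by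
  obtain ⟨l, rfl, h2, h3⟩ := h
  have key : ∀ t : (ℕ → ℕ) × ℕ, (∀ p ∈ l, ∀ w ∈ p.1.wires, t.1 w ≤ p.2) → t.2 ≤ d →
      ((l.map Prod.fst).foldl Gate.schedule t).2 ≤ d := by
    induction l with
    | nil => exact fun t _ h => h
    | cons p l ih =>
      intro t ht htd
      rw [List.pairwise_cons] at h3
      have hmax : ((p.1.wires.map t.1).foldr max 0) ≤ p.2 := by
        refine foldr_max_le fun a ha => ?_
        obtain ⟨w, hw, rfl⟩ := List.mem_map.mp ha
        exact ht p (by simp) w hw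
      rw [List.map_cons, List.foldl_cons]
      refine ih (fun q hq => h2 q (by simp [hq])) h3.2 _ ?_ ?_
      · intro q hq w hw
        simp only [Gate.schedule]
        split_ifs with hwp
        · rcases h3.1 q hq with H | H
          · exact absurd hw (H w hwp)
          · omega
        · exact ht q (by simp [hq]) w hw
      · simp only [Gate.schedule]
        have := h2 p (by simp)
        exact max_le htd (by omega)
  exact key _ (fun _ _ _ _ => Nat.zero_le _) (Nat.zero_le _)

/-- The gate list has size at most `k * n` and depth at most `k * log n`. -/
structure Cost (n : ℕ) (gs : List Gate) (k : ℕ) : Prop where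
  size : gs.length ≤ k * n
  depth : HasDepth gs (k * Nat.log 2 n)

theorem Cost.mono {n k k' : ℕ} {gs : List Gate} (h : Cost n gs k) (hk : k ≤ k') : Cost n gs k' :=
  ⟨h.size.trans (Nat.mul_le_mul_right _ hk), h.depth.mono (Nat.mul_le_mul_right _ hk)⟩

theorem cost_nil (n k : ℕ) : Cost n [] k := ⟨by simp, hasDepth_nil _⟩

theorem Cost.append {n k k' : ℕ} {gs hs : List Gate} (h : Cost n gs k) (h' : Cost n hs k') :
    Cost n (gs ++ hs) (k + k') :=
  ⟨by rw [List.length_append, add_mul]; exact Nat.add_le_add h.size h'.size,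
    by rw [add_mul]; exact h.depth.append h'.depth⟩

theorem Cost.reverse {n k : ℕ} {gs : List Gate} (h : Cost n gs k) : Cost n gs.reverse k :=
  ⟨by rw [List.length_reverse]; exact h.size, h.depth.reverse⟩

theorem one_le_log {n : ℕ} (hn : 2 ≤ n) : 1 ≤ Nat.log 2 n := Nat.log_pos (by omega) hn

theorem cost_of_length {n k : ℕ} (hn : 2 ≤ n) {gs : List Gate} (h : gs.length ≤ k) :
    Cost n gs k :=
  ⟨h.trans (Nat.le_mul_of_pos_right _ (by omega)),
    (hasDepth_length gs).mono (h.trans (Nat.le_mul_of_pos_right _ (one_le_log hn)))⟩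

theorem length_ctlChain (op : Op) (t : ℕ) (c : ℕ × Fin 2) (cs : List (ℕ × Fin 2)) (next : ℕ) :
    (ctlChain op t c cs next).1.length ≤ 2 * cs.length + 1 ∧
      (ctlChain op t c cs next).2 = next + cs.length := by
  induction cs generalizing c next with
  | nil => simp [ctlChain]
  | cons d ds ih =>
    obtain ⟨h1, h2⟩ := ih (next, 1) (next + 1)
    simp only [ctlChain, List.length_cons, List.length_append, List.length_nil]
    omega

theorem length_multiCtl (op : Op) (t : ℕ) (cs : List (ℕ × Fin 2)) (next : ℕ) :
    (multiCtl op t cs next).1.length ≤ 2 * cs.length + 1 ∧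
      (multiCtl op t cs next).2 ≤ next + cs.length := by
  cases cs with
  | nil => simp [multiCtl]
  | cons c cs =>
    obtain ⟨h1, h2⟩ := length_ctlChain op t c cs next
    simp only [multiCtl, List.length_cons]
    omega

theorem hasDepth_cswap (c x y : ℕ) : HasDepth (cswap c x y) 3 := hasDepth_length _

theorem wires_cswap {c x y : ℕ} {g : Gate} (hg : g ∈ cswap c x y) :
    ∀ w ∈ g.wires, w = c ∨ w = x ∨ w = y := by
  simp only [cswap, List.mem_cons, List.not_mem_nil, or_false] at hg
  rcases hg with rfl | rfl | rfl <;> simp [Gate.wires]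

/-- Copy `v` is made at time `2 * log v + v % 2`. Its parent `v / 2` is one level higher and thus at
least one step earlier; siblings, which share the control wire, are separated by their parity. -/
theorem hasDepth_fanOut {b next : ℕ} (hb : b < next) (K : ℕ) :
    HasDepth ((List.range K).map fun j =>
      (⟨[(copyWire b next ((j + 1) / 2), 1)], .not, copyWire b next (j + 1)⟩ : Gate))
      (2 * Nat.log 2 K + 2) := by
  refine ⟨(List.range K).map fun j =>
    (⟨[(copyWire b next ((j + 1) / 2), 1)], .not, copyWire b next (j + 1)⟩,
      2 * Nat.log 2 (j + 1) + (j + 1) % 2), ?_, ?_, ?_⟩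
  · rw [List.map_map]; rfl
  · intro p hp
    obtain ⟨j, hj, rfl⟩ := List.mem_map.mp hp
    have : Nat.log 2 (j + 1) ≤ Nat.log 2 K := Nat.log_mono_right (List.mem_range.mp hj)
    have := Nat.mod_lt (j + 1) (by omega : 2 > 0)
    dsimp only
    omega
  · rw [List.pairwise_map]
    refine List.pairwise_lt_range.imp ?_
    intro i j hij
    by_cases h1 : (j + 1) / 2 = (i + 1) / 2
    · have : Nat.log 2 (i + 1) ≤ Nat.log 2 (j + 1) := Nat.log_mono_right (by omega)
      exact Or.inr (by dsimp only; omega)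
    by_cases h2 : (j + 1) / 2 = i + 1
    · have : Nat.log 2 (j + 1) = Nat.log 2 (i + 1) + 1 := by
        rw [Nat.log_of_one_lt_of_le (by omega) (by omega), h2]
      exact Or.inr (by dsimp only; omega)
    · refine Or.inl fun w hw hw' => ?_
      simp only [Gate.wires, List.map_cons, List.map_nil, List.mem_cons, List.not_mem_nil,
        or_false, copyWire] at hw hw'
      rcases hw with rfl | rfl <;> rcases hw' with h | h <;> split_ifs at h <;> omega

theorem hasDepth_moves {K : ℕ} {c x y : ℕ → ℕ}
    (h : ∀ i < K, ∀ j < K, i ≠ j → c i ≠ c j ∧ c i ≠ x j ∧ c i ≠ y j ∧ x i ≠ x j ∧ x i ≠ y j ∧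
      y i ≠ y j) :
    HasDepth ((List.range K).flatMap fun j => cswap (c j) (x j) (y j)) 3 := by
  refine HasDepth.flatMap (fun j _ => hasDepth_cswap _ _ _) ?_
  refine List.pairwise_lt_range.imp_of_mem ?_
  intro i j hi hj hij g hg g' hg' w hw hw'
  have hi' := List.mem_range.mp hi
  have hj' := List.mem_range.mp hj
  obtain ⟨a1, a2, a3, a4, a5, a6⟩ := h i hi' j hj' hij.ne
  obtain ⟨b1, b2, b3, b4, b5, b6⟩ := h j hj' i hi' hij.ne'
  rcases wires_cswap hg w hw with rfl | rfl | rfl <;>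
    rcases wires_cswap hg' _ hw' with e | e | e <;> first | exact absurd e ‹_› | exact absurd e.symm ‹_›

/-- With `K` qubits there are `7 * K` gates, and the depth is `2 * log K + 2` for the fan-out plus
`3` for each layer of swaps; since `1 ≤ log n`, the constant `10` covers both. -/
theorem cost_ctlPerm {n b next : ℕ} {src dst : List ℕ} (hn : 2 ≤ n) (hb : b < next)
    (hs : src.Nodup) (hd : dst.Nodup) (hsn : ∀ w ∈ src, w < next) (hdn : ∀ w ∈ dst, w < next)
    (hlen : src.length = dst.length) (hK : src.length ≤ n) :
    Cost n (ctlPerm b src dst next).1 10 := by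
  have hL := one_le_log hn
  constructor
  · simp only [ctlPerm, List.length_append, List.length_map, List.length_range,
      List.length_flatMap, cswap, List.length_cons, List.length_nil]
    simp only [List.map_const', List.sum_replicate, List.length_range, smul_eq_mul]
    omega
  · have hs' : ∀ i < src.length, src.getD i 0 < next := fun i hi => by
      rw [List.getD_eq_getElem _ _ hi]; exact hsn _ (List.getElem_mem _)
    have hd' : ∀ i < src.length, dst.getD i 0 < next := fun i hi => by
      rw [List.getD_eq_getElem _ _ (by omega)]; exact hdn _ (List.getElem_mem _)
    have hsi : ∀ i < src.length, ∀ j < src.length, i ≠ j → src.getD i 0 ≠ src.getD j 0 := by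
      intro i hi j hj hij
      rw [List.getD_eq_getElem _ _ hi, List.getD_eq_getElem _ _ hj]
      exact fun e => hij ((hs.getElem_inj_iff).mp e)
    have hdi : ∀ i < src.length, ∀ j < src.length, i ≠ j → dst.getD i 0 ≠ dst.getD j 0 := by
      intro i hi j hj hij
      rw [List.getD_eq_getElem _ _ (by omega), List.getD_eq_getElem _ _ (by omega)]
      exact fun e => hij ((hd.getElem_inj_iff).mp e)
    have h1 := hasDepth_fanOut hb src.length
    have h2 : HasDepth ((List.range src.length).flatMap fun j =>
        cswap (copyWire b next (j + 1)) (src.getD j 0) (next + src.length + j)) 3 := by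
      refine hasDepth_moves fun i hi j hj hij => ?_
      have := hs' i hi; have := hs' j hj; have := hsi i hi j hj hij
      simp only [copyWire, Nat.add_eq_zero_iff, one_ne_zero, and_false, if_false]
      refine ⟨?_, ?_, ?_, ‹_›, ?_, ?_⟩ <;> omega
    have h3 : HasDepth ((List.range src.length).flatMap fun j =>
        cswap (copyWire b next (j + 1)) (next + src.length + j) (dst.getD j 0)) 3 := by
      refine hasDepth_moves fun i hi j hj hij => ?_
      have := hd' i hi; have := hd' j hj; have := hdi i hi j hj hij
      simp only [copyWire, Nat.add_eq_zero_iff, one_ne_zero, and_false, if_false]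
      refine ⟨?_, ?_, ?_, ?_, ?_, ‹_›⟩ <;> omega
    have hlog : Nat.log 2 src.length ≤ Nat.log 2 n := Nat.log_mono_right hK
    exact ((h1.append h2).append h3).mono (by omega)

end PLP

/-! ### Resource bounds for dictionaries, amortized over their keys. -/

namespace PLP

/-! ## Cost of the compilation of statements and dictionaries -/

section

variable {P : Program}

/-- The arguments of an entry, and the controlled permutations of the calls that are merged in it,
are well-formed. -/
structure EntryShape (n next : ℕ) {N : ℕ} {ar : Fin N → ℕ} (e : Entry ar) : Prop where
  good : Good n e.args
  merged : ∀ m ∈ e.merged, m.1 < next ∧ ∃ args : Fin (ar e.proc) → List ℕ,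
    Good n args ∧ sizes args = sizes e.args ∧ m.2 = allWires args

theorem EntryShape.mono {n a b : ℕ} (h : a ≤ b) {N : ℕ} {ar : Fin N → ℕ} {e : Entry ar}
    (he : EntryShape n a e) : EntryShape n b e :=
  ⟨he.good, fun m hm => ⟨(he.merged m hm).1.trans_le h, (he.merged m hm).2⟩⟩

/-- A dictionary with well-formed entries and distinct keys. -/
structure DictShape (n : ℕ) {N : ℕ} {ar : Fin N → ℕ} (s : CState ar) : Prop where
  entry : ∀ e ∈ s.dict, EntryShape n s.next e
  keys : (s.dict.map Entry.key).Nodup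

theorem DictShape.mono {n : ℕ} {N : ℕ} {ar : Fin N → ℕ} {s : CState ar} (h : DictShape n s)
    {next : ℕ} (hle : s.next ≤ next) {D : List (Entry ar)} (hD : D.Sublist s.dict) :
    DictShape n ⟨next, D⟩ :=
  ⟨fun e he => (h.entry e (hD.subset he)).mono hle, h.keys.sublist (hD.map _)⟩

/-- The number of merged calls. -/
def merges {N : ℕ} {ar : Fin N → ℕ} (D : List (Entry ar)) : ℕ :=
  (D.map fun e => e.merged.length).sum

theorem merges_append {N : ℕ} {ar : Fin N → ℕ} (D D' : List (Entry ar)) :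
    merges (D ++ D') = merges D + merges D' := by simp [merges]

theorem merges_perm {N : ℕ} {ar : Fin N → ℕ} {D D' : List (Entry ar)} (h : D.Perm D') :
    merges D = merges D' := (h.map _).sum_eq

/-- The cost of the compilation of a statement. -/
structure StmtCost (n : ℕ) {N : ℕ} {ar : Fin N → ℕ} (s : CState ar) (out : Output ar) (k w : ℕ) :
    Prop where
  le : s.next ≤ out.state.next
  anc : out.state.next ≤ s.next + k * n
  gates : ∃ a b, a + b ≤ k ∧ Cost n out.pre a ∧ Cost n out.post b
  dict : DictShape n out.state
  weight : merges out.state.dict ≤ merges s.dict + w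

/-- The cost of the compilation of a call. -/
structure CallCost (n next : ℕ) (r : List Gate × ℕ) (k : ℕ) : Prop where
  le : next ≤ r.2
  anc : r.2 ≤ next + k * n
  gates : Cost n r.1 k

theorem CallCost.mono {n next k k' : ℕ} {r : List Gate × ℕ} (h : CallCost n next r k)
    (hk : k ≤ k') : CallCost n next r k' :=
  ⟨h.le, h.anc.trans (Nat.add_le_add_left (Nat.mul_le_mul_right _ hk) _), h.gates.mono hk⟩

theorem StmtCost.mono {n : ℕ} {N : ℕ} {ar : Fin N → ℕ} {s : CState ar} {out : Output ar}
    {k k' w w' : ℕ} (h : StmtCost n s out k w) (hk : k ≤ k') (hw : w ≤ w') :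
    StmtCost n s out k' w' := by
  obtain ⟨a, b, hab, ha, hb⟩ := h.gates
  exact ⟨h.le, h.anc.trans (Nat.add_le_add_left (Nat.mul_le_mul_right _ hk) _),
    ⟨a, b, hab.trans hk, ha, hb⟩, h.dict, h.weight.trans (by omega)⟩

theorem CallCost.stmtCost {n : ℕ} {N : ℕ} {ar : Fin N → ℕ} {s : CState ar} (hd : DictShape n s)
    {r : List Gate × ℕ} {k : ℕ} (h : CallCost n s.next r k) :
    StmtCost n s ⟨r.1, [], ⟨r.2, s.dict⟩⟩ k 0 :=
  ⟨h.le, h.anc, ⟨k, 0, le_rfl, h.gates, cost_nil _ _⟩, hd.mono h.le (List.Sublist.refl _), le_rfl⟩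

theorem Entry.serves_of_find? {N : ℕ} {ar : Fin N → ℕ} {D : List (Entry ar)} {p : Fin N}
    {l : List ℕ} (h : D.find? (fun e => e.serves p l) = none) : (p, l) ∉ D.map Entry.key := by
  intro hm
  obtain ⟨e, he, hk⟩ := List.mem_map.mp hm
  exact absurd ((Entry.serves_iff e p l).mpr hk) (by simpa using List.find?_eq_none.mp h e he)

/-- Keys are distinct, so at most one entry receives the call. -/
theorem merges_update_le {N : ℕ} {ar : Fin N → ℕ} {D : List (Entry ar)}
    (hD : (D.map Entry.key).Nodup) (p : Fin N) (l : List ℕ) (m : ℕ × List ℕ) :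
    merges (D.map fun e => if e.serves p l then { e with merged := e.merged ++ [m] } else e) ≤
      merges D + 1 := by
  induction D with
  | nil => simp [merges]
  | cons e D ih =>
    rw [List.map_cons, List.nodup_cons] at hD
    by_cases he : e.serves p l = true
    · have hid : D.map (fun e => if e.serves p l then { e with merged := e.merged ++ [m] } else e) =
          D := by
        conv_rhs => rw [← List.map_id D]
        refine List.map_congr_left fun e' he' => ?_
        rw [if_neg, id]
        intro h
        rw [Entry.serves_iff] at h he
        exact hD.1 (he ▸ h ▸ List.mem_map_of_mem he')
      rw [List.map_cons, hid, if_pos he]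
      simp only [merges, List.map_cons, List.sum_cons, List.length_append, List.length_singleton]
      omega
    · have := ih hD.2
      rw [List.map_cons, if_neg he]
      simp only [merges, List.map_cons, List.sum_cons] at this ⊢
      omega

/-- Merging emits two multiply controlled NOTs of at most `2 * cs.length + 1` gates each, once in
`pre` and once reversed in `post`, whence the bound. -/
theorem stmtCost_anchorMerge {n : ℕ} (hn : 2 ≤ n) {N : ℕ} {ar : Fin N → ℕ} {p : Fin N}
    {args : Fin (ar p) → List ℕ} (hargs : Good n args) (cs : List (ℕ × Fin 2)) {s : CState ar}
    (hd : DictShape n s) :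
    StmtCost n s (anchorMerge p args cs s) (8 * cs.length + 4) 1 := by
  have hmul : ∀ k, k ≤ k * n := fun k => Nat.le_mul_of_pos_right _ (by omega)
  unfold anchorMerge
  split
  · rename_i hf
    obtain ⟨l1, l2⟩ := length_multiCtl .not s.next cs (s.next + 1)
    have l3 := multiCtl_le .not s.next cs (s.next + 1)
    have hk := hmul (8 * cs.length + 4)
    refine ⟨by dsimp only; omega, by dsimp only; omega, ⟨2 * cs.length + 1, 2 * cs.length + 1,
      by omega, cost_of_length hn l1, (cost_of_length hn l1).reverse⟩, ⟨?_, ?_⟩, ?_⟩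
    · intro e he
      rcases List.mem_append.mp he with he | he
      · exact (hd.entry e he).mono (by dsimp only; omega)
      · obtain rfl := List.mem_singleton.mp he
        exact ⟨hargs, by simp⟩
    · rw [List.map_append, List.nodup_append]
      refine ⟨hd.keys, by simp, ?_⟩
      rintro k hk k' hk' rfl
      rw [List.map_singleton, List.mem_singleton] at hk'
      have e : k = (p, sizes args) := hk'
      exact Entry.serves_of_find? hf (e ▸ hk)
    · simp [merges]
  · rename_i e hf
    obtain ⟨l1, l2⟩ := length_multiCtl .not e.anchor cs (s.next + 1)
    have l3 := multiCtl_le .not e.anchor cs (s.next + 1)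
    obtain ⟨l4, l5⟩ := length_multiCtl .not s.next cs (multiCtl .not e.anchor cs (s.next + 1)).2
    have l6 := multiCtl_le .not s.next cs (multiCtl .not e.anchor cs (s.next + 1)).2
    have hk := hmul (8 * cs.length + 4)
    have hc : Cost n ((multiCtl .not e.anchor cs (s.next + 1)).1 ++
        (multiCtl .not s.next cs (multiCtl .not e.anchor cs (s.next + 1)).2).1)
        (4 * cs.length + 2) := cost_of_length hn (by rw [List.length_append]; omega)
    refine ⟨by dsimp only; omega, by dsimp only; omega, ⟨_, _, by omega, hc, hc.reverse⟩,
      ⟨?_, ?_⟩, merges_update_le hd.keys _ _ _⟩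
    · intro e₁ he₁
      obtain ⟨e', he', rfl⟩ := List.mem_map.mp he₁
      have hle : s.next ≤
          (multiCtl .not s.next cs (multiCtl .not e.anchor cs (s.next + 1)).2).2 := by
        omega
      split_ifs with hs
      · rw [Entry.serves_iff] at hs
        obtain ⟨q, args', anchor, merged⟩ := e'
        simp only [Entry.key, Prod.mk.injEq] at hs
        obtain ⟨rfl, hs⟩ := hs
        have h := (hd.entry _ he').mono hle
        refine ⟨h.good, fun m hm => ?_⟩
        rcases List.mem_append.mp hm with hm | hm
        · exact h.merged m hm
        · obtain rfl := List.mem_singleton.mp hm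
          exact ⟨by dsimp only; omega, args, hargs, hs.symm, rfl⟩
      · exact (hd.entry e' he').mono hle
    · rw [List.map_map]
      have : (Entry.key ∘ fun e' : Entry ar => if e'.serves p (sizes args) then
          { e' with merged := e'.merged ++ [(s.next, allWires args)] } else e') = Entry.key := by
        funext e'
        simp only [Function.comp_apply]
        split_ifs <;> rfl
      rw [this]
      exact hd.keys

/-- The number of nodes of a statement. -/
def Stmt.size {N : ℕ} {ar : Fin N → ℕ} {V : Type} : Stmt ar V → ℕ
  | .skip => 1
  | .app _ _ => 1
  | .seq S₀ S₁ => S₀.size + S₁.size + 1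
  | .ite _ S₁ S₀ => S₁.size + S₀.size + 1
  | .qcase _ S₀ S₁ => S₀.size + S₁.size + 1
  | .call _ _ => 1

/-- Every node costs at most `B`, and the two branches of a `qcase` may be executed one after the
other because a statement has constant size. Each `qcase` adds one control, so `cs.length + S.size`
does not increase on the way down. Each node adds at most one merged call. -/
theorem stmtCost_compile {n : ℕ} (hn : 2 ≤ n) {N : ℕ} {ar : Fin N → ℕ}
    {cc : (p : Fin N) → (Fin (ar p) → List ℕ) → List (ℕ × Fin 2) → ℕ → List Gate × ℕ}
    {R : Fin N → Prop} [DecidablePred R] {B ℓ : ℕ} (hB : 8 * ℓ + 4 ≤ B)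
    (hcc : ∀ p args cs next, Good n args → cs.length ≤ ℓ → n ≤ next →
      CallCost n next (cc p args cs next) B)
    {V : Type} {f : V → List ℕ} (hf : Good n f) {S : Stmt ar V} (hS : S.NoCloning)
    {cs : List (ℕ × Fin 2)} (hcs : cs.length + S.size ≤ ℓ + 1) {s : CState ar} (hs : n ≤ s.next)
    (hd : DictShape n s) :
    StmtCost n s (S.compile cc R f cs s) (S.size * B) S.size := by
  have hmul : ∀ k, k ≤ k * n := fun k => Nat.le_mul_of_pos_right _ (by omega)
  have hskip : ∀ {s : CState ar} {k w : ℕ}, DictShape n s → StmtCost n s ⟨[], [], s⟩ k w :=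
    fun hd => ⟨le_rfl, by simp, ⟨0, 0, by omega, cost_nil _ _, cost_nil _ _⟩, hd, by simp⟩
  induction S generalizing cs s with
  | skip => exact hskip hd
  | app q U =>
    simp only [Stmt.compile, Stmt.size, one_mul] at hcs ⊢
    obtain ⟨l1, l2⟩ := length_multiCtl (U.eval f) (q.eval f) cs s.next
    have h : CallCost n s.next (multiCtl (U.eval f) (q.eval f) cs s.next) B :=
      ⟨multiCtl_le _ _ _ _, by have := hmul B; omega, cost_of_length hn (by omega)⟩
    exact (h.stmtCost hd).mono le_rfl (by omega)
  | seq S₀ S₁ ih₀ ih₁ =>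
    simp only [Stmt.size] at hcs ⊢
    have h₀ := ih₀ hS.1 (cs := cs) (by omega) hs hd
    have h₁ := ih₁ hS.2 (cs := cs) (by omega) (hs.trans h₀.le) h₀.dict
    obtain ⟨a₀, b₀, e₀, c₀, d₀⟩ := h₀.gates
    obtain ⟨a₁, b₁, e₁, c₁, d₁⟩ := h₁.gates
    have hk : S₀.size * B + S₁.size * B ≤ (S₀.size + S₁.size + 1) * B := by
      rw [← add_mul]; exact Nat.mul_le_mul_right _ (by omega)
    have hanc : (S₁.compile cc R f cs (S₀.compile cc R f cs s).state).state.next ≤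
        s.next + (S₀.size + S₁.size + 1) * B * n := by
      have := Nat.mul_le_mul_right n hk
      rw [add_mul] at this
      have := h₀.anc; have := h₁.anc
      omega
    have hwt := h₀.weight
    have hwt' := h₁.weight
    simp only [Stmt.compile]
    split_ifs
    · exact ⟨h₀.le.trans h₁.le, hanc, ⟨_, _, by omega, (c₀.append d₀).append c₁, d₁⟩, h₁.dict,
        by dsimp only; omega⟩
    · exact ⟨h₀.le.trans h₁.le, hanc, ⟨_, _, by omega, c₀, (d₀.append c₁).append d₁⟩, h₁.dict,
        by dsimp only; omega⟩
  | ite b S₁ S₀ ih₁ ih₀ =>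
    simp only [Stmt.size, Stmt.compile] at hcs ⊢
    split_ifs
    · exact (ih₁ hS.1 (cs := cs) (by omega) hs hd).mono (Nat.mul_le_mul_right _ (by omega)) (by omega)
    · exact (ih₀ hS.2 (cs := cs) (by omega) hs hd).mono (Nat.mul_le_mul_right _ (by omega)) (by omega)
  | qcase q S₀ S₁ ih₀ ih₁ =>
    simp only [Stmt.size] at hcs ⊢
    have h₀ := ih₀ hS.1 (cs := cs ++ [(q.eval f, 0)])
      (by rw [List.length_append, List.length_singleton]; omega) hs hd
    have h₁ := ih₁ hS.2 (cs := cs ++ [(q.eval f, 1)])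
      (by rw [List.length_append, List.length_singleton]; omega) (hs.trans h₀.le) h₀.dict
    obtain ⟨a₀, b₀, e₀, c₀, d₀⟩ := h₀.gates
    obtain ⟨a₁, b₁, e₁, c₁, d₁⟩ := h₁.gates
    have hk : S₀.size * B + S₁.size * B ≤ (S₀.size + S₁.size + 1) * B := by
      rw [← add_mul]; exact Nat.mul_le_mul_right _ (by omega)
    have hanc := Nat.mul_le_mul_right n hk
    rw [add_mul] at hanc
    have hanc₀ := h₀.anc
    have hanc₁ := h₁.anc
    have hwt := h₀.weight
    have hwt' := h₁.weight
    exact ⟨h₀.le.trans h₁.le, by simp only [Stmt.compile]; omega,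
      ⟨_, _, by omega, c₀.append c₁, d₁.append d₀⟩, h₁.dict, by simp only [Stmt.compile]; omega⟩
  | call p args =>
    simp only [Stmt.size, Stmt.compile, one_mul] at hcs ⊢
    split_ifs
    · exact hskip hd
    · exact (stmtCost_anchorMerge hn (hf.eval hS) cs hd).mono (by omega) le_rfl
    · exact ((hcc p _ cs s.next (hf.eval hS) (by omega) hs).stmtCost hd).mono le_rfl (by omega)

theorem cost_ctlPerms {n : ℕ} (hn : 2 ≤ n) {N : ℕ} {ar : Fin N → ℕ} {p : Fin N}
    {args : Fin (ar p) → List ℕ} (hargs : Good n args) {ms : List (ℕ × List ℕ)} {next : ℕ}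
    (hnext : n ≤ next) (hms : ∀ m ∈ ms, m.1 < next ∧ ∃ args' : Fin (ar p) → List ℕ,
      Good n args' ∧ sizes args' = sizes args ∧ m.2 = allWires args') :
    CallCost n next (ctlPerms (allWires args) ms next) (10 * ms.length) := by
  induction ms generalizing next with
  | nil => exact ⟨le_rfl, by simp [ctlPerms], cost_nil _ _⟩
  | cons m ms ih =>
    obtain ⟨hm, args', hg, hsz, hsrc⟩ := hms m (by simp)
    have hK : m.2.length ≤ n := by
      rw [hsrc, ← List.toFinset_card_of_nodup hg.nodup_allWires]
      refine (Finset.card_le_card (t := Finset.range n) fun w hw => ?_).trans_eq (by simp)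
      exact Finset.mem_range.mpr (hg.lt_allWires w (List.mem_toFinset.mp hw))
    have h := cost_ctlPerm hn hm (src := m.2) (dst := allWires args)
      (by rw [hsrc]; exact hg.nodup_allWires) hargs.nodup_allWires
      (by rw [hsrc]; exact fun w hw => (hg.lt_allWires w hw).trans_le hnext)
      (fun w hw => (hargs.lt_allWires w hw).trans_le hnext)
      (by rw [hsrc, length_allWires, length_allWires, tot_eq_of_sizes_eq hsz]) hK
    have hle : next ≤ (ctlPerm m.1 m.2 (allWires args) next).2 := by rw [ctlPerm_snd]; omega
    have h' := ih (hnext.trans hle) fun m hm => ⟨(hms m (by simp [hm])).1.trans_le hle,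
      (hms m (by simp [hm])).2⟩
    refine ⟨hle.trans h'.le, ?_, ?_⟩
    · have := h'.anc
      rw [ctlPerm_snd] at this
      simp only [ctlPerms, List.length_cons]
      rw [ctlPerm_snd, show 10 * (ms.length + 1) * n = 10 * ms.length * n + 10 * n by ring]
      omega
    · simp only [ctlPerms, List.length_cons]
      exact (h.append h'.gates).mono (by omega)

/-- A merged call costs `10` for its permutation and `10` for the inverse; a body costs at most `σ *
B` and creates at most `σ` merged calls. -/
theorem stmtCost_compileEntries {n : ℕ} (hn : 2 ≤ n) (hclone : P.NoCloning)
    {cc : (p : Fin P.nprocs) → (Fin (P.arity p) → List ℕ) → List (ℕ × Fin 2) → ℕ → List Gate × ℕ}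
    {R : Fin P.nprocs → Prop} [DecidablePred R] {B σ : ℕ} (hB : 8 * (σ + 1) + 4 ≤ B)
    (hσ : ∀ p, (P.body p).size ≤ σ)
    (hcc : ∀ p args cs next, Good n args → cs.length ≤ σ + 1 → n ≤ next →
      CallCost n next (cc p args cs next) B)
    {es : List (Entry P.arity)} {s : CState P.arity} (hs : n ≤ s.next)
    (hes : ∀ e ∈ es, EntryShape n s.next e) (hd : DictShape n s) :
    StmtCost n s (P.compileEntries cc R es s) (20 * merges es + es.length * (σ * B))
      (es.length * σ) := by
  induction es generalizing s with
  | nil => exact ⟨le_rfl, by simp [Program.compileEntries],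
      ⟨0, 0, by omega, cost_nil _ _, cost_nil _ _⟩, hd, by simp [Program.compileEntries]⟩
  | cons e es ih =>
    have he := hes e (by simp)
    have hπ := cost_ctlPerms hn he.good hs he.merged
    have h := (stmtCost_compile (R := R) hn (ℓ := σ + 1) hB hcc he.good (hclone.1 e.proc)
      (cs := [(e.anchor, 1)]) (by have := hσ e.proc; simp; omega)
      (s := ⟨(ctlPerms (allWires e.args) e.merged s.next).2, s.dict⟩) (hs.trans hπ.le)
      (hd.mono hπ.le (List.Sublist.refl _))).mono (Nat.mul_le_mul_right B (hσ e.proc)) (hσ e.proc)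
    have hle := hπ.le.trans h.le
    have h' := ih (hs.trans hle) (fun e he => (hes e (by simp [he])).mono hle) h.dict
    obtain ⟨a₀, b₀, e₀, c₀, d₀⟩ := h.gates
    obtain ⟨a₁, b₁, e₁, c₁, d₁⟩ := h'.gates
    have hm : merges (e :: es) = e.merged.length + merges es := by simp [merges]
    have hk : 20 * e.merged.length + σ * B + (20 * merges es + es.length * (σ * B)) =
        20 * merges (e :: es) + (e :: es).length * (σ * B) := by
      rw [hm, List.length_cons]; ring
    refine ⟨hle.trans h'.le, ?_, ⟨10 * e.merged.length + a₀ + a₁, b₁ + b₀ + 10 * e.merged.length,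
      by omega, (hπ.gates.append c₀).append c₁, (d₁.append d₀).append hπ.gates.reverse⟩,
      h'.dict, ?_⟩
    · rw [← hk]
      have i1 := hπ.anc; have i2 := h.anc; have i3 := h'.anc
      dsimp only at i2
      simp only [add_mul] at i3 ⊢
      simp only [Program.compileEntries]
      have : 10 * e.merged.length * n ≤ 20 * e.merged.length * n :=
        Nat.mul_le_mul_right _ (by omega)
      omega
    · have i2 := h.weight; have i3 := h'.weight
      simp only [Program.compileEntries, List.length_cons, add_mul, one_mul]
      dsimp only at i2
      omega

/-- The bound is a potential: `20` for each merged call present, and `20 * σ + σ * B` for each key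
of size at most `t`. An entry of size `t + 1` uses up a key of that size, which pays for its body
and, in advance, for the permutations of the calls that the body merges. Merged calls of compiled
entries are paid by their own share. -/
theorem callCost_compileDict {n : ℕ} (hn : 2 ≤ n) (hclone : P.NoCloning)
    {cc : (p : Fin P.nprocs) → (Fin (P.arity p) → List ℕ) → List (ℕ × Fin 2) → ℕ → List Gate × ℕ}
    {R : Fin P.nprocs → Prop} [DecidablePred R] {B σ : ℕ} (hB : 8 * (σ + 1) + 4 ≤ B)
    (hσ : ∀ p, (P.body p).size ≤ σ)
    (hcc : ∀ p args cs next, Good n args → cs.length ≤ σ + 1 → n ≤ next →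
      CallCost n next (cc p args cs next) B)
    {Q : (p : Fin P.nprocs) → (Fin (P.arity p) → List ℕ) → Prop}
    (hQ : ∀ p args, Q p args → ∀ c ∈ (P.body p).calls, R c.1 → (∀ j, (c.2 j).eval args ≠ []) →
      Q c.1 fun j => (c.2 j).eval args)
    {K : Finset (Fin P.nprocs × List ℕ)} (hK : ∀ p args, Q p args → (p, sizes args) ∈ K)
    (t : ℕ) {s : CState P.arity} (hs : n ≤ s.next) (hd : DictShape n s)
    (hsQ : ∀ e ∈ s.dict, Q e.proc e.args) :
    CallCost n s.next (P.compileDict cc R t s)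
      (20 * merges s.dict + (K.filter fun k => k.2.sum ≤ t).card * (20 * σ + σ * B)) := by
  induction t generalizing s with
  | zero => exact ⟨le_rfl, by simp [Program.compileDict], cost_nil _ _⟩
  | succ t ih =>
    have hperm := filter_perm s t
    simp only [Program.compileDict]
    set es := s.dict.filter fun e => (allWires e.args).length = t + 1 with hes
    set rest := s.dict.filter fun e => (allWires e.args).length ≠ t + 1 with hrest
    have hmem : ∀ e ∈ es, e ∈ s.dict := fun e he => (List.mem_filter.mp he).1
    have hmr : ∀ e ∈ rest, e ∈ s.dict := fun e he => (List.mem_filter.mp he).1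
    have h := stmtCost_compileEntries (R := R) hn hclone hB hσ hcc (s := ⟨s.next, rest⟩) hs
      (fun e he => hd.entry e (hmem e he)) (hd.mono le_rfl List.filter_sublist)
    have h' := ih (hs.trans h.le) h.dict (compileEntries_dict_forall
      (fun e he => hsQ e (hmr e he)) fun e he => hQ _ _ (hsQ e (hmem e he)))
    have hcard : es.length ≤ (K.filter fun k => k.2.sum = t + 1).card := by
      have hnd : (es.map Entry.key).Nodup := hd.keys.sublist (List.filter_sublist.map _)
      rw [← List.length_map (as := es) Entry.key, ← List.toFinset_card_of_nodup hnd]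
      refine Finset.card_le_card fun k hk => ?_
      obtain ⟨e, he, rfl⟩ := List.mem_map.mp (List.mem_toFinset.mp hk)
      refine Finset.mem_filter.mpr ⟨hK _ _ (hsQ e (hmem e he)), ?_⟩
      have := (List.mem_filter.mp he).2
      rw [length_allWires, decide_eq_true_eq] at this
      rw [← this, Entry.key, sizes, List.sum_ofFn, tot]
    have hsplit : (K.filter fun k => k.2.sum ≤ t + 1).card =
        (K.filter fun k => k.2.sum ≤ t).card + (K.filter fun k => k.2.sum = t + 1).card := by
      rw [← Finset.card_union_of_disjoint]
      · congr 1
        ext k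
        simp only [Finset.mem_filter, Finset.mem_union]
        constructor
        · rintro ⟨h1, h2⟩
          rcases Nat.le_succ_iff.mp h2 with h3 | h3
          exacts [Or.inl ⟨h1, h3⟩, Or.inr ⟨h1, h3⟩]
        · rintro (⟨h1, h2⟩ | ⟨h1, h2⟩)
          exacts [⟨h1, by omega⟩, ⟨h1, by omega⟩]
      · rw [Finset.disjoint_left]
        intro k hk hk'
        have := (Finset.mem_filter.mp hk).2
        have := (Finset.mem_filter.mp hk').2
        omega
    obtain ⟨a, b, e, ca, cb⟩ := h.gates
    have hm : merges es + merges rest = merges s.dict := by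
      rw [← merges_append]; exact merges_perm hperm
    have hw := h.weight
    dsimp only at hw
    set c := (K.filter fun k => k.2.sum ≤ t).card
    set d := (K.filter fun k => k.2.sum = t + 1).card
    have htotal : 20 * merges es + es.length * (σ * B) + (20 * merges
        (P.compileEntries cc R es ⟨s.next, rest⟩).state.dict + c * (20 * σ + σ * B)) ≤
        20 * merges s.dict + (K.filter fun k => k.2.sum ≤ t + 1).card * (20 * σ + σ * B) := by
      rw [hsplit]
      have h1 := Nat.mul_le_mul_right (20 * σ + σ * B) hcard
      have h2 : es.length * (20 * σ + σ * B) = 20 * (es.length * σ) + es.length * (σ * B) := by ring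
      rw [add_mul]
      omega
    refine ⟨h.le.trans h'.le, ?_, ?_⟩
    · refine le_trans ?_ (Nat.add_le_add_left (Nat.mul_le_mul_right n htotal) _)
      rw [add_mul]
      have i1 := h.anc; have i2 := h'.anc
      dsimp only at i1
      omega
    · exact ((ca.append h'.gates).append cb).mono (by omega)

end

end PLP

namespace PLP

/-! ## The number of keys -/

/-- The value `v` is close to the quotient of `N` by a power of two. -/
def SizeAt (T N v : ℕ) : Prop := ∃ a ≤ T, N / 2 ^ a ≤ v + T ∧ v ≤ N / 2 ^ a + 1

theorem SizeAt.mono {T T' N v : ℕ} (h : SizeAt T N v) (hT : T ≤ T') : SizeAt T' N v := by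
  obtain ⟨a, h1, h2, h3⟩ := h
  exact ⟨a, h1.trans hT, by omega, h3⟩

theorem sizeAt_self (T N : ℕ) : SizeAt T N N := ⟨0, by omega, by simp, by simp⟩

/-- The number of operations in a list expression. -/
def Exp.ops {V : Type} : Exp V .list → ℕ
  | .var _ => 0
  | .remove l _ => l.ops + 1
  | .fstHalf l => l.ops + 1
  | .sndHalf l => l.ops + 1

/-- Removing an element costs one unit of the lower slack; halving raises the exponent by one. The
upper slack stays `1`, because `⌈(q + 1) / 2⌉ ≤ ⌊q / 2⌋ + 1`: rounding up does not accumulate. -/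
theorem Exp.sizeAt_eval {V : Type} (f : V → List ℕ) {T N : ℕ} :
    (l : Exp V .list) → SizeAt T N (f l.base).length → (l.eval f : List ℕ) ≠ [] →
      SizeAt (T + l.ops) N (l.eval f : List ℕ).length
  | .var q, h, _ => by simpa [Exp.eval, Exp.ops, Exp.base] using h
  | .remove l i, h, hne => by
      simp only [Exp.eval, Exp.base, Exp.ops] at *
      split_ifs at hne ⊢ with hk
      · have hl : (l.eval f : List ℕ) ≠ [] := by
          intro h0; rw [h0] at hk; simp at hk; omega
        obtain ⟨a, h1, h2, h3⟩ := l.sizeAt_eval f h hl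
        have hlen := List.length_pos_of_ne_nil hl
        rw [List.length_eraseIdx_of_lt (by omega)]
        exact ⟨a, by omega, by omega, by omega⟩
      · exact absurd rfl hne
  | .fstHalf l, h, hne => by
      simp only [Exp.eval, Exp.base, Exp.ops] at *
      split_ifs at hne ⊢ with hk
      · have hl : (l.eval f : List ℕ) ≠ [] := by
          intro h0; rw [h0] at hk; simp at hk
        obtain ⟨a, h1, h2, h3⟩ := l.sizeAt_eval f h hl
        rw [List.length_take]
        refine ⟨a + 1, by omega, ?_, ?_⟩ <;>
        · rw [pow_succ, ← Nat.div_div_eq_div_mul]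
          omega
      · exact absurd rfl hne
  | .sndHalf l, h, hne => by
      simp only [Exp.eval, Exp.base, Exp.ops] at *
      split_ifs at hne ⊢ with hk
      · have hl : (l.eval f : List ℕ) ≠ [] := by
          intro h0; rw [h0] at hk; simp at hk
        obtain ⟨a, h1, h2, h3⟩ := l.sizeAt_eval f h hl
        rw [List.length_drop]
        refine ⟨a + 1, by omega, ?_, ?_⟩ <;>
        · rw [pow_succ, ← Nat.div_div_eq_div_mul]
          omega
      · exact absurd rfl hne

theorem Exp.length_le_of_halves {V : Type} (f : V → List ℕ) :
    (l : Exp V .list) → l.Halves → (l.eval f : List ℕ) ≠ [] →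
      2 ≤ (f l.base).length ∧
        (l.eval f : List ℕ).length ≤ ((f l.base).length + 1) / 2
  | .var _, h, _ => by simp only [Exp.Halves] at h
  | .remove l i, h, hne => by
      simp only [Exp.eval, Exp.base, Exp.Halves] at *
      split_ifs at hne ⊢ with hk
      · have hl : (l.eval f : List ℕ) ≠ [] := by
          intro h0; rw [h0] at hk; simp at hk; omega
        obtain ⟨h1, h2⟩ := l.length_le_of_halves f h hl
        exact ⟨h1, (List.length_eraseIdx_le _ _).trans h2⟩
      · exact absurd rfl hne
  | .fstHalf l, _, hne => by
      simp only [Exp.eval, Exp.base] at *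
      have := (l.eval_sublist f).length_le
      split_ifs at hne ⊢ with hk
      · rw [List.length_take]; omega
      · exact absurd rfl hne
  | .sndHalf l, _, hne => by
      simp only [Exp.eval, Exp.base] at *
      have := (l.eval_sublist f).length_le
      split_ifs at hne ⊢ with hk
      · rw [List.length_drop]; omega
      · exact absurd rfl hne

/-- The total number of halvings that the arguments of a call allow for. -/
def halvings {m : ℕ} (args : Fin m → List ℕ) : ℕ := ∑ j, Nat.clog 2 (args j).length

/-- For lengths at least `2`, the rounded-up logarithm drops by exactly one under `v ↦ ⌈v / 2⌉`. One
argument is halved and the others do not grow. The sum of logarithms is used because a call need not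
shorten its other arguments. -/
theorem halvings_eval_lt {m k : ℕ} {f : Fin k → List ℕ} {args : Fin m → Exp (Fin k) .list}
    (h : Function.Injective fun j => (args j).base) (hh : ∃ j, (args j).Halves)
    (hne : ∀ j, ((args j).eval f : List ℕ) ≠ []) :
    halvings (fun j => (args j).eval f) + 1 ≤ halvings f := by
  obtain ⟨j, hj⟩ := hh
  have h1 : halvings (fun j => (args j).eval f) < ∑ j, Nat.clog 2 (f (args j).base).length := by
    refine Finset.sum_lt_sum
      (fun j _ => Nat.clog_mono_right 2 ((args j).eval_sublist f).length_le) ⟨j, Finset.mem_univ _, ?_⟩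
    obtain ⟨h2, h3⟩ := (args j).length_le_of_halves f hj (hne j)
    rw [Nat.clog_of_two_le (by omega) h2]
    refine Nat.lt_succ_of_le (Nat.clog_mono_right 2 ?_)
    simpa using h3
  have := Finset.sum_map Finset.univ ⟨fun j => (args j).base, h⟩ fun v => Nat.clog 2 (f v).length
  refine h1.trans_le ?_
  refine this.symm.le.trans (Finset.sum_le_sum_of_subset (Finset.subset_univ _))

theorem Good.length_le {n : ℕ} {V : Type} {f : V → List ℕ} (h : Good n f) (v : V) :
    (f v).length ≤ n := by
  rw [← List.toFinset_card_of_nodup (h.nodup v)]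
  refine (Finset.card_le_card (t := Finset.range n) fun w hw => ?_).trans_eq (by simp)
  exact Finset.mem_range.mpr (h.lt v w (List.mem_toFinset.mp hw))

theorem halvings_le {n m : ℕ} {args : Fin m → List ℕ} (h : Good n args) :
    halvings args ≤ m * (Nat.log 2 n + 1) := by
  have h1 : ∀ j ∈ (Finset.univ : Finset (Fin m)),
      Nat.clog 2 (args j).length ≤ Nat.log 2 n + 1 := fun j _ =>
    Nat.clog_le_of_le_pow ((h.length_le j).trans (Nat.lt_pow_succ_log_self (by omega) n).le)
  exact (Finset.sum_le_card_nsmul _ _ _ h1).trans_eq (by simp)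

/-- The sizes that are close to a quotient of one of the numbers `N j` by a power of two. -/
def sizeSet {m : ℕ} (T : ℕ) (N : Fin m → ℕ) : Finset ℕ :=
  Finset.univ.biUnion fun j => (Finset.range (T + 1)).biUnion fun a =>
    Finset.Icc (N j / 2 ^ a - T) (N j / 2 ^ a + 1)

theorem mem_sizeSet {m T v : ℕ} {N : Fin m → ℕ} {j : Fin m} (h : SizeAt T (N j) v) :
    v ∈ sizeSet T N := by
  obtain ⟨a, h1, h2, h3⟩ := h
  simp only [sizeSet, Finset.mem_biUnion, Finset.mem_univ, true_and, Finset.mem_range,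
    Finset.mem_Icc]
  exact ⟨j, a, by omega, by omega, h3⟩

/-- For each root size there are `T + 1` exponents, and each exponent leaves an interval of at most
`T + 2` values. -/
theorem card_sizeSet_le {m : ℕ} (T : ℕ) (N : Fin m → ℕ) :
    (sizeSet T N).card ≤ m * ((T + 1) * (T + 2)) := by
  refine (Finset.card_biUnion_le_card_mul _ _ ((T + 1) * (T + 2)) fun j _ => ?_).trans_eq (by simp)
  refine (Finset.card_biUnion_le_card_mul _ _ (T + 2) fun a _ => ?_).trans_eq (by simp)
  rw [Nat.card_Icc]
  omega

section

variable {P : Program}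

/-- The calls reached from a call with the arguments `root` have arguments whose sizes are close to
quotients of the sizes of `root` by powers of two. -/
def Reached {m : ℕ} (R : Fin P.nprocs → Prop) (h : ℕ) (root : Fin m → List ℕ) (p : Fin P.nprocs)
    (args : Fin (P.arity p) → List ℕ) : Prop :=
  R p ∧ ∃ k, k + halvings args ≤ halvings root ∧
    ∀ i, ∃ j, SizeAt (h * k) (root j).length (args i).length

/-- The witness `k` counts the recursive calls since the root. Each of them uses up a halving, so
`k` is bounded by the halvings of the root, and adds at most `h` operations to the slack. -/
theorem Reached.call (hclone : P.NoCloning) {R : Fin P.nprocs → Prop} [DecidablePred R]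
    (hR : RecClass P R) {h : ℕ}
    (hops : ∀ p, ∀ c ∈ (P.body p).calls, ∀ i, (c.2 i).ops ≤ h) {m : ℕ} {root : Fin m → List ℕ}
    {p : Fin P.nprocs} {args : Fin (P.arity p) → List ℕ} (hp : Reached R h root p args)
    {c : Σ q : Fin P.nprocs, Fin (P.arity q) → Exp (Fin (P.arity p)) .list}
    (hc : c ∈ (P.body p).calls) (hRc : R c.1) (hne : ∀ j, (c.2 j).eval args ≠ []) :
    Reached R h root c.1 fun j => (c.2 j).eval args := by
  obtain ⟨h1, k, h2, h3⟩ := hp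
  have := halvings_eval_lt ((hclone.1 p).of_mem_calls hc) (hR.halves p h1 c hc hRc) hne
  refine ⟨hRc, k + 1, by omega, fun i => ?_⟩
  obtain ⟨j, hj⟩ := h3 (c.2 i).base
  refine ⟨j, ((c.2 i).sizeAt_eval args hj (hne i)).mono ?_⟩
  rw [mul_add, mul_one]
  exact Nat.add_le_add_left (hops p c hc i) _

/-- The possible keys of the calls that are reached from a given call. -/
def keySet (P : Program) {m : ℕ} (T : ℕ) (N : Fin m → ℕ) : Finset (Fin P.nprocs × List ℕ) :=
  Finset.univ.biUnion fun p =>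
    (Fintype.piFinset fun _ : Fin (P.arity p) => sizeSet T N).image fun g => (p, List.ofFn g)

theorem Reached.mem_keySet {R : Fin P.nprocs → Prop} {h T : ℕ} {m : ℕ} {root : Fin m → List ℕ}
    (hT : h * halvings root ≤ T) {p : Fin P.nprocs} {args : Fin (P.arity p) → List ℕ}
    (hp : Reached R h root p args) :
    (p, sizes args) ∈ keySet P T fun j => (root j).length := by
  obtain ⟨-, k, h2, h3⟩ := hp
  simp only [keySet, Finset.mem_biUnion, Finset.mem_univ, true_and, Finset.mem_image,
    Fintype.mem_piFinset]
  refine ⟨p, fun i => (args i).length, fun i => ?_, rfl⟩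
  obtain ⟨j, hj⟩ := h3 i
  exact mem_sizeSet (hj.mono ((Nat.mul_le_mul_left h (by omega)).trans hT))

theorem card_keySet_le {A : ℕ} (hA : ∀ p, P.arity p ≤ A) {m T : ℕ} (hm : m ≤ A) (N : Fin m → ℕ) :
    (keySet P T N).card ≤ P.nprocs * (A * ((T + 1) * (T + 2)) + 1) ^ A := by
  refine (Finset.card_biUnion_le_card_mul _ _ ((A * ((T + 1) * (T + 2)) + 1) ^ A)
    fun p _ => ?_).trans_eq (by simp)
  refine Finset.card_image_le.trans ?_
  rw [Fintype.card_piFinset]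
  simp only [Finset.prod_const, Finset.card_univ, Fintype.card_fin]
  -- The summand `1` keeps the base positive, so that the exponent can be raised from the arity of
  -- `p` to `A`.
  refine (Nat.pow_le_pow_left ?_ _).trans (Nat.pow_le_pow_right (by omega) (hA p))
  exact (card_sizeSet_le T N).trans ((Nat.mul_le_mul_right _ hm).trans (Nat.le_succ _))

/-! ## Cost of the compilation of calls -/

/-- Functions bounded by polynomials. -/
def PolyBdd (f : ℕ → ℕ) : Prop := ∃ c k, ∀ L, 1 ≤ L → f L ≤ c * L ^ k

theorem polyBdd_const (a : ℕ) : PolyBdd fun _ => a := ⟨a, 0, by simp⟩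

theorem polyBdd_id : PolyBdd fun L => L := ⟨1, 1, by simp⟩

theorem PolyBdd.add {f g : ℕ → ℕ} (hf : PolyBdd f) (hg : PolyBdd g) :
    PolyBdd fun L => f L + g L := by
  obtain ⟨c, k, h⟩ := hf
  obtain ⟨c', k', h'⟩ := hg
  refine ⟨c + c', k + k', fun L hL => ?_⟩
  have h1 : L ^ k ≤ L ^ (k + k') := Nat.pow_le_pow_right hL (by omega)
  have h2 : L ^ k' ≤ L ^ (k + k') := Nat.pow_le_pow_right hL (by omega)
  rw [add_mul]
  exact Nat.add_le_add ((h L hL).trans (Nat.mul_le_mul_left _ h1))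
    ((h' L hL).trans (Nat.mul_le_mul_left _ h2))

theorem PolyBdd.mul {f g : ℕ → ℕ} (hf : PolyBdd f) (hg : PolyBdd g) :
    PolyBdd fun L => f L * g L := by
  obtain ⟨c, k, h⟩ := hf
  obtain ⟨c', k', h'⟩ := hg
  refine ⟨c * c', k + k', fun L hL => (Nat.mul_le_mul (h L hL) (h' L hL)).trans_eq ?_⟩
  rw [pow_add]; ring

theorem PolyBdd.pow {f : ℕ → ℕ} (hf : PolyBdd f) (m : ℕ) : PolyBdd fun L => f L ^ m := by
  induction m with
  | zero => simpa using polyBdd_const 1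
  | succ m ih => simpa only [pow_succ] using ih.mul hf

/-- For a fixed nesting depth the number of controls is bounded by a constant, and each level
applies fixed polynomial operations to the bound of the level below; hence the result is still a
polynomial in `log n`. -/
theorem callCost_compileCall (hclone : P.NoCloning) (hplp : P.IsPolyLog) {σ A h : ℕ}
    (hσ : ∀ p, (P.body p).size ≤ σ) (hA : ∀ p, P.arity p ≤ A)
    (hops : ∀ p, ∀ c ∈ (P.body p).calls, ∀ i, (c.2 i).ops ≤ h) (d ℓ : ℕ) :
    ∃ f, PolyBdd f ∧ ∀ n, 2 ≤ n → ∀ p args cs next, Good n args → cs.length ≤ ℓ → n ≤ next →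
      CallCost n next (P.compileCall d p args cs next) (f (Nat.log 2 n)) := by
  induction d generalizing ℓ with
  | zero => exact ⟨_, polyBdd_const 0, fun n _ p args cs next _ _ _ =>
      ⟨le_rfl, by simp [Program.compileCall], cost_nil _ _⟩⟩
  | succ d ih =>
    -- The bound on controls covers both cases: a body compiled in place adds at most `σ` controls
    -- to the given ones, and a body in the dictionary starts from its anchor alone.
    obtain ⟨g, hg, ih⟩ := ih (ℓ + σ + 1)
    -- `B` bounds the cost of one node of a body, `T` the slack accumulated along a chain of
    -- recursive calls, and `C` the number of keys.
    set B : ℕ → ℕ := fun L => g L + (8 * (ℓ + σ + 1) + 4) with hB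
    set T : ℕ → ℕ := fun L => h * (A * (L + 1)) with hT
    set C : ℕ → ℕ := fun L => P.nprocs * (A * ((T L + 1) * (T L + 2)) + 1) ^ A with hC
    have hBp : PolyBdd B := hg.add (polyBdd_const _)
    have hTp : PolyBdd T :=
      (polyBdd_const h).mul ((polyBdd_const A).mul (polyBdd_id.add (polyBdd_const 1)))
    have hCp : PolyBdd C := (polyBdd_const _).mul (((polyBdd_const A).mul
      ((hTp.add (polyBdd_const 1)).mul (hTp.add (polyBdd_const 2)))).add (polyBdd_const 1) |>.pow A)
    refine ⟨fun L => B L + 20 + C L * (20 * σ + σ * B L) + σ * B L, ((hBp.add (polyBdd_const 20)).add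
      (hCp.mul ((polyBdd_const (20 * σ)).add ((polyBdd_const σ).mul hBp)))).add
      ((polyBdd_const σ).mul hBp), ?_⟩
    intro n hn p args cs next hargs hcs hnext
    have hd0 : DictShape n (⟨next, []⟩ : CState P.arity) := ⟨by simp, by simp⟩
    have hcc : ∀ p args cs next, Good n args → cs.length ≤ ℓ + σ + 1 → n ≤ next →
        CallCost n next (P.compileCall d p args cs next) (B (Nat.log 2 n)) :=
      fun p args cs next h1 h2 h3 => (ih n hn p args cs next h1 h2 h3).mono (Nat.le_add_right _ _)
    have hBl : 8 * (ℓ + σ + 1) + 4 ≤ B (Nat.log 2 n) := Nat.le_add_left _ _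
    dsimp only
    simp only [Program.compileCall]
    split_ifs with hR
    · have h1 := stmtCost_anchorMerge hn hargs cs hd0
      have h2 := callCost_compileDict (R := P.MutRec p) hn hclone
        (σ := σ) (by omega) hσ
        (fun p args cs next a1 a2 a3 => hcc p args cs next a1 (by omega) a3)
        (Q := Reached (P.MutRec p) h args)
        (fun q args' hq c hc hRc hne => hq.call hclone (hplp.recClass p) hops hc hRc hne)
        (K := keySet P (h * halvings args) fun j => (args j).length)
        (fun q args' hq => hq.mem_keySet le_rfl) (allWires args).length
        (s := (anchorMerge p args cs ⟨next, []⟩).state) (hnext.trans h1.le) h1.dict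
        (anchorMerge_dict_forall (Q := Reached (P.MutRec p) h args) (by simp)
          ⟨hR, 0, by simp, fun i => ⟨i, sizeAt_self _ _⟩⟩)
      have hcard : ((keySet P (h * halvings args) fun j => (args j).length).filter
          fun k => k.2.sum ≤ (allWires args).length).card ≤ C (Nat.log 2 n) := by
        refine (Finset.card_filter_le _ _).trans ((card_keySet_le hA (hA p) _).trans ?_)
        have hle : h * halvings args ≤ T (Nat.log 2 n) := Nat.mul_le_mul_left _
          ((halvings_le hargs).trans (Nat.mul_le_mul_right _ (hA p)))
        refine Nat.mul_le_mul_left _ (Nat.pow_le_pow_left ?_ _)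
        exact Nat.add_le_add_right (Nat.mul_le_mul_left _
          (Nat.mul_le_mul (by omega) (by omega))) _
      have hw := h1.weight
      simp only [merges, List.map_nil, List.sum_nil, zero_add] at hw
      have h3 := h2.mono (Nat.add_le_add (Nat.mul_le_mul_left 20 hw)
        (Nat.mul_le_mul_right _ hcard))
      obtain ⟨a, b, e, ca, cb⟩ := h1.gates
      have hk : 8 * cs.length + 4 + (20 * 1 + C (Nat.log 2 n) * (20 * σ + σ * B (Nat.log 2 n))) ≤
          B (Nat.log 2 n) + 20 + C (Nat.log 2 n) * (20 * σ + σ * B (Nat.log 2 n)) +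
            σ * B (Nat.log 2 n) := by omega
      refine ⟨h1.le.trans h3.le, ?_, ?_⟩
      · refine le_trans ?_ (Nat.add_le_add_left (Nat.mul_le_mul_right n hk) _)
        have i1 := h1.anc; have i2 := h3.anc
        dsimp only at i1 ⊢
        rw [add_mul (8 * cs.length + 4)]
        omega
      · exact ((ca.append h3.gates).append cb).mono (by omega)
    · have h1 := stmtCost_compile (R := fun _ => False) hn hBl hcc hargs (hclone.1 p)
        (cs := cs) (by have := hσ p; omega) (s := ⟨next, []⟩) hnext hd0
      obtain ⟨a, b, e, ca, cb⟩ := h1.gates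
      have hk : (P.body p).size * B (Nat.log 2 n) ≤
          B (Nat.log 2 n) + 20 + C (Nat.log 2 n) * (20 * σ + σ * B (Nat.log 2 n)) +
            σ * B (Nat.log 2 n) :=
        (Nat.mul_le_mul_right _ (hσ p)).trans (Nat.le_add_left _ _)
      refine ⟨h1.le, ?_, (ca.append cb).mono (by omega)⟩
      exact h1.anc.trans (Nat.add_le_add_left (Nat.mul_le_mul_right n hk) _)

/-- The size, the depth and the number of ancillas of the circuit of a program. -/
theorem cost_compile (hclone : P.NoCloning) (hplp : P.IsPolyLog) :
    ∃ c k : ℕ, ∀ len : Fin P.nvars → ℕ, 2 ≤ total len →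
      (P.compile len).size ≤ c * (total len * Nat.log 2 (total len) ^ k) ∧
      (P.compile len).depth ≤ c * Nat.log 2 (total len) ^ k ∧
      (P.compile len).ancillas ≤ c * (total len * Nat.log 2 (total len) ^ k) := by
  have hsup : ∀ g : Fin P.nprocs → ℕ, ∃ b, ∀ p, g p ≤ b := fun g =>
    ⟨∑ p, g p, fun p => Finset.single_le_sum (fun _ _ => Nat.zero_le _) (Finset.mem_univ p)⟩
  obtain ⟨σ, hσ⟩ := hsup fun p => (P.body p).size
  obtain ⟨A, hA⟩ := hsup P.arity
  -- A crude uniform bound: the operations in all arguments of all calls of a body are added up.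
  obtain ⟨h, hops⟩ := hsup fun p => ((P.body p).calls.map fun c => ∑ i, (c.2 i).ops).sum
  obtain ⟨f, ⟨c, k, hf⟩, hcc⟩ := callCost_compileCall hclone hplp hσ hA (h := h) (fun p c hc i =>
    (Finset.single_le_sum (f := fun i => (c.2 i).ops) (fun _ _ => Nat.zero_le _)
      (Finset.mem_univ i)).trans ((List.single_le_sum (fun _ _ => Nat.zero_le _) _
        (List.mem_map_of_mem hc)).trans (hops p))) P.nprocs P.main.size
  -- The exponent grows by one because the unit of depth in `Cost` is already `log n`.
  refine ⟨P.main.size * (c + (8 * P.main.size + 4)), k + 1, fun len hn => ?_⟩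
  set n := total len with hnd
  have hL := one_le_log hn
  set L := Nat.log 2 n with hLd
  have h1 := stmtCost_compile (R := fun _ => False) (cc := P.compileCall P.nprocs) hn
    (B := f L + (8 * P.main.size + 4)) (ℓ := P.main.size) (Nat.le_add_left _ _)
    (fun p args cs next a1 a2 a3 => (hcc n hn p args cs next a1 a2 a3).mono (Nat.le_add_right _ _))
    (good_wiresOf len) hclone.2 (cs := []) (by simp) (s := ⟨n, []⟩) le_rfl ⟨by simp, by simp⟩
  have hfun : (fun q => (List.range' 1 (len q)).map (wire len q)) =
      wiresOf len fun q => .var q := (funext (pointers_var len)).symm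
  obtain ⟨a, b, e, ca, cb⟩ := h1.gates
  have hgates : Cost n (P.compile len).gates (P.main.size * (f L + (8 * P.main.size + 4))) := by
    simp only [Program.compile]
    rw [hfun]
    exact (ca.append cb).mono e
  have hanc : (P.compile len).ancillas ≤ P.main.size * (f L + (8 * P.main.size + 4)) * n := by
    have := h1.anc
    simp only [Program.compile]
    rw [hfun, ← hnd]
    dsimp only at this
    omega
  have hb : P.main.size * (f L + (8 * P.main.size + 4)) ≤
      P.main.size * (c + (8 * P.main.size + 4)) * L ^ k := by
    rw [mul_assoc]
    refine Nat.mul_le_mul_left _ ?_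
    rw [add_mul]
    exact Nat.add_le_add (hf L hL) (Nat.le_mul_of_pos_right _ (Nat.pow_pos hL))
  have hpow : L ^ k ≤ L ^ (k + 1) := Nat.pow_le_pow_right hL (by omega)
  have hsize : P.main.size * (f L + (8 * P.main.size + 4)) * n ≤
      P.main.size * (c + (8 * P.main.size + 4)) * (n * L ^ (k + 1)) := by
    refine (Nat.mul_le_mul_right _ (hb.trans (Nat.mul_le_mul_left _ hpow))).trans_eq ?_
    ring
  refine ⟨hgates.size.trans hsize, ?_, hanc.trans hsize⟩
  refine hgates.depth.schedule_le.trans ((Nat.mul_le_mul_right _ hb).trans_eq ?_)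
  rw [pow_succ]; ring

end

end PLP

/-! ### Error-freeness of the unrolling, and the theorem. -/

namespace PLP

section

variable {P : Program}

/-- Accessibility depends on the lengths alone. A tree that is not `Ok` produces an error from every
input vector, so the zero vector is enough for the contradiction. -/
theorem Program.ErrorFree.tree_ok (h : P.ErrorFree) (hclone : P.NoCloning) (hrec : P.RecHalving)
    (len : Fin P.nvars → ℕ) :
    (P.main.tree P.unroll (wiresOf len fun q => .var q)).Ok
      (accWires len fun q => Set.Icc 1 (len q)) := by
  by_contra hok
  obtain ⟨ψ', hψ⟩ := (executes_main hclone hrec (fun q => Set.Icc 1 (len q))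
    (fun _ => le_rfl) 0).2 hok
  exact h len 0 ψ' hψ

theorem accWires_subset {m : ℕ} (len : Fin m → ℕ) :
    (accWires len fun q => Set.Icc 1 (len q)) ⊆ Set.Iio (total len) := by
  rintro _ ⟨q, k, hk, rfl⟩
  exact wire_lt_total len hk

end

end PLP

theorem theorem4 (P : PLP.Program) (hclone : P.NoCloning) (hplp : P.IsPolyLog) :
    (∃ c k : ℕ, ∀ len : Fin P.nvars → ℕ, 2 ≤ PLP.total len →
      (P.compile len).size ≤ c * (PLP.total len * Nat.log 2 (PLP.total len) ^ k) ∧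
      (P.compile len).depth ≤ c * Nat.log 2 (PLP.total len) ^ k) ∧
    (P.ErrorFree →
      ∃ F : (len : Fin P.nvars → ℕ) → Matrix.unitaryGroup (Fin (PLP.total len) → Fin 2) ℂ,
        P.Computes F ∧
        (∀ len, (P.compile len).Implements (F len)) ∧
        PLP.QNC PLP.total F) := by
  obtain ⟨c, k, hck⟩ := PLP.cost_compile hclone hplp
  refine ⟨⟨c, k, fun len hn => ⟨(hck len hn).1, (hck len hn).2.1⟩⟩, fun herr => ?_⟩
  have hok := fun len => herr.tree_ok hclone hplp.1 len
  have hlt : ∀ len : Fin P.nvars → ℕ, ∀ g ∈ (P.main.tree P.unroll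
      (PLP.wiresOf len fun q => .var q)).gates, g.wires.Nodup ∧ ∀ w ∈ g.wires, w < PLP.total len :=
    fun len g hg => ⟨(hok len).nodup g hg,
      fun w hw => PLP.accWires_subset len ((hok len).wiresIn.gates g hg w hw)⟩
  choose F hF using fun len => PLP.exists_unitary (hlt len)
  have himp : ∀ len, (P.compile len).Implements (F len) := fun len => by
    obtain ⟨h1, h2⟩ := PLP.compile_correct hclone hplp len (PLP.accWires_subset len) (hok len)
    exact ⟨h1, fun ψ => by rw [h2 ψ, hF len]⟩
  -- The ancillas are bounded by a multiple of `n * log n ^ k`, hence of `n ^ (k + 1)`.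
  refine ⟨F, ?_, himp, k, k + 1, c, P.compile, fun len => ⟨himp len, fun hn => ?_⟩⟩
  · intro len ψ ψ'
    have hrun := (PLP.executes_main hclone hplp.1 (fun q => Set.Icc 1 (len q))
      (fun _ => le_rfl) ψ).1 (hok len)
    rw [hF len] at hrun
    constructor
    · intro h
      exact PLP.Exec.top_unique h rfl hrun
    · rintro rfl
      exact hrun
  · refine ⟨(hck len hn).2.1, (hck len hn).2.2.trans (Nat.mul_le_mul_left _ ?_)⟩
    rw [pow_succ, mul_comm]
    exact Nat.mul_le_mul_right _ (Nat.pow_le_pow_left (Nat.log_le_self _ _) _)
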